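/- **Setting.** Let $w=w_1\cdots w_n$ be a word over an arbitrary alphabet, let $\#$ be an end-marker that is not a letter, and let $\gamma=[i\,..\,j]$ with $1\le i\le j\le n$ be an interval of positions, $|\gamma|=j-i+1$. *Induced suffix trees.* $T(\gamma)$ is the compacted trie of the words $w[k\,..\,n]\#$, $k\in\gamma$. Its nodes are the prefixes of these words; the explicit nodes are the root, the leaves $w[k\,..\,n]\#$ (labelled $k$) and the branching nodes. For a node $v$, $|v|$ is the number of letters of $v$ other than $\#$; $\mathrm{parent}(v,\gamma)$ is the longest explicit node of $T(\gamma)$ that is a proper prefix of $v$ (the root is its own parent); $\mathrm{Occ}(v,\gamma)$ is the set of all $k\in\gamma$ such that $v$ is a prefix of $w[k\,..\,n]\#$. *Quasigaps.* For a finite set $X$ of integers let $\mathrm{maxgap}(X)$ be the largest difference of two consecutive elements of $X$ ($0$ if $|X|\le1$). If $\mathrm{Occ}(v,\gamma)\neq\emptyset$, let $\ell_1,\ell_2$ be its minimum and maximum and $$M=\max\Bigl(\mathrm{maxgap}(\mathrm{Occ}(v,\gamma)),\ \ell_1-i+1,\ \bigl\lceil\tfrac{j-\ell_2}{2}\bigr\rceil+1,\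 |\mathrm{parent}(v,\gamma)|+1\Bigr).$$ Then $\mathrm{quasigap}(v,\gamma)=M$ if $M\le|v|$, and $\mathrm{quasigap}(v,\gamma)=\infty$ if $M>|v|$ or $\mathrm{Occ}(v,\gamma)=\emptyset$. *Reduced staircases.* A factorization of a word $u$ is a sequence $(f_1,\dots,f_r)$ with $u=f_1\cdots f_r$ in which each $f_q$ is a subword of $f_1\cdots f_{q-1}$ or a single letter; an $f$-factorization is one with the least number of factors. For $N=|\gamma|$ and $1\le m\le N$, the $m$-staircase covering $\gamma$ consists of the intervals which, with positions counted from the beginning of $\gamma$, are $[km+1\,..\,(k+3)m]\cap[1\,..\,N]$, $k=0,1,\dots,\max(0,\lceil N/m\rceil-3)$. Given an $f$-factorization $F$ of $w[i\,..\,j]$, the reduced $m$-staircase $\mathcal K$ consists of those intervals $[a\,..\,b]$ of the $m$-staircase for which the extended interval $[a\,..\,b+m]$ of positions is not contained in the set of positions of a single factor of $F$ (in particular, $[a\,..\,b]$ is kept whenever $b+m>j$). Let $\|\mathcal K\|$ be the total length of the intervals in $\mathcal K$. *The problem Merge$(\gamma,\mathcal K)$.* Input: $\gamma$ and $m$; the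 tree $T(\gamma)$, given by the number of its explicit nodes and, for each of them (numbered $0,1,2,\dots$ in an arbitrary order), the number of its parent, its length $|v|$, and its label if it is a leaf; and, for every $\lambda\in\mathcal K$ (in an arbitrary order), the endpoints of $\lambda$ and the list of all explicit nodes $u$ of $T(\lambda)$, which are also explicit nodes of $T(\gamma)$ and are referred to by their numbers there, each with $\mathrm{parent}(u,\lambda)$ and $\mathrm{quasigap}(u,\lambda)$. Output: for every explicit node $v$ of $T(\gamma)$, the exact value of $\mathrm{quasigap}(v,\gamma)$ if it is at most $m$, and otherwise the information that it is larger than $m$. **Statement.** Merge$(\gamma,\mathcal K)$ can be solved in $O(|\gamma|+\|\mathcal K\|)$ time on a word RAM with words of at least $\log_2 n+O(1)$ bits. That is, there are one program and one constant $C$ such that for all $w$, $\gamma$, $m$ with $1\le m\le|\gamma|$, all $f$-factorizations $F$ of $w[i\,..\,j]$ with the corresponding $\mathcal K$, all orders in which the input is listed, and all word lengths $W$ with $C\,n\le 2^W$, the program halts with the correct output after at most $C(|\gamma|+\|\mathcal K\|)$ steps. -/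

import Mathlib

namespace SeedMerge

/-! ## Words, intervals, factorizations, staircases -/

/-- The interval `[lo .. hi]` of (1-based) positions. -/
structure Interval where
  lo : ℕ
  hi : ℕ

/-- The number of positions of an interval. -/
def Interval.length (γ : Interval) : ℕ := γ.hi + 1 - γ.lo

/-- The total length of the intervals of a family. -/
def totalLength (K : List Interval) : ℕ := (K.map Interval.length).sum

/-- `γ` is a nonempty interval of positions of `w`. -/
def IsIntervalOf {α : Type} (w : List α) (γ : Interval) : Prop :=
  1 ≤ γ.lo ∧ γ.lo ≤ γ.hi ∧ γ.hi ≤ w.length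

/-- The factor `w[lo .. hi]` of `w`. -/
def subword {α : Type} (w : List α) (γ : Interval) : List α :=
  (w.drop (γ.lo - 1)).take γ.length

/-- `F = (f₁, …, f_K)` is a factorization of `u`: `u = f₁ ⋯ f_K`, and each `f_k` is a subword of
`f₁ ⋯ f_{k-1}` or a single letter. -/
def IsFactorization {α : Type} (u : List α) (F : List (List α)) : Prop :=
  F.flatten = u ∧
    ∀ (k : ℕ) (hk : k < F.length), F[k] <:+: (F.take k).flatten ∨ F[k].length = 1

/-- An f-factorization: a factorization with the minimal number of factors. -/
def IsFFactorization {α : Type} (u : List α) (F : List (List α)) : Prop :=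
  IsFactorization u F ∧ ∀ G : List (List α), IsFactorization u G → F.length ≤ G.length

/-- `l` belongs to the `m`-staircase covering `γ`. Relative to `γ`, whose length is `N`, the
intervals of the staircase are `[k·m + 1 .. (k+3)·m] ∩ [1 .. N]` for
`k = 0, …, max (0, ⌈N/m⌉ - 3)`. -/
def InStaircase (γ : Interval) (m : ℕ) (l : Interval) : Prop :=
  ∃ k : ℕ, k ≤ (γ.length ⌈/⌉ m) - 3 ∧
    l.lo = γ.lo + k * m ∧ l.hi = min (γ.lo + (k + 3) * m - 1) γ.hi

/-- All positions of `l` lie within a single factor of the factorization `F` of the factor of the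
word at `γ`. (The factor `F[k]` starts at the position `γ.lo + |f₁ ⋯ f_{k-1}|`.) -/
def WithinSingleFactor {α : Type} (γ : Interval) (F : List (List α)) (l : Interval) : Prop :=
  ∃ (k : ℕ) (hk : k < F.length),
    γ.lo + (F.take k).flatten.length ≤ l.lo ∧
    l.hi < γ.lo + (F.take k).flatten.length + F[k].length

/-- `K` lists, without repetition and in any order, the intervals `[i .. j]` of the `m`-staircase
covering `γ` whose extension `[i .. j + m]` does not lie within a single factor of `F`. -/
def IsReducedStaircase {α : Type} (γ : Interval) (m : ℕ) (F : List (List α))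
    (K : List Interval) : Prop :=
  K.Nodup ∧ ∀ l : Interval,
    l ∈ K ↔ InStaircase γ m l ∧ ¬ WithinSingleFactor γ F ⟨l.lo, l.hi + m⟩

/-! ## Induced suffix trees

Nodes, explicit or implicit, are words over the alphabet extended by the end-marker `none`. -/

/-- The suffix of `w#` starting at the position `k`. -/
def markedSuffix {α : Type} (w : List α) (k : ℕ) : List (Option α) :=
  (w.map some ++ [none]).drop (k - 1)

/-- `|v|`: the length of the subword of `w` represented by a node `v`, that is, the number of
letters of `v` other than the end-marker. -/
def nodeLength {α : Type} (v : List (Option α)) : ℕ := v.reduceOption.length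

open Classical in
/-- `Occ(v, γ)`: the starting positions in `γ` of the occurrences of `v`; equivalently, the labels
of the leaves of `T(γ)` in the subtree of `v`. -/
noncomputable def occ {α : Type} (w : List α) (v : List (Option α)) (γ : Interval) : Finset ℕ :=
  (Finset.Icc γ.lo γ.hi).filter fun k => v <+: markedSuffix w k

/-- `v` is a node (explicit or implicit) of `T(γ)`: it lies on the path from the root to a leaf
labelled with an element of `γ`. -/
def IsNode {α : Type} (w : List α) (γ : Interval) (v : List (Option α)) : Prop :=
  (occ w v γ).Nonempty

/-- `v` is the leaf of `T(γ)` labelled with `k`. -/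
def IsLeaf {α : Type} (w : List α) (γ : Interval) (v : List (Option α)) (k : ℕ) : Prop :=
  γ.lo ≤ k ∧ k ≤ γ.hi ∧ v = markedSuffix w k

/-- `v` is an explicit node of `T(γ)`: the root, a leaf, or a branching node. -/
def IsExplicit {α : Type} (w : List α) (γ : Interval) (v : List (Option α)) : Prop :=
  v = [] ∨ (∃ k, IsLeaf w γ v k) ∨
    ∃ a b : Option α, a ≠ b ∧ IsNode w γ (v ++ [a]) ∧ IsNode w γ (v ++ [b])

open Classical in
/-- `parent(v, γ)`: the longest explicit node of `T(γ)` that is a proper prefix of `v`; the root is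
its own parent. -/
noncomputable def parent {α : Type} (w : List α) (γ : Interval) (v : List (Option α)) :
    List (Option α) :=
  v.take (Nat.findGreatest (fun d => d < v.length ∧ IsExplicit w γ (v.take d)) v.length)

/-! ## Quasigaps -/

/-- The maximum difference of consecutive elements of `X`, and `0` if `X` has at most one
element. -/
def maxgap (X : Finset ℕ) : ℕ :=
  ((X ×ˢ X).filter fun p => p.1 < p.2 ∧ ∀ c ∈ X, ¬ (p.1 < c ∧ c < p.2)).sup fun p => p.2 - p.1

open Classical in
/-- `quasigap(v, γ)`, an element of `ℕ ∪ {∞}`. -/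
noncomputable def quasigap {α : Type} (w : List α) (v : List (Option α)) (γ : Interval) : ℕ∞ :=
  if h : (occ w v γ).Nonempty then
    let first := (occ w v γ).min' h
    let last := (occ w v γ).max' h
    let M := max (max (maxgap (occ w v γ)) (first - γ.lo + 1))
      (max ((γ.hi - last) ⌈/⌉ 2 + 1) (nodeLength (parent w γ v) + 1))
    if M ≤ nodeLength v then (M : ℕ∞) else ⊤
  else ⊤

/-! ## The word RAM -/

/-- Instructions. `d`, `a`, `b` are names of registers, `t` is a position in the program. -/
inductive Instr where
  /-- `d := c` -/
  | const (d c : ℕ)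
  /-- `d := a + b` -/
  | add (d a b : ℕ)
  /-- `d := max (a - b, 0)` -/
  | sub (d a b : ℕ)
  /-- `d := a * b` -/
  | mul (d a b : ℕ)
  /-- `d := ⌊a / b⌋` -/
  | div (d a b : ℕ)
  /-- `d :=` the content of the memory cell whose address is in `a` -/
  | load (d a : ℕ)
  /-- the memory cell whose address is in `a` receives the content of `b` -/
  | store (a b : ℕ)
  /-- if `a < b`, continue at `t` -/
  | jumpLt (a b t : ℕ)
  /-- continue at `t` -/
  | jump (t : ℕ)

/-- A program is a finite list of instructions. -/
abbrev Program := List Instr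

/-- A configuration: program counter, registers and memory. -/
structure Config where
  pc : ℕ
  reg : ℕ → ℕ
  mem : ℕ → ℕ

/-- Write a value into a register, reduced to a `W`-bit word, and continue with the next
instruction. -/
def Config.setReg (W : ℕ) (c : Config) (d x : ℕ) : Config :=
  { c with pc := c.pc + 1, reg := Function.update c.reg d (x % 2 ^ W) }

/-- The effect of one instruction on a machine with `W`-bit words. -/
def Instr.exec (W : ℕ) (c : Config) : Instr → Config
  | .const d x => c.setReg W d x
  | .add d a b => c.setReg W d (c.reg a + c.reg b)
  | .sub d a b => c.setReg W d (c.reg a - c.reg b)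
  | .mul d a b => c.setReg W d (c.reg a * c.reg b)
  | .div d a b => c.setReg W d (c.reg a / c.reg b)
  | .load d a => c.setReg W d (c.mem (c.reg a))
  | .store a b => { c with pc := c.pc + 1, mem := Function.update c.mem (c.reg a) (c.reg b) }
  | .jumpLt a b t => { c with pc := if c.reg a < c.reg b then t else c.pc + 1 }
  | .jump t => { c with pc := t }

/-- The machine has halted when the program counter is outside the program. -/
def Config.Halted (P : Program) (c : Config) : Prop := P.length ≤ c.pc

/-- One step; each executed instruction costs one unit of time. -/
def step (W : ℕ) (P : Program) (c : Config) : Config :=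
  match P[c.pc]? with
  | some instr => instr.exec W c
  | none => c

/-- The configuration reached after `t` steps. -/
def run (W : ℕ) (P : Program) (t : ℕ) (c : Config) : Config := (step W P)^[t] c

/-- The initial configuration: the input occupies the memory cells `0, 1, 2, …`; all other cells
and all registers hold `0`, and the program starts at its first instruction. -/
def initial (input : List ℕ) : Config where
  pc := 0
  reg := fun _ => 0
  mem := fun a => input.getD a 0

/-! ## Input and output of Merge -/

/-- `V` lists the explicit nodes of `T(γ)`, each once, in any order. The index of a node in the list
`V` for the tree `T(γ)` serves as the identifier of that node. -/
def Enumerates {α : Type} (w : List α) (γ : Interval) (V : List (List (Option α))) : Prop :=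
  V.Nodup ∧ ∀ v, v ∈ V ↔ IsExplicit w γ v

open Classical in
/-- The identifier of the node `v`. -/
noncomputable def nodeId {α : Type} (V : List (List (Option α))) (v : List (Option α)) : ℕ :=
  V.idxOf v

open Classical in
/-- The label of `v` if `v` is a leaf of `T(γ)`, and `0` otherwise. -/
noncomputable def leafLabel {α : Type} (w : List α) (γ : Interval) (v : List (Option α)) : ℕ :=
  if h : ∃ k, IsLeaf w γ v k then h.choose else 0

/-- A quasigap as a machine word. All quasigaps are positive, so that `0` can stand for `∞`. -/
noncomputable def encodeGap (x : ℕ∞) : ℕ := x.toNat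

/-- The tree `T(γ)`: the number of its explicit nodes and, for each explicit node in the order of
identifiers, the identifier of its parent, its length, and its leaf label. -/
noncomputable def encodeTree {α : Type} (w : List α) (γ : Interval) (V : List (List (Option α))) :
    List ℕ :=
  V.length :: V.flatMap fun v => [nodeId V (parent w γ v), nodeLength v, leafLabel w γ v]

/-- The interval `l`, its induced tree `T(l)` and the quasigaps in `l`: the endpoints of `l`, the
number of explicit nodes of `T(l)` and, for each of them, its identifier, the identifier of its
parent in `T(l)` and its quasigap in `l`. The explicit nodes of `T(l)`, which are explicit nodes of
`T(γ)` as well, are listed by `U` and keep their identifiers from `T(γ)`. -/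
noncomputable def encodeSubtree {α : Type} (w : List α) (V : List (List (Option α)))
    (l : Interval) (U : List (List (Option α))) : List ℕ :=
  l.lo :: l.hi :: U.length ::
    U.flatMap fun u => [nodeId V u, nodeId V (parent w l u), encodeGap (quasigap w u l)]

/-- The input of Merge. -/
noncomputable def mergeInput {α : Type} (w : List α) (γ : Interval) (m : ℕ) (K : List Interval)
    (V : List (List (Option α))) (U : Interval → List (List (Option α))) : List ℕ :=
  [γ.lo, γ.hi, m] ++ encodeTree w γ V ++
    K.length :: K.flatMap fun l => encodeSubtree w V l (U l)

open Classical in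
/-- What Merge has to report for the node `v`: its quasigap in `γ` if this is at most `m`, and `0`,
which stands for "larger than `m`", otherwise. -/
noncomputable def smallQuasigap {α : Type} (w : List α) (γ : Interval) (m : ℕ)
    (v : List (Option α)) : ℕ :=
  if quasigap w v γ ≤ (m : ℕ∞) then encodeGap (quasigap w v γ) else 0

end SeedMerge

/-! The proof reduces quasigaps in `γ` to a problem on one tree with weighted vertical paths, solves
that problem in linear time, and runs the solution on the RAM.

Locality. Let `v` be an explicit node of `T(γ)` other than the root, `g ≤ m`, and `g' = min g |v|`.
Then quasigap(`v`, `γ`) `≤ g` says that `|parent(v, γ)| < g'` and that Occ(`v`, `γ`) is `Dense` with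
parameter `g'`: every window of `g'` positions that starts no later than the last occurrence
contains the start of an occurrence, and the last occurrence is close to the end of `γ`. Because
`g'` exceeds the length of the parent, the prefix of `v` of length `g'` has the same occurrences as
`v`, and this prefix is short compared with the staircase. Density passes from `γ` to all intervals
of the staircase (`Dense.of_staircase`). Conversely, density in the kept intervals suffices
(`dense_of_reducedStaircase`): around a window that is served by a removed interval the word repeats
an earlier part, because the extended interval lies in one factor, so induction on the position of
the window applies.

From intervals to edges. For an interval `λ` of the reduced staircase, `v` lies on at most one edge
of `T(λ)`, say the one leading to `u` (`Covers`), and then `v` and `u` have the same occurrences in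
`λ`. Moreover `parent(u, λ)` is a prefix of `parent(v, γ)`, so density of `v` in `λ` amounts to
quasigap(`u`, `λ`) `≤ g'`. Hence quasigap(`v`, `γ`), where it is at most `m`, is the maximum of
`|parent(v, γ)| + 1` and the weights of the edges through `v`, provided that every `λ` has an edge
of finite weight through `v` and that the maximum is at most `|v|`.

The tree problem. An edge of `T(λ)` is a vertical path of `T(γ)`, from `u` up to, but excluding, `p
= parent(u, λ)`. The number of paths through each node follows from the numbers of path ends by one
bottom-up pass (`Arbor.cov_add`). For the maxima, each weight is stored only at the top node of its
path, the child `a` of `p` towards `u`, and the maximum over all ancestors of `v` is taken. This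
includes weights of paths that miss `v`, but they do no harm when `v` occurs in every `λ`: if the
path ends above `v`, its weight is at most `|u| ≤ |parent(v, γ)|`; and it cannot branch off the way
to `v` below `a`, since the branching point would be an explicit node of `T(λ)` strictly inside an
edge.

Finding `a` in constant time is the remaining point (`TreeInput.Tables.attach_iff`). Only nodes that
occur in every `λ` ("full" nodes) matter. A node with two full children branches in every `T(λ)`, so
no path runs through it from below. Thus, if `p` has two or more full children, `a` is the nearest
ancestor of the lowest full ancestor of `u` whose parent has at least two full children; if `p` has
one full child, `a` can only be that child. Both pointers are tabulated by a bottom-up and a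
top-down pass.

The machine. The program is written in a small structured language with records, compiled to RAM
code, and verified by Hoare triples that carry running times. Nodes are visited in a topological
order obtained with a queue. Linearity rests on `T(λ)` having at most `2|λ| + 1` explicit nodes. -/

namespace SeedMerge

/-! ## A structured language on top of the word RAM -/

/-- A state of the structured language: registers, the low memory cells, and an unbounded supply of
records, `g k v` being the field `k` of the record `v`. -/
structure St where
  reg : ℕ → ℕ
  inp : ℕ → ℕ
  g : ℕ → ℕ → ℕ

namespace St

def setReg (σ : St) (d x : ℕ) : St := { σ with reg := Function.update σ.reg d x }

def setInp (σ : St) (a x : ℕ) : St := { σ with inp := Function.update σ.inp a x }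

def setG (σ : St) (k v x : ℕ) : St :=
  { σ with g := Function.update σ.g k (Function.update (σ.g k) v x) }

@[simp] theorem setReg_inp (σ : St) (d x : ℕ) : (σ.setReg d x).inp = σ.inp := rfl
@[simp] theorem setReg_g (σ : St) (d x : ℕ) : (σ.setReg d x).g = σ.g := rfl
@[simp] theorem setInp_reg (σ : St) (d x : ℕ) : (σ.setInp d x).reg = σ.reg := rfl
@[simp] theorem setInp_g (σ : St) (d x : ℕ) : (σ.setInp d x).g = σ.g := rfl
@[simp] theorem setG_reg (σ : St) (k v x : ℕ) : (σ.setG k v x).reg = σ.reg := rfl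
@[simp] theorem setG_inp (σ : St) (k v x : ℕ) : (σ.setG k v x).inp = σ.inp := rfl

theorem setReg_reg (σ : St) (d x r : ℕ) :
    (σ.setReg d x).reg r = if r = d then x else σ.reg r := by
  simp [setReg, Function.update_apply]

theorem setInp_inp (σ : St) (a x b : ℕ) :
    (σ.setInp a x).inp b = if b = a then x else σ.inp b := by
  simp [setInp, Function.update_apply]

theorem setG_g (σ : St) (k v x k' v' : ℕ) :
    (σ.setG k v x).g k' v' = if k' = k then (if v' = v then x else σ.g k v') else σ.g k' v' := by
  by_cases h : k' = k
  · subst h; simp [setG, Function.update_apply]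
  · simp [setG, h]

end St

/-- Commands of the structured language. -/
inductive Cmd where
  | const (d c : ℕ)
  | add (d a b : ℕ)
  | sub (d a b : ℕ)
  /-- `d` receives the content of the low memory cell whose address is in `a`. -/
  | rd (d a : ℕ)
  /-- The low memory cell whose address is in `a` receives `b`. -/
  | wr (a b : ℕ)
  /-- `d` receives the field `k` of the record whose number is in `a`. -/
  | ld (d k a : ℕ)
  /-- The field `k` of the record whose number is in `a` receives `b`. -/
  | st (k a b : ℕ)
  | skip
  | seq (c₁ c₂ : Cmd)
  | ifLt (a b : ℕ) (c₁ c₂ : Cmd)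
  | whileLt (a b : ℕ) (c : Cmd)

infixr:60 " ;; " => Cmd.seq

/-- The size of the compiled code. -/
def Cmd.sz : Cmd → ℕ
  | .const _ _ => 1
  | .add _ _ _ => 1
  | .sub _ _ _ => 1
  | .rd _ _ => 1
  | .wr _ _ => 1
  | .ld _ _ _ => 5
  | .st _ _ _ => 5
  | .skip => 0
  | .seq c₁ c₂ => c₁.sz + c₂.sz
  | .ifLt _ _ c₁ c₂ => c₁.sz + c₂.sz + 2
  | .whileLt _ _ c => c.sz + 3

/-- The compiled code, to be placed at the position `off`. The machine registers `0` and `1` are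
scratch registers, `2` holds the address of the records, and `3` holds `16`. -/
def Cmd.comp : Cmd → ℕ → Program
  | .const d c, _ => [.const (d + 4) c]
  | .add d a b, _ => [.add (d + 4) (a + 4) (b + 4)]
  | .sub d a b, _ => [.sub (d + 4) (a + 4) (b + 4)]
  | .rd d a, _ => [.load (d + 4) (a + 4)]
  | .wr a b, _ => [.store (a + 4) (b + 4)]
  | .ld d k a, _ => [.mul 0 (a + 4) 3, .add 0 0 2, .const 1 k, .add 0 0 1, .load (d + 4) 0]
  | .st k a b, _ => [.mul 0 (a + 4) 3, .add 0 0 2, .const 1 k, .add 0 0 1, .store 0 (b + 4)]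
  | .skip, _ => []
  | .seq c₁ c₂, off => c₁.comp off ++ c₂.comp (off + c₁.sz)
  | .ifLt a b c₁ c₂, off =>
      .jumpLt (a + 4) (b + 4) (off + c₂.sz + 2) :: (c₂.comp (off + 1) ++
        .jump (off + (c₁.sz + c₂.sz + 2)) :: c₁.comp (off + c₂.sz + 2))
  | .whileLt a b c, off =>
      .jumpLt (a + 4) (b + 4) (off + 2) :: .jump (off + (c.sz + 3)) ::
        (c.comp (off + 2) ++ [.jump off])

theorem Cmd.length_comp (c : Cmd) : ∀ off, (c.comp off).length = c.sz := by
  induction c with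
  | seq c₁ c₂ h₁ h₂ => intro off; simp [Cmd.comp, Cmd.sz, h₁, h₂]
  | ifLt a b c₁ c₂ h₁ h₂ => intro off; simp [Cmd.comp, Cmd.sz, h₁, h₂]; omega
  | whileLt a b c h => intro off; simp [Cmd.comp, Cmd.sz, h]
  | _ => intro off; simp [Cmd.comp, Cmd.sz]

/-- The code `l` occupies the positions of `P` from `off` on. -/
def CodeAt (P : Program) (off : ℕ) (l : Program) : Prop :=
  ∀ i (h : i < l.length), P[off + i]? = some l[i]

theorem CodeAt.left {P off l₁ l₂} (h : CodeAt P off (l₁ ++ l₂)) : CodeAt P off l₁ := by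
  intro i hi
  have := h i (by simp; omega)
  rwa [List.getElem_append_left hi] at this

theorem CodeAt.right {P off l₁ l₂} (h : CodeAt P off (l₁ ++ l₂)) :
    CodeAt P (off + l₁.length) l₂ := by
  intro i hi
  have := h (l₁.length + i) (by simp; omega)
  rw [List.getElem_append_right (by omega)] at this
  simpa [add_assoc] using this

theorem CodeAt.head {P off i l} (h : CodeAt P off (i :: l)) : P[off]? = some i :=
  h 0 (by simp)

theorem CodeAt.tail {P off i l} (h : CodeAt P off (i :: l)) : CodeAt P (off + 1) l := by
  have := CodeAt.right (l₁ := [i]) (l₂ := l) h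
  simpa using this

/-! ### Simulation of structured states by machine configurations -/

/-- The machine configuration `c` represents the state `σ`; the records are stored from the address
`B` on, and all machine words have `W` bits. -/
structure Rel (W B : ℕ) (σ : St) (c : Config) : Prop where
  reg : ∀ r, c.reg (r + 4) = σ.reg r
  base : c.reg 2 = B
  sixteen : c.reg 3 = 16
  inp : ∀ a, a < B → c.mem a = σ.inp a
  g : ∀ k, k < 16 → ∀ v, c.mem (B + 16 * v + k) = σ.g k v
  reg_lt : ∀ r, c.reg r < 2 ^ W
  mem_lt : ∀ a, c.mem a < 2 ^ W

/-- The code `c`, started in the state `σ`, ends after at most `T` steps in a state with `Q`. -/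
def Tri (W B : ℕ) (c : Cmd) (σ : St) (T : ℕ) (Q : St → Prop) : Prop :=
  ∀ (P : Program) (off : ℕ), CodeAt P off (c.comp off) → ∀ cfg : Config, cfg.pc = off →
    Rel W B σ cfg → ∃ t ≤ T, ∃ σ', Rel W B σ' (run W P t cfg) ∧
      (run W P t cfg).pc = off + c.sz ∧ Q σ'

theorem run_add (W : ℕ) (P : Program) (s t : ℕ) (c : Config) :
    run W P (s + t) c = run W P t (run W P s c) := by
  simp only [run]
  rw [add_comm, Function.iterate_add_apply]

theorem run_zero (W : ℕ) (P : Program) (c : Config) : run W P 0 c = c := rfl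

theorem run_succ (W : ℕ) (P : Program) (t : ℕ) (c : Config) :
    run W P (t + 1) c = run W P t (step W P c) := by
  simp only [run, Function.iterate_succ_apply]

theorem step_of_getElem? {W : ℕ} {P : Program} {c : Config} {i : Instr}
    (h : P[c.pc]? = some i) : step W P c = i.exec W c := by
  simp [step, h]

theorem Rel.congr_pc {W B σ c} (h : Rel W B σ c) (p : ℕ) : Rel W B σ { c with pc := p } :=
  ⟨h.reg, h.base, h.sixteen, h.inp, h.g, h.reg_lt, h.mem_lt⟩

theorem Rel.setReg {W B σ c} (h : Rel W B σ c) (d x : ℕ) (hx : x < 2 ^ W) :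
    Rel W B (σ.setReg d x) (c.setReg W (d + 4) x) := by
  have hx' : x % 2 ^ W = x := Nat.mod_eq_of_lt hx
  constructor
  · intro r
    simp [Config.setReg, Function.update_apply, hx', St.setReg_reg, h.reg]
  · simp [Config.setReg, h.base]
  · simp [Config.setReg, h.sixteen]
  · exact h.inp
  · exact h.g
  · intro r
    simp only [Config.setReg, Function.update_apply, hx']
    split_ifs
    · exact hx
    · exact h.reg_lt r
  · exact h.mem_lt

/-- The machine registers `0` and `1` represent no register of the structured state, so the address
computations may use them freely. -/
theorem Rel.scratch {W B σ c} (h : Rel W B σ c) (d x : ℕ) (hd : d < 2) :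
    Rel W B σ (c.setReg W d x) := by
  constructor
  · intro r
    simp [Config.setReg, show r + 4 ≠ d by omega, h.reg]
  · simp [Config.setReg, show 2 ≠ d by omega, h.base]
  · simp [Config.setReg, show 3 ≠ d by omega, h.sixteen]
  · exact h.inp
  · exact h.g
  · intro r
    simp only [Config.setReg, Function.update_apply]
    split_ifs
    · exact Nat.mod_lt _ (by positivity)
    · exact h.reg_lt r
  · exact h.mem_lt

/-! ### Hoare rules with running times -/

namespace Tri

variable {W B : ℕ}

theorem mono {c σ T T' Q Q'} (h : Tri W B c σ T Q) (hT : T ≤ T') (hQ : ∀ σ', Q σ' → Q' σ') :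
    Tri W B c σ T' Q' := by
  intro P off hc cfg hpc hr
  obtain ⟨t, ht, σ', h1, h2, h3⟩ := h P off hc cfg hpc hr
  exact ⟨t, ht.trans hT, σ', h1, h2, hQ _ h3⟩

theorem skip {σ} {Q : St → Prop} (h : Q σ) : Tri W B .skip σ 0 Q := by
  intro P off _ cfg hpc hr
  exact ⟨0, le_rfl, σ, hr, by simp [run_zero, Cmd.sz, hpc], h⟩

theorem seq {c₁ c₂ σ T₁ T₂ Q R} (h₁ : Tri W B c₁ σ T₁ R) (h₂ : ∀ σ', R σ' → Tri W B c₂ σ' T₂ Q) :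
    Tri W B (c₁ ;; c₂) σ (T₁ + T₂) Q := by
  intro P off hc cfg hpc hr
  simp only [Cmd.comp] at hc
  obtain ⟨t₁, ht₁, σ₁, r₁, p₁, q₁⟩ := h₁ P off hc.left cfg hpc hr
  have hc₂ := hc.right
  rw [Cmd.length_comp] at hc₂
  obtain ⟨t₂, ht₂, σ₂, r₂, p₂, q₂⟩ := h₂ σ₁ q₁ P _ hc₂ _ p₁ r₁
  refine ⟨t₁ + t₂, by omega, σ₂, ?_, ?_, q₂⟩
  · rwa [run_add]
  · rw [run_add, p₂, Cmd.sz, add_assoc]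

/-- A single instruction that writes a register. -/
theorem setReg_rule {c : Cmd} {i : Instr} {d x σ} {Q : St → Prop}
    (hcomp : ∀ off, c.comp off = [i]) (hsz : c.sz = 1)
    (hi : ∀ cfg, Rel W B σ cfg → i.exec W cfg = cfg.setReg W (d + 4) x)
    (hx : x < 2 ^ W) (hQ : Q (σ.setReg d x)) : Tri W B c σ 1 Q := by
  intro P off hc cfg hpc hr
  rw [hcomp] at hc
  have h0 := hc.head
  rw [← hpc] at h0
  refine ⟨1, le_rfl, _, ?_, ?_, hQ⟩
  · rw [run_succ, run_zero, step_of_getElem? h0, hi cfg hr]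
    exact hr.setReg d x hx
  · rw [run_succ, run_zero, step_of_getElem? h0, hi cfg hr, hsz, ← hpc]
    rfl

theorem const {d x σ} {Q : St → Prop} (hx : x < 2 ^ W) (hQ : Q (σ.setReg d x)) :
    Tri W B (.const d x) σ 1 Q :=
  setReg_rule (fun _ => rfl) rfl (fun _ _ => rfl) hx hQ

theorem add {d a b σ} {Q : St → Prop} (hx : σ.reg a + σ.reg b < 2 ^ W)
    (hQ : Q (σ.setReg d (σ.reg a + σ.reg b))) : Tri W B (.add d a b) σ 1 Q :=
  setReg_rule (fun _ => rfl) rfl (fun _ h => by simp [Instr.exec, h.reg]) hx hQ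

theorem sub {d a b σ} {Q : St → Prop}
    (hQ : Q (σ.setReg d (σ.reg a - σ.reg b))) : Tri W B (.sub d a b) σ 1 Q := by
  intro P off hc cfg hpc hr
  -- A truncated difference is bounded by a register, which already is a word; hence `sub` needs no
  -- overflow hypothesis.
  have hx : σ.reg a - σ.reg b < 2 ^ W := by
    have := hr.reg_lt (a + 4)
    rw [hr.reg] at this
    omega
  exact setReg_rule (c := .sub d a b) (fun _ => rfl) rfl
    (fun _ h => by simp [Instr.exec, h.reg]) hx hQ P off hc cfg hpc hr

theorem rd {d a σ} {Q : St → Prop} (ha : σ.reg a < B)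
    (hQ : Q (σ.setReg d (σ.inp (σ.reg a)))) : Tri W B (.rd d a) σ 1 Q := by
  intro P off hc cfg hpc hr
  have hx : σ.inp (σ.reg a) < 2 ^ W := by
    rw [← hr.inp _ ha]; exact hr.mem_lt _
  exact setReg_rule (c := .rd d a) (fun _ => rfl) rfl
    (fun _ h => by simp [Instr.exec, h.reg, h.inp _ ha]) hx hQ P off hc cfg hpc hr

theorem wr {a b σ} {Q : St → Prop} (ha : σ.reg a < B)
    (hQ : Q (σ.setInp (σ.reg a) (σ.reg b))) : Tri W B (.wr a b) σ 1 Q := by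
  intro P off hc cfg hpc hr
  have h0 := hc.head
  rw [← hpc] at h0
  refine ⟨1, le_rfl, _, ?_, ?_, hQ⟩
  · rw [run_succ, run_zero, step_of_getElem? h0]
    simp only [Instr.exec]
    refine ⟨hr.reg, hr.base, hr.sixteen, ?_, ?_, hr.reg_lt, ?_⟩
    · intro x hx
      simp [Function.update_apply, St.setInp_inp, hr.reg, hr.inp x hx]
    · intro k hk v
      simp only [Function.update_apply, hr.reg, St.setInp_g]
      rw [if_neg (by omega), hr.g k hk]
    · intro x
      simp only [Function.update_apply]
      split_ifs
      · exact hr.reg_lt _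
      · exact hr.mem_lt x
  · rw [run_succ, run_zero, step_of_getElem? h0, ← hpc]; rfl

/-- The address computation of `ld` and `st`. -/
theorem address {P : Program} {off k a : ℕ} {σ : St} {i : Instr} {cfg : Config}
    (hc : CodeAt P off [.mul 0 (a + 4) 3, .add 0 0 2, .const 1 k, .add 0 0 1, i])
    (hpc : cfg.pc = off) (hr : Rel W B σ cfg) (ha : 16 * σ.reg a + B + 16 ≤ 2 ^ W) (hk : k < 16) :
    ∃ cfg', Rel W B σ cfg' ∧ run W P 5 cfg = i.exec W cfg' ∧ cfg'.pc = off + 4 ∧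
      cfg'.reg 0 = B + 16 * σ.reg a + k := by
  have e0 := hc 0 (by simp)
  have e1 := hc 1 (by simp)
  have e2 := hc 2 (by simp)
  have e3 := hc 3 (by simp)
  have e4 := hc 4 (by simp)
  simp only [List.getElem_cons_zero, List.getElem_cons_succ, ← hpc] at e0 e1 e2 e3 e4
  refine ⟨(((cfg.setReg W 0 (16 * σ.reg a)).setReg W 0 (16 * σ.reg a + B)).setReg W 1 k).setReg W 0
    (B + 16 * σ.reg a + k), ?_, ?_, ?_, ?_⟩
  · exact (((hr.scratch _ _ (by omega)).scratch _ _ (by omega)).scratch _ _ (by omega)).scratch _ _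
      (by omega)
  · have m1 : 16 * σ.reg a % 2 ^ W = 16 * σ.reg a := Nat.mod_eq_of_lt (by omega)
    have m2 : (16 * σ.reg a + B) % 2 ^ W = 16 * σ.reg a + B := Nat.mod_eq_of_lt (by omega)
    have m3 : k % 2 ^ W = k := Nat.mod_eq_of_lt (by omega)
    have s1 : step W P cfg = cfg.setReg W 0 (16 * σ.reg a) := by
      rw [step_of_getElem? e0]
      simp [Instr.exec, hr.reg, hr.sixteen, mul_comm]
    have s2 : step W P (cfg.setReg W 0 (16 * σ.reg a)) =
        (cfg.setReg W 0 (16 * σ.reg a)).setReg W 0 (16 * σ.reg a + B) := by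
      rw [step_of_getElem? e1]
      simp [Instr.exec, Config.setReg, m1, hr.base]
    have s3 : step W P ((cfg.setReg W 0 (16 * σ.reg a)).setReg W 0 (16 * σ.reg a + B)) =
        ((cfg.setReg W 0 (16 * σ.reg a)).setReg W 0 (16 * σ.reg a + B)).setReg W 1 k := by
      rw [step_of_getElem? e2]
      rfl
    have s4 : step W P (((cfg.setReg W 0 (16 * σ.reg a)).setReg W 0
        (16 * σ.reg a + B)).setReg W 1 k) = ((((cfg.setReg W 0 (16 * σ.reg a)).setReg W 0
        (16 * σ.reg a + B)).setReg W 1 k)).setReg W 0 (B + 16 * σ.reg a + k) := by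
      rw [step_of_getElem? (i := .add 0 0 1) e3]
      simp [Instr.exec, Config.setReg, m3, add_comm]
    rw [run_succ, run_succ, run_succ, run_succ, run_succ, run_zero, s1, s2, s3, s4,
      step_of_getElem? (i := i) e4]
  · simp [Config.setReg, hpc]
  · simp only [Config.setReg, Function.update_self]
    exact Nat.mod_eq_of_lt (by omega)

theorem ld {d k a σ} {Q : St → Prop} (hk : k < 16) (ha : 16 * σ.reg a + B + 16 ≤ 2 ^ W)
    (hQ : Q (σ.setReg d (σ.g k (σ.reg a)))) : Tri W B (.ld d k a) σ 5 Q := by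
  intro P off hc cfg hpc hr
  obtain ⟨cfg', r', e, p, q⟩ := address hc hpc hr ha hk
  have hm : cfg'.mem (B + 16 * σ.reg a + k) = σ.g k (σ.reg a) := r'.g k hk _
  refine ⟨5, le_rfl, _, ?_, ?_, hQ⟩
  · rw [e]
    simp only [Instr.exec, q, hm]
    exact r'.setReg _ _ (hm ▸ r'.mem_lt _)
  · rw [e]
    simp [Instr.exec, Config.setReg, p, Cmd.sz]

theorem st {k a b σ} {Q : St → Prop} (hk : k < 16) (ha : 16 * σ.reg a + B + 16 ≤ 2 ^ W)
    (hQ : Q (σ.setG k (σ.reg a) (σ.reg b))) : Tri W B (.st k a b) σ 5 Q := by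
  intro P off hc cfg hpc hr
  obtain ⟨cfg', r', e, p, q⟩ := address hc hpc hr ha hk
  refine ⟨5, le_rfl, _, ?_, ?_, hQ⟩
  · rw [e]
    simp only [Instr.exec, q]
    refine ⟨r'.reg, r'.base, r'.sixteen, ?_, ?_, r'.reg_lt, ?_⟩
    · intro x hx
      simp only [Function.update_apply]
      rw [if_neg (by omega), r'.inp x hx]
      rfl
    · intro k' hk' v
      simp only [Function.update_apply, r'.reg, St.setG_g]
      by_cases h : k' = k ∧ v = σ.reg a
      · obtain ⟨rfl, rfl⟩ := h
        simp
      -- As both field numbers are below `16`, the address `B + 16 * v + k` determines the record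
      -- and the field.
      · rw [if_neg (by omega), r'.g k' hk']
        split_ifs with h1 h2
        · exact absurd ⟨h1, h2⟩ h
        · rw [h1]
        · rfl
    · intro x
      simp only [Function.update_apply]
      split_ifs
      · exact r'.reg_lt _
      · exact r'.mem_lt x
  · rw [e]
    simp [Instr.exec, p, Cmd.sz]

/-- The two additional steps are the conditional jump and the jump over the code of `c₁`, which the
compiler places behind that of `c₂`. -/
theorem ifLt {a b c₁ c₂ σ T} {Q : St → Prop}
    (h₁ : σ.reg a < σ.reg b → Tri W B c₁ σ T Q) (h₂ : ¬ σ.reg a < σ.reg b → Tri W B c₂ σ T Q) :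
    Tri W B (.ifLt a b c₁ c₂) σ (T + 2) Q := by
  intro P off hc cfg hpc hr
  subst hpc
  simp only [Cmd.comp] at hc
  have e0 := hc.head
  have hc' := hc.tail
  have s0 := step_of_getElem? (W := W) e0
  simp only [Instr.exec, hr.reg] at s0
  by_cases h : σ.reg a < σ.reg b
  · rw [if_pos h] at s0
    have hc₁ := hc'.right.tail
    rw [Cmd.length_comp] at hc₁
    obtain ⟨t, ht, σ', r, p, q⟩ := h₁ h P (cfg.pc + c₂.sz + 2) (by convert hc₁ using 1; omega)
      { cfg with pc := cfg.pc + c₂.sz + 2 } rfl (hr.congr_pc _)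
    refine ⟨t + 1, by omega, σ', ?_, ?_, q⟩
    · rwa [run_succ, s0]
    · rw [run_succ, s0, p, Cmd.sz]; omega
  · rw [if_neg h] at s0
    obtain ⟨t, ht, σ', r, p, q⟩ := h₂ h P (cfg.pc + 1) hc'.left
      { cfg with pc := cfg.pc + 1 } rfl (hr.congr_pc _)
    have e1 := hc'.right.head
    rw [Cmd.length_comp] at e1
    refine ⟨(t + 1) + 1, by omega, σ', ?_, ?_, q⟩
    · rw [run_succ, s0, run_add, run_succ, run_zero, step_of_getElem? (by rw [p]; exact e1)]
      exact r.congr_pc _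
    · rw [run_succ, s0, run_add, run_succ, run_zero, step_of_getElem? (by rw [p]; exact e1)]
      simp [Instr.exec, Cmd.sz]

theorem while_false {a b c σ} {Q : St → Prop} (h : ¬ σ.reg a < σ.reg b) (hQ : Q σ) :
    Tri W B (.whileLt a b c) σ 2 Q := by
  intro P off hc cfg hpc hr
  simp only [Cmd.comp] at hc
  have e0 := hc.head
  have e1 := hc.tail.head
  rw [← hpc] at e0 e1
  have s0 := step_of_getElem? (W := W) e0
  simp only [Instr.exec, hr.reg, if_neg h] at s0
  have s1 := step_of_getElem? (W := W) (c := { cfg with pc := cfg.pc + 1 }) e1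
  refine ⟨2, le_rfl, σ, ?_, ?_, hQ⟩
  · rw [run_succ, run_succ, run_zero, s0, s1]
    exact (hr.congr_pc _)
  · rw [run_succ, run_succ, run_zero, s0, s1]
    simp [Instr.exec, Cmd.sz, hpc]

theorem while_true {a b c σ T T' R} {Q : St → Prop} (h : σ.reg a < σ.reg b)
    (hb : Tri W B c σ T R) (hw : ∀ σ', R σ' → Tri W B (.whileLt a b c) σ' T' Q) :
    Tri W B (.whileLt a b c) σ (T + T' + 2) Q := by
  intro P off hc cfg hpc hr
  subst hpc
  have hc0 := hc
  simp only [Cmd.comp] at hc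
  have e0 := hc.head
  have hct := hc.tail.tail
  have s0 := step_of_getElem? (W := W) e0
  simp only [Instr.exec, hr.reg, if_pos h] at s0
  obtain ⟨t, ht, σ₁, r, p, q⟩ := hb P (cfg.pc + 2) hct.left
      { cfg with pc := cfg.pc + 2 } rfl (hr.congr_pc _)
  have e1 := hct.right.head
  rw [Cmd.length_comp] at e1
  have s1 := step_of_getElem? (W := W) (by rw [p]; exact e1)
  obtain ⟨t', ht', σ₂, r₂, p₂, q₂⟩ := hw σ₁ q P cfg.pc hc0 { (run W P t { cfg with pc := cfg.pc + 2 }) with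
    pc := cfg.pc } rfl (r.congr_pc _)
  have key : run W P (t + 1 + t' + 1) cfg = run W P t' { (run W P t { cfg with pc := cfg.pc + 2 }) with
    pc := cfg.pc } := by
    rw [run_succ, s0, run_add, run_add, run_succ, run_zero, s1]
    simp only [Instr.exec]
  refine ⟨t + 1 + t' + 1, by omega, σ₂, ?_, ?_, q₂⟩
  · rw [key]; exact r₂
  · rw [key]; exact p₂

/-- A loop with an invariant. -/
theorem while_inv {a b c} (I : ℕ → St → Prop) (T n : ℕ) {σ}
    (hstep : ∀ i, i < n → ∀ σ, I i σ → σ.reg a < σ.reg b ∧ Tri W B c σ T (I (i + 1)))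
    (hend : ∀ σ, I n σ → ¬ σ.reg a < σ.reg b) (h0 : I 0 σ) :
    Tri W B (.whileLt a b c) σ (n * (T + 2) + 2) (I n) := by
  suffices H : ∀ j i σ, i + j = n → I i σ →
      Tri W B (.whileLt a b c) σ (j * (T + 2) + 2) (I n) from H n 0 σ (by omega) h0
  intro j
  induction j with
  | zero =>
    intro i σ hi hI
    obtain rfl : i = n := by omega
    simpa using while_false (hend σ hI) hI
  | succ j ih =>
    intro i σ hi hI
    obtain ⟨h1, h2⟩ := hstep i (by omega) σ hI
    refine (while_true h1 h2 (fun σ' h' => ih (i + 1) σ' (by omega) h')).mono ?_ (fun _ h => h)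
    rw [Nat.succ_mul]; omega

end Tri

/-! ### Symbolic execution of loop-free code -/

/-- The weakest precondition of a loop-free command. -/
def wp (W B : ℕ) : Cmd → (St → Prop) → St → Prop
  | .const d c, Q, σ => c < 2 ^ W ∧ Q (σ.setReg d c)
  | .add d a b, Q, σ => σ.reg a + σ.reg b < 2 ^ W ∧ Q (σ.setReg d (σ.reg a + σ.reg b))
  | .sub d a b, Q, σ => Q (σ.setReg d (σ.reg a - σ.reg b))
  | .rd d a, Q, σ => σ.reg a < B ∧ Q (σ.setReg d (σ.inp (σ.reg a)))
  | .wr a b, Q, σ => σ.reg a < B ∧ Q (σ.setInp (σ.reg a) (σ.reg b))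
  | .ld d k a, Q, σ => (k < 16 ∧ 16 * σ.reg a + B + 16 ≤ 2 ^ W) ∧
      Q (σ.setReg d (σ.g k (σ.reg a)))
  | .st k a b, Q, σ => (k < 16 ∧ 16 * σ.reg a + B + 16 ≤ 2 ^ W) ∧
      Q (σ.setG k (σ.reg a) (σ.reg b))
  | .skip, Q, σ => Q σ
  | .seq c₁ c₂, Q, σ => wp W B c₁ (wp W B c₂ Q) σ
  | .ifLt a b c₁ c₂, Q, σ =>
      (σ.reg a < σ.reg b → wp W B c₁ Q σ) ∧ (¬ σ.reg a < σ.reg b → wp W B c₂ Q σ)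
  | .whileLt _ _ _, _, _ => False

/-- A bound for the running time of a loop-free command. -/
def Cmd.cost : Cmd → ℕ
  | .const _ _ => 1
  | .add _ _ _ => 1
  | .sub _ _ _ => 1
  | .rd _ _ => 1
  | .wr _ _ => 1
  | .ld _ _ _ => 5
  | .st _ _ _ => 5
  | .skip => 0
  | .seq c₁ c₂ => c₁.cost + c₂.cost
  | .ifLt _ _ c₁ c₂ => max c₁.cost c₂.cost + 2
  | .whileLt _ _ _ => 0

theorem wp_mono {W B : ℕ} (c : Cmd) : ∀ {Q Q' : St → Prop} {σ : St}, wp W B c Q σ →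
    (∀ σ', Q σ' → Q' σ') → wp W B c Q' σ := by
  induction c with
  | seq c₁ c₂ h₁ h₂ => exact fun h hQ => h₁ h fun σ' h' => h₂ h' hQ
  | ifLt a b c₁ c₂ h₁ h₂ => exact fun h hQ => ⟨fun x => h₁ (h.1 x) hQ, fun x => h₂ (h.2 x) hQ⟩
  | whileLt a b c _ => exact fun h _ => h
  | sub => exact fun h hQ => hQ _ h
  | skip => exact fun h hQ => hQ _ h
  | _ => exact fun h hQ => ⟨h.1, hQ _ h.2⟩

/-- Turns loop-free code into a goal that `simp` evaluates symbolically, together with its cost.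
Loops are excluded because their weakest precondition is `False`; they go through `while_inv` or an
explicit induction. -/
theorem Tri.of_wp {W B : ℕ} (c : Cmd) :
    ∀ {σ : St} {Q : St → Prop}, wp W B c Q σ → Tri W B c σ c.cost Q := by
  induction c with
  | const d x => exact fun h => Tri.const h.1 h.2
  | add d a b => exact fun h => Tri.add h.1 h.2
  | sub d a b => exact fun h => Tri.sub h
  | rd d a => exact fun h => Tri.rd h.1 h.2
  | wr a b => exact fun h => Tri.wr h.1 h.2
  | ld d k a => exact fun h => Tri.ld h.1.1 h.1.2 h.2
  | st k a b => exact fun h => Tri.st h.1.1 h.1.2 h.2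
  | skip => exact fun h => Tri.skip h
  | seq c₁ c₂ h₁ h₂ => exact fun h => Tri.seq (h₁ h) (fun _ h' => h₂ h')
  | ifLt a b c₁ c₂ h₁ h₂ =>
    exact fun h => Tri.ifLt (fun hl => (h₁ (h.1 hl)).mono (le_max_left _ _) fun _ => id)
      (fun hl => (h₂ (h.2 hl)).mono (le_max_right _ _) fun _ => id)
  | whileLt a b c _ => exact fun h => h.elim

/-! ## Rooted trees on `{0, …, n - 1}` -/

/-- A rooted tree on `{0, …, n - 1}`; `le a v` says that `a` is an ancestor of `v` or `v` itself. -/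
structure Arbor where
  n : ℕ
  root : ℕ
  par : ℕ → ℕ
  le : ℕ → ℕ → Prop
  rank : ℕ → ℕ
  root_lt : root < n
  par_lt : ∀ v, v < n → par v < n
  par_root : par root = root
  rank_lt : ∀ v, v < n → v ≠ root → rank (par v) < rank v
  le_iff : ∀ a v, a < n → v < n → (le a v ↔ a = v ∨ (v ≠ root ∧ le a (par v)))

namespace Arbor

variable (T : Arbor)

theorem le_refl {v : ℕ} (hv : v < T.n) : T.le v v := (T.le_iff v v hv hv).2 (Or.inl rfl)

/-- Since `rank` decreases along `par`, every node reaches the root after finitely many steps. Most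
facts about ancestors below use this recursion instead of paths. -/
theorem induct {motive : (v : ℕ) → v < T.n → Prop} (root : motive T.root T.root_lt)
    (step : ∀ v (hv : v < T.n), v ≠ T.root → motive (T.par v) (T.par_lt v hv) → motive v hv) :
    ∀ v (hv : v < T.n), motive v hv := by
  suffices H : ∀ r v (hv : v < T.n), T.rank v = r → motive v hv from fun v hv => H _ v hv rfl
  intro r
  induction r using Nat.strong_induction_on with
  | _ r ih =>
    intro v hv hr
    by_cases h : v = T.root
    · subst h; exact root
    · exact step v hv h (ih _ (hr ▸ T.rank_lt v hv h) _ (T.par_lt v hv) rfl)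

theorem root_le {v : ℕ} (hv : v < T.n) : T.le T.root v := by
  induction v, hv using T.induct with
  | root => exact T.le_refl T.root_lt
  | step v hv h ih => exact (T.le_iff _ _ T.root_lt hv).2 (Or.inr ⟨h, ih⟩)

theorem par_le {v : ℕ} (hv : v < T.n) : T.le (T.par v) v := by
  by_cases h : v = T.root
  · rw [h, T.par_root]; exact T.le_refl T.root_lt
  · exact (T.le_iff _ _ (T.par_lt v hv) hv).2 (Or.inr ⟨h, T.le_refl (T.par_lt v hv)⟩)

theorem le_trans {a b c : ℕ} (ha : a < T.n) (hb : b < T.n) (hc : c < T.n) (hab : T.le a b)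
    (hbc : T.le b c) : T.le a c := by
  induction c, hc using T.induct with
  | root =>
    have := (T.le_iff _ _ hb T.root_lt).1 hbc
    simp only [ne_eq, not_true_eq_false, false_and, or_false] at this
    exact this ▸ hab
  | step v hv h ih =>
    rcases (T.le_iff _ _ hb hv).1 hbc with rfl | ⟨_, h2⟩
    · exact hab
    · exact (T.le_iff _ _ ha hv).2 (Or.inr ⟨h, ih h2⟩)

theorem rank_le {a v : ℕ} (ha : a < T.n) (hv : v < T.n) (h : T.le a v) :
    a = v ∨ T.rank a < T.rank v := by
  induction v, hv using T.induct with
  | root =>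
    have := (T.le_iff _ _ ha T.root_lt).1 h
    simp only [ne_eq, not_true_eq_false, false_and, or_false] at this
    exact Or.inl this
  | step v hv h' ih =>
    rcases (T.le_iff _ _ ha hv).1 h with rfl | ⟨_, h2⟩
    · exact Or.inl rfl
    · have := T.rank_lt v hv h'
      rcases ih h2 with h3 | h3
      · right; rw [h3]; exact this
      · right; omega

theorem antisymm {a b : ℕ} (ha : a < T.n) (hb : b < T.n) (h : T.le a b) (h' : T.le b a) :
    a = b := by
  rcases T.rank_le ha hb h with h1 | h1
  · exact h1
  · rcases T.rank_le hb ha h' with h2 | h2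
    · exact h2.symm
    · omega

theorem not_le_par {v : ℕ} (hv : v < T.n) (h : v ≠ T.root) : ¬ T.le v (T.par v) := by
  intro h'
  have := T.rank_lt v hv h
  rcases T.rank_le hv (T.par_lt v hv) h' with h1 | h1
  · rw [← h1] at this; omega
  · omega

/-- `c` is a child of `v`. -/
def Child (v c : ℕ) : Prop := c < T.n ∧ c ≠ T.root ∧ T.par c = v

theorem exists_child {v u : ℕ} (hv : v < T.n) (hu : u < T.n) (h : T.le v u) (hne : v ≠ u) :
    ∃ c, T.Child v c ∧ T.le c u := by
  induction u, hu using T.induct with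
  | root =>
    have := (T.le_iff _ _ hv T.root_lt).1 h
    simp only [ne_eq, not_true_eq_false, false_and, or_false] at this
    exact absurd this hne
  | step u hu hr ih =>
    rcases (T.le_iff _ _ hv hu).1 h with rfl | ⟨_, h2⟩
    · exact absurd rfl hne
    · by_cases e : v = T.par u
      · exact ⟨u, ⟨hu, hr, e.symm⟩, T.le_refl hu⟩
      · obtain ⟨c, hc, hcu⟩ := ih h2 e
        exact ⟨c, hc, (T.le_iff _ _ hc.1 hu).2 (Or.inr ⟨hr, hcu⟩)⟩

theorem Child.le {T : Arbor} {v c : ℕ} (h : T.Child v c) : T.le v c := h.2.2 ▸ T.par_le h.1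

theorem Child.lt {T : Arbor} {v c : ℕ} (h : T.Child v c) : v < T.n := h.2.2 ▸ T.par_lt c h.1

theorem Child.not_le {T : Arbor} {v c : ℕ} (h : T.Child v c) : ¬ T.le c v :=
  h.2.2 ▸ T.not_le_par h.1 h.2.1

theorem linear {a b u : ℕ} (ha : a < T.n) (hb : b < T.n) (hu : u < T.n) (h : T.le a u)
    (h' : T.le b u) : T.le a b ∨ T.le b a := by
  induction u, hu using T.induct with
  | root =>
    have h1 := (T.le_iff _ _ ha T.root_lt).1 h
    simp only [ne_eq, not_true_eq_false, false_and, or_false] at h1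
    right; rw [h1]; exact h'
  | step u hu hr ih =>
    rcases (T.le_iff _ _ ha hu).1 h with rfl | ⟨_, h2⟩
    · right; exact h'
    · rcases (T.le_iff _ _ hb hu).1 h' with rfl | ⟨_, h3⟩
      · left; exact h
      · exact ih h2 h3

theorem child_unique {v c d u : ℕ} (hu : u < T.n) (hc : T.Child v c) (hd : T.Child v d)
    (hcu : T.le c u) (hdu : T.le d u) : c = d := by
  have key : ∀ c d, T.Child v c → T.Child v d → T.le c d → c = d := by
    intro c d hc hd h
    rcases (T.le_iff _ _ hc.1 hd.1).1 h with h | ⟨_, h⟩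
    · exact h
    · rw [hd.2.2] at h
      exact absurd h hc.not_le
  rcases T.linear hc.1 hd.1 hu hcu hdu with h | h
  · exact key c d hc hd h
  · exact (key d c hd hc h).symm

open Classical in
noncomputable def children (v : ℕ) : Finset ℕ := (Finset.range T.n).filter (T.Child v)

theorem mem_children {v c : ℕ} : c ∈ T.children v ↔ T.Child v c := by
  simp only [children, Finset.mem_filter, Finset.mem_range, and_iff_right_iff_imp]
  exact fun h => h.1

open Classical in
-- A node below `v` is `v` itself or lies below exactly one child of `v`. In this counting form the
-- fact can be summed over the ends of paths.
theorem indicator_le {v z : ℕ} (hv : v < T.n) (hz : z < T.n) :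
    (if T.le v z then 1 else 0) =
      (if z = v then 1 else 0) + ∑ c ∈ T.children v, if T.le c z then 1 else 0 := by
  by_cases h : T.le v z
  · rw [if_pos h]
    by_cases e : z = v
    · have h0 : ∀ c ∈ T.children v, (if T.le c z then 1 else 0) = 0 :=
        fun c hc => if_neg (e ▸ (T.mem_children.1 hc).not_le)
      rw [if_pos e, Finset.sum_eq_zero h0, add_zero]
    · rw [if_neg e]
      obtain ⟨c, hc, hcz⟩ := T.exists_child hv hz h (Ne.symm e)
      rw [Finset.sum_eq_single c, if_pos hcz]
      · intro d hd hne
        rw [if_neg]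
        exact fun hdz => hne (T.child_unique hz (T.mem_children.1 hd) hc hdz hcz)
      · intro hn
        exact absurd (T.mem_children.2 hc) hn
  · have hz' : z ≠ v := by
      rintro rfl
      exact h (T.le_refl hz)
    have h0 : ∀ c ∈ T.children v, (if T.le c z then 1 else 0) = 0 := fun c hc => if_neg fun hcz =>
      h (T.le_trans hv (T.mem_children.1 hc).1 hz (T.mem_children.1 hc).le hcz)
    rw [if_neg h, if_neg hz', Finset.sum_eq_zero h0, add_zero]

end Arbor

/-! ### Counting vertical paths through a node -/

/-- A path of the tree, from `u` up to, but excluding, `p`, with a weight `q`. -/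
structure Item where
  u : ℕ
  p : ℕ
  q : ℕ

open Classical in
/-- The number of paths in `L` that contain the node `v`. -/
noncomputable def Arbor.cov (T : Arbor) (L : List Item) (v : ℕ) : ℕ :=
  L.countP fun it => decide (T.le v it.u ∧ ¬ T.le v it.p)

/-- A path is the difference of the ancestor chains of `u` and of `p`. Each chain satisfies the
recursion `indicator_le`, and the difference of the two recursions gives this one, written without
subtraction. It determines all path counts from the numbers of path ends, children before parents.
-/
theorem Arbor.cov_add (T : Arbor) (L : List Item)
    (hL : ∀ it ∈ L, it.u < T.n ∧ it.p < T.n ∧ T.le it.p it.u) {v : ℕ} (hv : v < T.n) :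
    T.cov L v + L.countP (fun it => decide (it.p = v)) =
      L.countP (fun it => decide (it.u = v)) + ∑ c ∈ T.children v, T.cov L c := by
  classical
  induction L with
  | nil => simp [Arbor.cov]
  | cons it L ih =>
    have ih := ih fun x hx => hL x (List.mem_cons_of_mem _ hx)
    obtain ⟨h1, h2, h3⟩ := hL it List.mem_cons_self
    have hu := T.indicator_le hv h1
    have hp := T.indicator_le hv h2
    have key : ∀ c, c < T.n → (if T.le c it.u then 1 else 0) =
        (if T.le c it.u ∧ ¬ T.le c it.p then 1 else 0) + if T.le c it.p then 1 else 0 := by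
      intro c hc
      have := T.le_trans hc h2 h1 (b := it.p)
      by_cases a : T.le c it.u <;> by_cases b : T.le c it.p <;> simp_all
    rw [Finset.sum_congr rfl fun c hc => key c (T.mem_children.1 hc).1, Finset.sum_add_distrib,
      key v hv] at hu
    simp only [Arbor.cov, List.countP_cons, decide_eq_true_eq] at ih ⊢
    rw [Finset.sum_add_distrib]
    omega

/-! ## The tree algorithm -/

/-- The data processed by the algorithm: a tree with lengths of nodes, a list of weighted paths,
the number `K` of paths that contain the nodes of interest and the bound `m`. -/
structure TreeInput extends Arbor where
  len : ℕ → ℕ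
  items : List Item
  K : ℕ
  m : ℕ
  item_ok : ∀ it ∈ items, it.u < n ∧ it.p < n ∧ le it.p it.u

namespace TreeInput

variable (D : TreeInput)

/-- The paths of positive weight. -/
def fin : List Item := D.items.filter fun it => decide (0 < it.q)

/-- For Merge, a node other than the root is full if and only if it occurs in every interval of the
reduced staircase (`Instance.full_iff`). -/
def Full (v : ℕ) : Prop := D.cov D.items v = D.K

open Classical in
/-- The number of full children. -/
noncomputable def cf (v : ℕ) : ℕ := ((D.children v).filter D.Full).card

/-- Full nodes are closed under passing to the parent, and a node with two full children
interrupts no path. -/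
structure Good : Prop where
  up : ∀ v, v < D.n → v ≠ D.root → D.Full v → D.par v ≠ D.root → D.Full (D.par v)
  br : ∀ it ∈ D.items, ∀ y, y < D.n → 2 ≤ D.cf y → D.le y it.u → y ≠ it.u → D.le y it.p

/-- The weight `q` of the path `it` is relevant for `v`. -/
def Relevant (v : ℕ) (it : Item) : Prop :=
  ∃ a, D.Child it.p a ∧ D.Full a ∧ D.le a it.u ∧ D.le a v

variable {D}

theorem Good.up_of_le (hD : D.Good) {a v : ℕ} (ha : a < D.n) (hv : v < D.n) (hr : a ≠ D.root)
    (hf : D.Full v) (h : D.le a v) : D.Full a := by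
  induction v, hv using D.induct with
  | root =>
    have := (D.le_iff _ _ ha D.root_lt).1 h
    simp only [ne_eq, not_true_eq_false, false_and, or_false] at this
    exact absurd this hr
  | step v hv hr' ih =>
    rcases (D.le_iff _ _ ha hv).1 h with rfl | ⟨_, h2⟩
    · exact hf
    · refine ih (hD.up v hv hr' hf ?_) h2
      intro e
      rw [e] at h2
      exact hr (D.antisymm ha D.root_lt h2 (D.root_le ha))

open Classical in
/-- Results of the top-down pass and of the counting of full children. -/
structure Tables (D : TreeInput) (f h fc : ℕ → ℕ) : Prop where
  f_root : f D.root = D.root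
  f_eq : ∀ v, v < D.n → v ≠ D.root → f v = if D.Full v then v else f (D.par v)
  h_eq : ∀ v, v < D.n → v ≠ D.root → h v = if 2 ≤ D.cf (D.par v) then v else h (D.par v)
  fc_mem : ∀ v, v < D.n → 0 < D.cf v → D.Child v (fc v) ∧ D.Full (fc v)

theorem Tables.f_spec {f h fc : ℕ → ℕ} (hT : Tables D f h fc) {v : ℕ} (hv : v < D.n) :
    f v < D.n ∧ D.le (f v) v ∧ (f v = D.root ∨ D.Full (f v)) ∧
      ∀ y, y < D.n → D.Full y → D.le y v → D.le y (f v) := by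
  classical
  induction v, hv using D.induct with
  | root =>
    rw [hT.f_root]
    exact ⟨D.root_lt, D.le_refl D.root_lt, Or.inl rfl, fun y _ _ h => h⟩
  | step v hv hr ih =>
    rw [hT.f_eq v hv hr]
    split_ifs with hF
    · exact ⟨hv, D.le_refl hv, Or.inr hF, fun y _ _ h => h⟩
    · obtain ⟨h0, h1, h2, h3⟩ := ih
      refine ⟨h0, D.le_trans h0 (D.par_lt v hv) hv h1 (D.par_le hv), h2, fun y hy hyF hyv => ?_⟩
      rcases (D.le_iff _ _ hy hv).1 hyv with rfl | ⟨_, h4⟩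
      · exact absurd hyF hF
      · exact h3 y hy hyF h4

theorem exists_full_child {v : ℕ} (h : 0 < D.cf v) : ∃ c, D.Child v c ∧ D.Full c := by
  classical
  obtain ⟨c, hc⟩ := Finset.card_pos.1 h
  rw [Finset.mem_filter, D.mem_children] at hc
  exact ⟨c, hc⟩

theorem cf_pos {v c : ℕ} (hc : D.Child v c) (hf : D.Full c) : 0 < D.cf v := by
  classical
  refine Finset.card_pos.2 ⟨c, ?_⟩
  rw [Finset.mem_filter, D.mem_children]
  exact ⟨hc, hf⟩

theorem eq_of_cf_lt_two {v c d : ℕ} (h : ¬ 2 ≤ D.cf v) (hc : D.Child v c) (hf : D.Full c)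
    (hd : D.Child v d) (hf' : D.Full d) : c = d := by
  classical
  refine Finset.card_le_one.1 (show D.cf v ≤ 1 by omega) c ?_ d ?_ <;>
    rw [Finset.mem_filter, D.mem_children]
  · exact ⟨hc, hf⟩
  · exact ⟨hd, hf'⟩

/-- A replacement for level ancestor queries: the full child of `it.p` towards `it.u`, if there is
one, is read off from the tables. Here `f` gives the lowest full ancestor, `h` the nearest ancestor
whose parent has two full children, and `fc` some full child. Full nodes are closed upwards, so such
a child exists exactly if `f it.u` lies strictly below `it.p`. -/
theorem Tables.attach_iff {f h fc : ℕ → ℕ} (hT : Tables D f h fc) (hD : D.Good) {it : Item} (hit : it ∈ D.items) (a : ℕ) :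
    (0 < D.cf it.p ∧ f it.u ≠ it.p ∧ a = if 2 ≤ D.cf it.p then h (f it.u) else fc it.p) ↔
      D.Child it.p a ∧ D.Full a ∧ D.le a it.u := by
  classical
  obtain ⟨hu, hp, hpu⟩ := D.item_ok it hit
  obtain ⟨f0, f1, f2, f3⟩ := hT.f_spec hu
  have main : ∀ a, D.Child it.p a → D.Full a → D.le a it.u →
      a = if 2 ≤ D.cf it.p then h (f it.u) else fc it.p := by
    intro a ha haF hau
    have hle := f3 a ha.1 haF hau
    split_ifs with h2
    · have key : ∀ z, z < D.n → D.le a z → D.le z it.u → h z = a := by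
        intro z hz
        induction z, hz using D.induct with
        | root =>
          intro haz _
          exact absurd (D.antisymm ha.1 D.root_lt haz (D.root_le ha.1)) ha.2.1
        | step z hz hr ih =>
          intro haz hzu
          rw [hT.h_eq z hz hr]
          rcases (D.le_iff _ _ ha.1 hz).1 haz with rfl | ⟨_, h4⟩
          · rw [ha.2.2, if_pos h2]
          · have hpz := D.par_lt z hz
            have hpu' := D.le_trans hpz hz hu (D.par_le hz) hzu
            -- Climbing towards `a`, the recursion of `h` must not stop early. A node with two full
            -- children strictly inside the path would by `Good.br` be an ancestor of `it.p`,
            -- although it lies below `a`.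
            rw [if_neg, ih h4 hpu']
            intro h5
            have hne : D.par z ≠ it.u := by
              intro e
              exact D.not_le_par hz hr (e ▸ hzu)
            exact ha.not_le (D.le_trans ha.1 hpz hp h4 (hD.br it hit _ hpz h5 hpu' hne))
      exact (key _ f0 hle f1).symm
    · have := hT.fc_mem it.p hp (cf_pos ha haF)
      exact eq_of_cf_lt_two h2 ha haF this.1 this.2
  constructor
  · rintro ⟨h1, h2, h3⟩
    obtain ⟨c, hc, hcF⟩ := exists_full_child h1
    -- Having a full child, `it.p` is full or the root; in both cases the lowest full ancestor of
    -- `it.u` is not above it.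
    have hpf : D.le it.p (f it.u) := by
      by_cases e : it.p = D.root
      · rw [e]; exact D.root_le f0
      · refine f3 _ hp ?_ hpu
        have := hD.up c hc.1 hc.2.1 hcF
        rw [hc.2.2] at this
        exact this e
    obtain ⟨a', ha', hau'⟩ := D.exists_child hp f0 hpf (Ne.symm h2)
    have hF' : D.Full a' := by
      rcases f2 with e | e
      · rw [e] at hau'
        exact absurd (D.antisymm ha'.1 D.root_lt hau' (D.root_le ha'.1)) ha'.2.1
      · exact hD.up_of_le ha'.1 f0 ha'.2.1 e hau'
    have hle := D.le_trans ha'.1 f0 hu hau' f1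
    rw [h3, ← main a' ha' hF' hle]
    exact ⟨ha', hF', hle⟩
  · rintro ⟨h1, h2, h3⟩
    refine ⟨cf_pos h1 h2, ?_, main a h1 h2 h3⟩
    intro e
    have := f3 a h1.1 h2 h3
    rw [e] at this
    exact h1.not_le this

end TreeInput

/-! ## Loops over the input -/

/-- The low memory holds the list `l` from the address `pos` on. -/
def Holds (inp : ℕ → ℕ) (pos : ℕ) (l : List ℕ) : Prop :=
  ∀ i (h : i < l.length), inp (pos + i) = l[i]

theorem holds_cons {inp pos a l} :
    Holds inp pos (a :: l) ↔ inp pos = a ∧ Holds inp (pos + 1) l := by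
  constructor
  · intro h
    refine ⟨h 0 (by simp), fun i hi => ?_⟩
    have := h (i + 1) (by simpa using hi)
    simp only [List.getElem_cons_succ] at this
    rw [← this, add_assoc, add_comm 1 i]
  · rintro ⟨h0, h1⟩ i hi
    cases i with
    | zero => exact h0
    | succ i =>
      have := h1 i (by simpa using hi)
      simp only [List.getElem_cons_succ]
      rw [← this, add_assoc, add_comm 1 i]

theorem holds_append {inp pos l₁ l₂} :
    Holds inp pos (l₁ ++ l₂) ↔ Holds inp pos l₁ ∧ Holds inp (pos + l₁.length) l₂ := by
  induction l₁ generalizing pos with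
  | nil => simp [Holds]
  | cons a l ih =>
    simp only [List.cons_append, holds_cons, ih, List.length_cons, and_assoc]
    rw [add_assoc, add_comm 1]

def Item.enc (it : Item) : List ℕ := [it.u, it.p, it.q]

/-- An interval with its list of items, as in the input of Merge. -/
structure Block where
  lo : ℕ
  hi : ℕ
  items : List Item

def Block.enc (b : Block) : List ℕ := b.lo :: b.hi :: b.items.length :: b.items.flatMap Item.enc

/-- The loop over the items of one block. -/
def blockLoop (body : Cmd) : Cmd :=
  .whileLt 9 8 (.rd 12 6 ;; .add 6 6 1 ;; .rd 13 6 ;; .add 6 6 1 ;; .rd 14 6 ;; .add 6 6 1 ;;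
    .add 9 9 1 ;; body)

/-- The loop over all items of the input. -/
def itemLoop (body : Cmd) : Cmd :=
  (.const 6 5 ;; .add 6 6 2 ;; .add 6 6 2 ;; .add 6 6 2 ;; .const 7 0) ;;
  .whileLt 7 3 ((.const 12 2 ;; .add 6 6 12 ;; .rd 8 6 ;; .add 6 6 1 ;; .const 9 0 ;;
    .add 7 7 1) ;; blockLoop body)

/-- One execution of `body` processes one item. The registers from `12` on are scratch registers. -/
def BodySpec (W B : ℕ) (body : Cmd) (r : ℕ → ℕ) (inp : ℕ → ℕ) (items : List Item)
    (J : List Item → (ℕ → ℕ → ℕ) → Prop) : Prop :=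
  ∀ done it rest σ, done ++ it :: rest = items → (∀ x < 6, σ.reg x = r x) → σ.inp = inp →
    J done σ.g → σ.reg 12 = it.u → σ.reg 13 = it.p → σ.reg 14 = it.q →
    wp W B body (fun σ' => J (done ++ [it]) σ'.g ∧ σ'.inp = σ.inp ∧
      ∀ x < 12, σ'.reg x = σ.reg x) σ

/-- The assertion `J` is indexed by the list of all items processed so far, across the borders of
blocks; `rest` stands for the items of later blocks. The last numerical hypothesis keeps the reading
position and the counter below `B`. -/
theorem blockLoop_tri {W B : ℕ} {body : Cmd} {r inp items J} (hB : B < 2 ^ W)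
    (hr1 : r 1 = 1) (hb : BodySpec W B body r inp items J) (l : List Item) :
    ∀ (done rest : List Item) (σ : St), done ++ l ++ rest = items → (∀ x < 6, σ.reg x = r x) →
      σ.inp = inp → J done σ.g → Holds inp (σ.reg 6) (l.flatMap Item.enc) →
      σ.reg 9 + l.length = σ.reg 8 → σ.reg 6 + 3 * l.length + σ.reg 8 ≤ B →
      Tri W B (blockLoop body) σ (l.length * (body.cost + 9) + 2) fun σ' =>
        (∀ x < 6, σ'.reg x = r x) ∧ σ'.inp = inp ∧ J (done ++ l) σ'.g ∧
          σ'.reg 6 = σ.reg 6 + 3 * l.length ∧ σ'.reg 7 = σ.reg 7 := by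
  induction l with
  | nil =>
    intro done rest σ _ h1 h2 h3 _ h4 _
    simp only [List.length_nil, add_zero] at h4
    refine (Tri.while_false (by omega) ?_).mono (by simp) (fun _ h => h)
    exact ⟨h1, h2, by simpa using h3, by simp, rfl⟩
  | cons it l ih =>
    intro done rest σ h0 h1 h2 h3 h4 h5 h6
    simp only [List.length_cons] at h5 h6
    simp only [List.flatMap_cons, Item.enc, List.cons_append, List.nil_append, holds_cons] at h4
    obtain ⟨e1, e2, e3, e4⟩ := h4
    have r1 : σ.reg 1 = 1 := (h1 1 (by omega)).trans hr1
    refine (Tri.while_true (T := body.cost + 7) (T' := l.length * (body.cost + 9) + 2)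
      (R := fun σ' => (∀ x < 6, σ'.reg x = r x) ∧ σ'.inp = inp ∧ J (done ++ [it]) σ'.g ∧
        σ'.reg 6 = σ.reg 6 + 3 ∧ σ'.reg 7 = σ.reg 7 ∧ σ'.reg 8 = σ.reg 8 ∧
        σ'.reg 9 = σ.reg 9 + 1) (by omega) ?_ ?_).mono ?_ (fun _ h => h)
    · refine (Tri.of_wp _ (Q := fun σ' => (∀ x < 6, σ'.reg x = r x) ∧ σ'.inp = inp ∧
        J (done ++ [it]) σ'.g ∧ σ'.reg 6 = σ.reg 6 + 3 ∧ σ'.reg 7 = σ.reg 7 ∧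
        σ'.reg 8 = σ.reg 8 ∧ σ'.reg 9 = σ.reg 9 + 1) ?_).mono
        (by simp only [Cmd.cost]; omega) (fun _ h => h)
      simp only [wp, St.setReg_reg, St.setReg_inp, h2, r1, Nat.reduceEqDiff,
        if_true, if_false, OfNat.one_ne_ofNat]
      refine ⟨by omega, by omega, by omega, by omega, by omega, by omega, by omega, ?_⟩
      refine wp_mono _ (hb done it (l ++ rest) _ (by simpa using h0) ?_ ?_ ?_ ?_ ?_ ?_) ?_
      · intro x hx
        simp only [St.setReg_reg]
        rw [if_neg (by omega), if_neg (by omega), if_neg (by omega), if_neg (by omega),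
          if_neg (by omega), if_neg (by omega), if_neg (by omega), h1 x hx]
      · simpa using h2
      · simpa using h3
      · simp [St.setReg_reg, e1]
      · simp [St.setReg_reg, e2]
      · simp [St.setReg_reg, e3]
      · rintro σ' ⟨k1, k2, k3⟩
        refine ⟨fun x hx => ?_, by simpa using k2.trans h2, k1, ?_, ?_, ?_, ?_⟩
        · rw [k3 x (by omega)]
          simp only [St.setReg_reg]
          rw [if_neg (by omega), if_neg (by omega), if_neg (by omega), if_neg (by omega),
            if_neg (by omega), if_neg (by omega), if_neg (by omega), h1 x hx]
        all_goals
          rw [k3 _ (by omega)]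
          simp [St.setReg_reg]
    · rintro σ' ⟨k1, k2, k3, k4, k5, k6, k7⟩
      refine (ih (done ++ [it]) rest σ' (by simpa using h0) k1 k2 k3 (by rw [k4]; exact e4)
        (by omega) (by omega)).mono le_rfl ?_
      rintro τ ⟨t1, t2, t3, t4, t5⟩
      refine ⟨t1, t2, by simpa using t3, ?_, by omega⟩
      rw [t4, k4, List.length_cons]; ring
    · rw [List.length_cons, Nat.succ_mul]; omega

/-- The blocks start at `5 + 3 * r 2`: they are preceded by three header cells, the number of nodes,
three cells for each node, and the number of intervals. The endpoints of the intervals are skipped,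
since the algorithm has no need of them. -/
theorem itemLoop_tri {W B : ℕ} {body : Cmd} {r inp J} (blocks : List Block) (hB : B + 16 < 2 ^ W)
    (hr1 : r 1 = 1) (hr3 : r 3 = blocks.length)
    (hb : BodySpec W B body r inp (blocks.flatMap Block.items) J)
    (hin : Holds inp (5 + 3 * r 2) (blocks.flatMap Block.enc))
    (hlen : 5 + 3 * r 2 + 4 * (blocks.flatMap Block.enc).length + 3 ≤ B) {σ : St}
    (hreg : ∀ x < 6, σ.reg x = r x) (hinp : σ.inp = inp) (hJ : J [] σ.g) :
    Tri W B (itemLoop body) σ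
      ((body.cost + 20) * ((blocks.flatMap Block.items).length + blocks.length + 1)) fun σ' =>
        (∀ x < 6, σ'.reg x = r x) ∧ σ'.inp = inp ∧ J (blocks.flatMap Block.items) σ'.g := by
  have main : ∀ (bs : List Block) (done : List Item) (σ : St),
      done ++ bs.flatMap Block.items = blocks.flatMap Block.items → (∀ x < 6, σ.reg x = r x) →
      σ.inp = inp → J done σ.g → Holds inp (σ.reg 6) (bs.flatMap Block.enc) →
      σ.reg 7 + bs.length = r 3 → σ.reg 6 + 4 * (bs.flatMap Block.enc).length + 3 ≤ B →
      σ.reg 7 + bs.length ≤ B →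
      Tri W B (.whileLt 7 3 ((.const 12 2 ;; .add 6 6 12 ;; .rd 8 6 ;; .add 6 6 1 ;; .const 9 0 ;;
          .add 7 7 1) ;; blockLoop body)) σ
        ((body.cost + 9) * (bs.flatMap Block.items).length + 10 * bs.length + 2) fun σ' =>
        (∀ x < 6, σ'.reg x = r x) ∧ σ'.inp = inp ∧ J (blocks.flatMap Block.items) σ'.g := by
    intro bs
    induction bs with
    | nil =>
      intro done σ h0 h1 h2 h3 h4 h5 h6 _
      simp only [List.length_nil, add_zero] at h5
      refine (Tri.while_false ?_ ?_).mono (by simp) (fun _ h => h)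
      · rw [h1 3 (by omega)]; omega
      · simp only [List.flatMap_nil, List.append_nil] at h0
        exact ⟨h1, h2, h0 ▸ h3⟩
    | cons b bs ih =>
      intro done σ h0 h1 h2 h3 h4 h5 h6 h7
      simp only [List.length_cons] at h5 h7
      simp only [List.flatMap_cons, Block.enc, List.cons_append, holds_cons] at h4
      obtain ⟨_, _, e3, e4⟩ := h4
      rw [holds_append] at e4
      have hlenb : (b.items.flatMap Item.enc).length = 3 * b.items.length := by
        simp [List.length_flatMap, Item.enc, mul_comm]
      rw [hlenb] at e4
      simp only [List.flatMap_cons, Block.enc, List.cons_append, List.length_cons,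
        List.length_append, hlenb] at h6
      have r1 : σ.reg 1 = 1 := (h1 1 (by omega)).trans hr1
      refine (Tri.while_true (T := 6 + (b.items.length * (body.cost + 9) + 2))
        (T' := (body.cost + 9) * (bs.flatMap Block.items).length + 10 * bs.length + 2)
        (R := fun σ' => (∀ x < 6, σ'.reg x = r x) ∧ σ'.inp = inp ∧ J (done ++ b.items) σ'.g ∧
          σ'.reg 6 = σ.reg 6 + 3 + 3 * b.items.length ∧ σ'.reg 7 = σ.reg 7 + 1) ?_
        (Tri.seq (R := fun σ' => (∀ x < 6, σ'.reg x = r x) ∧ σ'.inp = inp ∧ J done σ'.g ∧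
          σ'.reg 6 = σ.reg 6 + 3 ∧ σ'.reg 7 = σ.reg 7 + 1 ∧ σ'.reg 8 = b.items.length ∧
          σ'.reg 9 = 0) ?_ ?_) ?_).mono ?_ (fun _ h => h)
      · rw [h1 3 (by omega)]; omega
      · refine (Tri.of_wp _ ?_).mono (by simp [Cmd.cost]) (fun _ h => h)
        simp only [wp, St.setReg_reg, St.setReg_inp, St.setReg_g, h2, r1,
          Nat.reduceEqDiff, if_true, if_false, OfNat.one_ne_ofNat]
        refine ⟨by omega, by omega, by omega, by omega, by omega, by omega, ?_, trivial, h3, trivial, trivial,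
          e3, trivial⟩
        intro x hx
        rw [if_neg (by omega), if_neg (by omega), if_neg (by omega), if_neg (by omega),
          if_neg (by omega), if_neg (by omega), h1 x hx]
      · rintro σ' ⟨k1, k2, k3, k4, k5, k6, k7⟩
        refine (blockLoop_tri (by omega) hr1 hb b.items done (bs.flatMap Block.items) σ'
          (by simpa using h0) k1 k2 k3 (by rw [k4]; exact e4.1) (by omega) (by omega)).mono le_rfl ?_
        rintro τ ⟨t1, t2, t3, t4, t5⟩
        exact ⟨t1, t2, t3, by omega, by omega⟩
      · rintro σ' ⟨k1, k2, k3, k4, k5⟩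
        refine ih (done ++ b.items) σ' (by simpa using h0) k1 k2 k3 ?_ (by omega) (by omega)
          (by omega)
        rw [k4]; exact e4.2
      · simp only [List.flatMap_cons, List.length_append, List.length_cons]
        ring_nf; omega
  have hbl : blocks.length ≤ (blocks.flatMap Block.enc).length := by
    clear * -
    induction blocks with
    | nil => simp
    | cons b bs ih => simp [Block.enc]; omega
  have r1 : σ.reg 1 = 1 := (hreg 1 (by omega)).trans hr1
  have r2 : σ.reg 2 = r 2 := hreg 2 (by omega)
  refine (Tri.seq (T₁ := 5) (R := fun σ' => (∀ x < 6, σ'.reg x = r x) ∧ σ'.inp = inp ∧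
    J [] σ'.g ∧ σ'.reg 6 = 5 + 3 * r 2 ∧ σ'.reg 7 = 0) (Tri.of_wp _ ?_) (fun σ' h => main blocks [] σ'
      (by simp) h.1 h.2.1 h.2.2.1 (by rw [h.2.2.2.1]; exact hin) (by omega) (by omega)
      (by omega))).mono ?_ (fun _ h => h)
  · simp only [wp, St.setReg_reg, St.setReg_inp, St.setReg_g, hinp, r2,
      Nat.reduceEqDiff, if_true, if_false]
    refine ⟨by omega, by omega, by omega, by omega, by omega, ?_, trivial, hJ, by omega, trivial⟩
    intro x hx
    rw [if_neg (by omega), if_neg (by omega), if_neg (by omega), if_neg (by omega),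
      if_neg (by omega), hreg x hx]
  · ring_nf; omega

/-! ## Reading the input -/

/-- The field `k` of the record `a` is incremented. -/
def Cmd.inc (k a : ℕ) : Cmd := .ld 15 k a ;; .add 15 15 1 ;; .st k a 15

/-- The contents of the registers that are not changed by the main loops. -/
structure Base (D : TreeInput) (σ : St) : Prop where
  zero : σ.reg 0 = 0
  one : σ.reg 1 = 1
  n : σ.reg 2 = D.n
  K : σ.reg 3 = D.K
  m : σ.reg 4 = D.m
  root : σ.reg 5 = D.root

theorem Base.congr {D : TreeInput} {σ σ' : St} (h : Base D σ) (e : ∀ x < 6, σ'.reg x = σ.reg x) :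
    Base D σ' :=
  ⟨(e 0 (by omega)).trans h.zero, (e 1 (by omega)).trans h.one, (e 2 (by omega)).trans h.n,
    (e 3 (by omega)).trans h.K, (e 4 (by omega)).trans h.m, (e 5 (by omega)).trans h.root⟩

/-- The data fit into the memory. -/
structure Fits (W B : ℕ) (D : TreeInput) : Prop where
  cap : 16 * D.n + B + 16 ≤ 2 ^ W
  base : 16 ≤ B
  items : 2 * D.items.length < B
  n : 4 + 3 * D.n < B
  len : ∀ v, v < D.n → D.len v + 1 < 2 ^ W
  q : ∀ it ∈ D.items, it.q < 2 ^ W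

theorem Fits.rec_lt {W B D} (h : Fits W B D) {v : ℕ} (hv : v < D.n) :
    16 * v + B + 16 ≤ 2 ^ W := by
  have := h.cap; omega

/-- The parent and the length go to the fields `0` and `1`, the leaf label is skipped, and field `2`
of the parent counts its children. The root is recognized as the node that is its own parent, by two
failing comparisons. -/
def initBody : Cmd :=
  .rd 12 6 ;; .add 6 6 1 ;; .rd 13 6 ;; .add 6 6 1 ;; .add 6 6 1 ;; .st 0 10 12 ;; .st 1 10 13 ;;
    .inc 2 12 ;; .ifLt 12 10 .skip (.ifLt 10 12 .skip (.add 5 10 0)) ;; .add 10 10 1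

def initPhase : Cmd :=
  (.const 0 0 ;; .const 1 1 ;; .const 12 2 ;; .rd 4 12 ;; .const 6 3 ;; .rd 2 6 ;; .const 6 4 ;;
    .const 10 0) ;; .whileLt 10 2 initBody ;; .rd 3 6

/-- The number of `x < i` with parent `v`. -/
def Arbor.deg (T : Arbor) (i v : ℕ) : ℕ := ((Finset.range i).filter fun x => T.par x = v).card

theorem Arbor.deg_succ (T : Arbor) (i v : ℕ) :
    T.deg (i + 1) v = T.deg i v + if T.par i = v then 1 else 0 := by
  simp only [Arbor.deg, Finset.range_add_one, Finset.filter_insert]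
  split_ifs
  · rw [Finset.card_insert_of_notMem (by simp)]
  · rfl

theorem Arbor.deg_le (T : Arbor) (i v : ℕ) : T.deg i v ≤ i :=
  (Finset.card_filter_le _ _).trans (by simp)

theorem Arbor.par_eq_self {T : Arbor} {v : ℕ} (hv : v < T.n) (h : T.par v = v) : v = T.root := by
  by_contra hr
  have := T.rank_lt v hv hr
  rw [h] at this
  omega

/-- The part of the input in front of the intervals. -/
structure Header (D : TreeInput) (inp : ℕ → ℕ) : Prop where
  m : inp 2 = D.m
  n : inp 3 = D.n
  par : ∀ v, v < D.n → inp (4 + 3 * v) = D.par v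
  len : ∀ v, v < D.n → inp (4 + 3 * v + 1) = D.len v
  K : inp (4 + 3 * D.n) = D.K

theorem initPhase_tri {W B : ℕ} {D : TreeInput} (hF : Fits W B D) {σ : St}
    (hH : Header D σ.inp) (hg : ∀ k < 16, ∀ v, σ.g k v = 0) :
    Tri W B initPhase σ (100 * (D.n + 1)) fun σ' => Base D σ' ∧ σ'.inp = σ.inp ∧
      (∀ v, v < D.n → σ'.g 0 v = D.par v ∧ σ'.g 1 v = D.len v ∧ σ'.g 2 v = D.deg D.n v) ∧
      ∀ k, 3 ≤ k → k < 16 → ∀ v, σ'.g k v = 0 := by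
  have hW := hF.cap
  have hB := hF.base
  have hn := hF.n
  refine (Tri.seq (Tri.of_wp _ (Q := fun σ' => σ'.reg 0 = 0 ∧ σ'.reg 1 = 1 ∧ σ'.reg 2 = D.n ∧
    σ'.reg 4 = D.m ∧ σ'.reg 6 = 4 ∧ σ'.reg 10 = 0 ∧ σ'.inp = σ.inp ∧ σ'.g = σ.g) ?_)
    (T₂ := D.n * 50 + 10) ?_).mono ?_ (fun _ h => h)
  · simp only [wp, St.setReg_reg, St.setReg_inp, St.setReg_g, hH.m, hH.n, Nat.reduceEqDiff, if_true,
      if_false, OfNat.ofNat_ne_zero, OfNat.zero_ne_ofNat, OfNat.one_ne_ofNat, zero_ne_one]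
    refine ⟨by omega, by omega, by omega, by omega, by omega, by omega, by omega, by omega, ?_⟩
    simp
  · rintro σ₁ ⟨a0, a1, a2, a4, a6, a10, ai, ag⟩
    refine (Tri.seq (Tri.while_inv (fun i σ' => σ'.reg 0 = 0 ∧ σ'.reg 1 = 1 ∧ σ'.reg 2 = D.n ∧
      σ'.reg 4 = D.m ∧ σ'.reg 6 = 4 + 3 * i ∧ σ'.reg 10 = i ∧ σ'.inp = σ.inp ∧
      (D.root < i → σ'.reg 5 = D.root) ∧ (∀ v, v < i → σ'.g 0 v = D.par v ∧ σ'.g 1 v = D.len v) ∧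
      (∀ v, σ'.g 2 v = D.deg i v) ∧ ∀ k, 3 ≤ k → k < 16 → ∀ v, σ'.g k v = 0)
      initBody.cost D.n ?_ ?_ ?_)
      (fun σ' h => Tri.of_wp (.rd 3 6) ?_)).mono (by
        simp [initBody, Cmd.inc, Cmd.cost]; omega) (fun _ h => h)
    · rintro i hi τ ⟨b0, b1, b2, b4, b6, b10, bi, b5, bg, bd, bk⟩
      refine ⟨by omega, Tri.of_wp _ ?_⟩
      have hpar := D.par_lt i hi
      have hd := D.deg_le i (D.par i)
      have e1 := hH.par i hi
      have e2 := hH.len i hi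
      simp only [initBody, Cmd.inc, wp, St.setReg_reg, St.setReg_inp, St.setReg_g, St.setG_reg,
        St.setG_inp, St.setG_g, b0, b1, b2, b4, b6, b10, bi, bd, e1, e2, Nat.reduceEqDiff, if_true,
        if_false, OfNat.ofNat_ne_zero, OfNat.zero_ne_ofNat, OfNat.ofNat_ne_one, OfNat.one_ne_ofNat,
        zero_ne_one, one_ne_zero, Nat.reduceLT, true_and]
      have p1 := hF.rec_lt hi
      have p2 := hF.rec_lt hpar
      have hdeg : ∀ v, (if v = D.par i then D.deg i (D.par i) + 1 else D.deg i v) =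
          D.deg (i + 1) v := by
        intro v
        rw [D.deg_succ]
        by_cases h : v = D.par i
        · subst h; simp
        · rw [if_neg h, if_neg (Ne.symm h), add_zero]
      have hfld : ∀ v, v < i + 1 → (if v = i then D.par i else τ.g 0 v) = D.par v ∧
          (if v = i then D.len i else τ.g 1 v) = D.len v := by
        intro v hv
        split_ifs with h
        · subst h; exact ⟨rfl, rfl⟩
        · exact bg v (by omega)
      have hother : ∀ k, 3 ≤ k → k < 16 → ∀ v, (if k = 2 then if v = D.par i then
          D.deg i (D.par i) + 1 else D.deg i v else if k = 1 then if v = i then D.len i else τ.g 1 v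
          else if k = 0 then if v = i then D.par i else τ.g 0 v else τ.g k v) = 0 := by
        intro k hk hk' v
        rw [if_neg (by omega), if_neg (by omega), if_neg (by omega), bk k hk hk']
      refine ⟨by omega, by omega, by omega, by omega, by omega, p1, p1, p2, by omega, p2, ?_, ?_⟩
      · intro hlt
        refine ⟨by omega, by omega, fun h => b5 ?_, hfld, hdeg, hother⟩
        rcases Nat.lt_succ_iff_lt_or_eq.1 h with h | h
        · exact h
        · have := D.par_root; rw [h] at this; omega
      · intro h1
        refine ⟨fun h2 => ?_, fun h2 => ?_⟩
        · refine ⟨by omega, by omega, fun h => b5 ?_, hfld, hdeg, hother⟩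
          rcases Nat.lt_succ_iff_lt_or_eq.1 h with h | h
          · exact h
          · have := D.par_root; rw [h] at this; omega
        · refine ⟨by omega, by omega, by omega, fun _ => ?_, hfld, hdeg, hother⟩
          exact (add_zero i).trans (D.par_eq_self hi (by omega))
    · rintro τ ⟨b0, b1, b2, b4, b6, b10, -⟩
      omega
    · refine ⟨a0, a1, a2, a4, a6, a10, ai, by omega, by omega, ?_, ?_⟩
      · intro v
        rw [ag, hg 2 (by omega)]
        simp [Arbor.deg]
      · intro k _ hk v
        rw [ag, hg k hk]
    · obtain ⟨b0, b1, b2, b4, b6, b10, bi, b5, bg, bd, bk⟩ := h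
      simp only [wp, b6, bi, St.setReg_inp, St.setReg_g, hH.K]
      refine ⟨by omega, ⟨?_, ?_, ?_, ?_, ?_, ?_⟩, trivial,
        fun v hv => ⟨(bg v hv).1, (bg v hv).2, bd v⟩, bk⟩ <;> simp [St.setReg_reg, *]
      exact b5 D.root_lt
  · simp only [Cmd.cost]; omega

/-! ## Counting the ends of the paths -/

/-- Fields `3` and `4` count lower and upper ends of all paths, fields `5` and `6` only those of
paths with positive weight, that is, with finite quasigap. -/
def countBody : Cmd :=
  .inc 3 12 ;; .inc 4 13 ;; .ifLt 0 14 (.inc 5 12 ;; .inc 6 13) .skip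

/-- The number of paths in `L` with lower end `v`. -/
def cntU (L : List Item) (v : ℕ) : ℕ := L.countP fun it => decide (it.u = v)

/-- The number of paths in `L` that end immediately below `v`. -/
def cntP (L : List Item) (v : ℕ) : ℕ := L.countP fun it => decide (it.p = v)

structure CountInv (g0 : ℕ → ℕ → ℕ) (done : List Item) (g : ℕ → ℕ → ℕ) : Prop where
  u : ∀ v, g 3 v = cntU done v
  p : ∀ v, g 4 v = cntP done v
  uf : ∀ v, g 5 v = cntU (done.filter fun it => decide (0 < it.q)) v
  pf : ∀ v, g 6 v = cntP (done.filter fun it => decide (0 < it.q)) v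
  rest : ∀ k, k < 3 ∨ 6 < k → ∀ v, g k v = g0 k v

theorem cntU_append (L : List Item) (it : Item) (v : ℕ) :
    cntU (L ++ [it]) v = if v = it.u then cntU L it.u + 1 else cntU L v := by
  simp only [cntU, List.countP_append, List.countP_singleton, decide_eq_true_eq]
  split_ifs with h1 h2 h2
  · rw [h1]
  · exact absurd h1.symm h2
  · exact absurd h2.symm h1
  · rfl

theorem cntP_append (L : List Item) (it : Item) (v : ℕ) :
    cntP (L ++ [it]) v = if v = it.p then cntP L it.p + 1 else cntP L v := by
  simp only [cntP, List.countP_append, List.countP_singleton, decide_eq_true_eq]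
  split_ifs with h1 h2 h2
  · rw [h1]
  · exact absurd h1.symm h2
  · exact absurd h2.symm h1
  · rfl

theorem countBody_spec {W B : ℕ} {D : TreeInput} (hF : Fits W B D) {r inp} (g0)
    (r0 : r 0 = 0) (r1 : r 1 = 1) :
    BodySpec W B countBody r inp D.items (CountInv g0) := by
  intro done it rest σ hd hr hi hJ hu hp hq
  have hit : it ∈ D.items := by rw [← hd]; simp
  obtain ⟨iu, ip, -⟩ := D.item_ok it hit
  have pu := hF.rec_lt iu
  have pp := hF.rec_lt ip
  have hlen : done.length < D.items.length := by rw [← hd]; simp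
  have l1 : cntU done it.u ≤ done.length := List.countP_le_length
  have l2 : cntP done it.p ≤ done.length := List.countP_le_length
  have l0 := List.length_filter_le (fun it : Item => decide (0 < it.q)) done
  have l3 : cntU (done.filter fun it => decide (0 < it.q)) it.u ≤ _ := List.countP_le_length
  have l4 : cntP (done.filter fun it => decide (0 < it.q)) it.p ≤ _ := List.countP_le_length
  have hW := hF.cap
  have hB := hF.items
  have e0 : σ.reg 0 = 0 := (hr 0 (by omega)).trans r0
  have e1 : σ.reg 1 = 1 := (hr 1 (by omega)).trans r1
  simp only [countBody, Cmd.inc, wp, St.setReg_reg, St.setReg_inp, St.setReg_g, St.setG_reg,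
    St.setG_inp, St.setG_g, e0, e1, hu, hp, hq, hJ.u, hJ.p, hJ.uf, hJ.pf, Nat.reduceEqDiff, if_true,
    if_false, OfNat.zero_ne_ofNat, OfNat.one_ne_ofNat, Nat.reduceLT, true_and]
  refine ⟨pu, by omega, pu, pp, by omega, pp, fun h => ⟨pu, by omega, pu, pp, by omega, pp, ?_, ?_⟩,
    fun h => ⟨?_, ?_⟩⟩
  · have hf : (done ++ [it]).filter (fun it => decide (0 < it.q)) =
        done.filter (fun it => decide (0 < it.q)) ++ [it] := by simp [h]
    constructor <;> (try intro v) <;> simp [St.setG_g, hf, cntU_append, cntP_append,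
      hJ.u, hJ.p, hJ.uf, hJ.pf]
    intro hk x
    rw [if_neg (by omega), if_neg (by omega), if_neg (by omega), if_neg (by omega), hJ.rest v hk]
  · intro x hx
    simp [show x ≠ 15 by omega]
  · have hf : (done ++ [it]).filter (fun it => decide (0 < it.q)) =
        done.filter (fun it => decide (0 < it.q)) := by simp [h]
    constructor <;> (try intro v) <;> simp [St.setG_g, hf, cntU_append, cntP_append,
      hJ.u, hJ.p, hJ.uf, hJ.pf]
    intro hk x
    rw [if_neg (by omega), if_neg (by omega), hJ.rest v hk]
  · intro x hx
    simp [show x ≠ 15 by omega]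

/-! ## Processing the nodes from the leaves to the root -/

section kahn

open Classical

variable {D : TreeInput}

/-- The number of nodes outside `S` with parent `v`. -/
noncomputable def Arbor.degOut (T : Arbor) (S : Finset ℕ) (v : ℕ) : ℕ :=
  ((Finset.range T.n).filter fun x => T.par x = v ∧ x ∉ S).card

theorem Arbor.degOut_insert (T : Arbor) {S : Finset ℕ} {v : ℕ} (hv : v < T.n) (hS : v ∉ S)
    (w : ℕ) :
    T.degOut S w = T.degOut (insert v S) w + if w = T.par v then 1 else 0 := by
  unfold Arbor.degOut
  split_ifs with h
  · rw [← Finset.card_insert_of_notMem (a := v) (by simp)]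
    congr 1
    ext x
    simp only [Finset.mem_filter, Finset.mem_range, Finset.mem_insert, not_or]
    by_cases e : x = v
    · subst e; simp [hv, hS, h]
    · simp [e]
  · rw [add_zero]
    congr 1
    ext x
    simp only [Finset.mem_filter, Finset.mem_range, Finset.mem_insert, not_or]
    by_cases e : x = v
    · subst e; simp [Ne.symm h]
    · simp [e]

/-- Counters for the paths in `L` after the nodes in `S` have been processed. -/
def CntInv (D : TreeInput) (L : List Item) (S : Finset ℕ) (f : ℕ → ℕ) : Prop :=
  ∀ v, v < D.n → (v ∈ S → f v = D.cov L v) ∧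
    (v ∉ S → f v = cntU L v + ∑ c ∈ (D.children v).filter (· ∈ S), D.cov L c)

/-- When all children of `v` have been added, the counter is the right-hand side of `Arbor.cov_add`,
and subtracting the paths that end immediately below `v` leaves the wanted count. -/
theorem CntInv.eq {L : List Item} (hL : ∀ it ∈ L, it.u < D.n ∧ it.p < D.n ∧ D.le it.p it.u)
    {S f} (h : CntInv D L S f) {v : ℕ} (hv : v < D.n) (hS : v ∉ S)
    (hch : ∀ c ∈ D.children v, c ∈ S) : f v - cntP L v = D.cov L v := by
  rw [(h v hv).2 hS, Finset.filter_true_of_mem hch]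
  have := D.cov_add L hL hv
  simp only [cntU, cntP]
  omega

theorem sum_filter_insert {v p : ℕ} {S : Finset ℕ} (hS : v ∉ S) (hp : D.Child p v)
    (F : ℕ → ℕ) (w : ℕ) : ∑ c ∈ (D.children w).filter (· ∈ insert v S), F c =
      (∑ c ∈ (D.children w).filter (· ∈ S), F c) + if w = p then F v else 0 := by
  split_ifs with h
  · rw [h, add_comm, ← Finset.sum_insert (a := v) (by simp [hS])]
    congr 1
    ext x
    simp only [Finset.mem_filter, Finset.mem_insert]
    by_cases e : x = v
    · subst e; simp [D.mem_children, hp]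
    · simp [e]
  · rw [add_zero]
    congr 1
    ext x
    simp only [Finset.mem_filter, Finset.mem_insert]
    by_cases e : x = v
    · subst e
      simp only [D.mem_children, true_or, and_true, hS, and_false, iff_false]
      exact fun hc => h (hc.2.2.symm.trans hp.2.2)
    · simp [e]

/-- Excludes overflow: by `Arbor.cov_add` a completely filled counter is a path count plus a number
of path ends, each at most the length of `L`. -/
theorem CntInv.le {L : List Item} (hL : ∀ it ∈ L, it.u < D.n ∧ it.p < D.n ∧ D.le it.p it.u)
    {S f} (h : CntInv D L S f) {v p : ℕ} (hS : v ∉ S) (hp : D.Child p v) (hpS : p ∉ S) :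
    f p + D.cov L v ≤ 2 * L.length := by
  have e := sum_filter_insert hS hp (D.cov L) p
  rw [if_pos rfl] at e
  rw [(h p hp.lt).2 hpS, add_assoc, ← e]
  have h1 : ∑ c ∈ (D.children p).filter (· ∈ insert v S), D.cov L c ≤
      ∑ c ∈ D.children p, D.cov L c :=
    Finset.sum_le_sum_of_subset (Finset.filter_subset _ _)
  have h2 := D.cov_add L hL hp.lt
  have h3 : D.cov L p ≤ L.length := List.countP_le_length
  have h4 : L.countP (fun it => decide (it.p = p)) ≤ L.length := List.countP_le_length
  simp only [cntU]
  omega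

theorem CntInv.step {L : List Item} {S f f'} (h : CntInv D L S f) {v p : ℕ} (hS : v ∉ S)
    (hp : D.Child p v) (hpS : p ∉ S)
    (hf : ∀ w, f' w = if w = p then f p + D.cov L v else if w = v then D.cov L v else f w) :
    CntInv D L (insert v S) f' := by
  have hpv : p ≠ v := fun e => D.not_le_par hp.1 hp.2.1 (by rw [hp.2.2, e]; exact D.le_refl hp.1)
  intro w hw
  rw [hf w]
  constructor
  · intro hwS
    rcases Finset.mem_insert.1 hwS with rfl | hwS
    · rw [if_neg (Ne.symm hpv), if_pos rfl]
    · rw [if_neg (fun e : w = p => hpS (e ▸ hwS)), if_neg (fun e : w = v => hS (e ▸ hwS))]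
      exact (h w hw).1 hwS
  · intro hwS
    simp only [Finset.mem_insert, not_or] at hwS
    rw [sum_filter_insert hS hp, if_neg hwS.1]
    split_ifs with e
    · rw [e, (h p hp.lt).2 hpS, add_assoc]
    · rw [(h w hw).2 hwS.2, add_zero]

/-- `q` lists nodes other than the root, children before parents. -/
structure Queue (D : TreeInput) (q : List ℕ) : Prop where
  nodup : q.Nodup
  mem : ∀ v ∈ q, v < D.n ∧ v ≠ D.root
  ord : ∀ j (hj : j < q.length), ∀ x, x < D.n → D.par x = q[j] → x ∈ q.take j

/-- The state after the first `i` nodes of the queue `q` have been processed. -/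
structure KahnInv (D : TreeInput) (g0 : ℕ → ℕ → ℕ) (q : List ℕ) (i : ℕ) (g : ℕ → ℕ → ℕ) : Prop where
  queue : Queue D q
  le : i ≤ q.length
  loc : ∀ j (hj : j < q.length), g 7 j = q[j]
  deg : ∀ v, v < D.n → g 2 v = D.degOut (q.take i).toFinset v
  mem_iff : ∀ v, v < D.n → (v ∈ q ↔ g 2 v = 0)
  cU : CntInv D D.items (q.take i).toFinset (g 3)
  cF : CntInv D D.fin (q.take i).toFinset (g 5)
  pU : ∀ v, g 4 v = cntP D.items v
  pF : ∀ v, g 6 v = cntP D.fin v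
  cf : ∀ v, v < D.n → g 8 v =
    ∑ c ∈ (D.children v).filter (· ∈ (q.take i).toFinset), if D.Full c then 1 else 0
  fc : ∀ v, v < D.n → 0 < g 8 v → D.Child v (g 9 v) ∧ D.Full (g 9 v)
  rest : ∀ k, k < 2 ∨ 9 < k → ∀ v, g k v = g0 k v

theorem Queue.length_le {q : List ℕ} (h : Queue D q) : q.length ≤ D.n - 1 := by
  rw [← List.toFinset_card_of_nodup h.nodup, ← Finset.card_range D.n,
    ← Finset.card_erase_of_mem (Finset.mem_range.2 D.root_lt)]
  refine Finset.card_le_card fun v hv => ?_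
  have := h.mem v (by simpa using hv)
  exact Finset.mem_erase.2 ⟨this.2, Finset.mem_range.2 this.1⟩

theorem take_succ_toFinset {q : List ℕ} {i : ℕ} (hi : i < q.length) :
    (q.take (i + 1)).toFinset = insert q[i] (q.take i).toFinset := by
  rw [List.take_succ_eq_append_getElem hi, List.toFinset_append]
  ext x
  simp [or_comm]

theorem getElem_notMem_take {q : List ℕ} (h : q.Nodup) {i : ℕ} (hi : i < q.length) :
    q[i] ∉ q.take i := by
  have : (q.take (i + 1)).Nodup := h.sublist (List.take_sublist _ _)
  rw [List.take_succ_eq_append_getElem hi, List.nodup_append] at this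
  exact fun hm => this.2.2 _ hm _ (by simp) rfl

/-- A node of maximal rank among those missing in the queue would have a child outside the queue,
which is again a missing node, of larger rank. -/
theorem KahnInv.mem_of_ne_root {g0 q g} (h : KahnInv D g0 q q.length g) {v : ℕ} (hv : v < D.n)
    (hr : v ≠ D.root) : v ∈ q := by
  by_contra hn
  have hne : ((Finset.range D.n).filter fun v => v ≠ D.root ∧ v ∉ q).Nonempty :=
    ⟨v, by simp [hv, hr, hn]⟩
  obtain ⟨x, hx, hmax⟩ := Finset.exists_max_image _ D.rank hne
  simp only [Finset.mem_filter, Finset.mem_range] at hx hmax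
  have hd := mt (h.mem_iff x hx.1).2 hx.2.2
  rw [h.deg x hx.1, List.take_length] at hd
  obtain ⟨y, hy⟩ := Finset.card_pos.1 (Nat.pos_of_ne_zero hd)
  simp only [Finset.mem_filter, Finset.mem_range, List.mem_toFinset] at hy
  have hyr : y ≠ D.root := by
    rintro rfl
    exact hx.2.1 (hy.2.1.symm.trans D.par_root)
  have h1 := hmax y ⟨hy.1, hyr, hy.2.2⟩
  have h2 := D.rank_lt y hy.1 hyr
  rw [hy.2.1] at h2
  omega

/-- The queue never runs dry early: if all its entries have been processed, it already contains
every node except the root. -/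
theorem KahnInv.lt_length {g0 q i g} (h : KahnInv D g0 q i g) (hi : i < D.n - 1) :
    i < q.length := by
  by_contra hn
  obtain rfl : i = q.length := by have := h.le; omega
  have : (Finset.range D.n).erase D.root ⊆ q.toFinset := by
    intro v hv
    simp only [Finset.mem_erase, Finset.mem_range] at hv
    simpa using h.mem_of_ne_root hv.2 hv.1
  have := Finset.card_le_card this
  rw [List.toFinset_card_of_nodup h.queue.nodup,
    Finset.card_erase_of_mem (Finset.mem_range.2 D.root_lt), Finset.card_range] at this
  omega

theorem Queue.child {q : List ℕ} (h : Queue D q) {i : ℕ} (hi : i < q.length) :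
    D.Child (D.par q[i]) q[i] := by
  have := h.mem _ (List.getElem_mem hi)
  exact ⟨this.1, this.2, rfl⟩

theorem Queue.notMem {q : List ℕ} (h : Queue D q) {i : ℕ} (hi : i < q.length) :
    q[i] ∉ (q.take i).toFinset := by
  rw [List.mem_toFinset]
  exact getElem_notMem_take h.nodup hi

theorem Queue.children_mem {q : List ℕ} (h : Queue D q) {i : ℕ} (hi : i < q.length) :
    ∀ c ∈ D.children q[i], c ∈ (q.take i).toFinset := by
  intro c hc
  have hc := D.mem_children.1 hc
  exact List.mem_toFinset.2 (h.ord i hi c hc.1 hc.2.2)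

theorem Queue.par_notMem {q : List ℕ} (h : Queue D q) {i : ℕ} (hi : i < q.length) :
    D.par q[i] ∉ (q.take i).toFinset := by
  intro hm
  have hc := h.child hi
  rw [List.mem_toFinset, List.mem_take_iff_getElem] at hm
  obtain ⟨j, hj, e⟩ := hm
  have hj' : j < i ∧ j < q.length := by omega
  have := h.ord j hj'.2 q[i] hc.1 (hc.2.2.trans e.symm)
  refine getElem_notMem_take h.nodup hi ?_
  exact List.take_subset_take_left _ (by omega) this

/-- The hypotheses list the changes made to the records while `q[i]` is processed. The parent is
appended exactly when its counter of unprocessed children falls from `1` to `0`. -/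
theorem KahnInv.step {g0 q i g g'} (h : KahnInv D g0 q i g) (hi : i < q.length) (q' : List ℕ)
    (hq : q' = if g 2 (D.par q[i]) = 1 then q ++ [D.par q[i]] else q)
    (h2 : ∀ w, g' 2 w = if w = D.par q[i] then g 2 (D.par q[i]) - 1 else g 2 w)
    (h3 : ∀ w, g' 3 w = if w = D.par q[i] then g 3 (D.par q[i]) + D.cov D.items q[i] else
      if w = q[i] then D.cov D.items q[i] else g 3 w)
    (h5 : ∀ w, g' 5 w = if w = D.par q[i] then g 5 (D.par q[i]) + D.cov D.fin q[i] else
      if w = q[i] then D.cov D.fin q[i] else g 5 w)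
    (h4 : ∀ w, g' 4 w = g 4 w) (h6 : ∀ w, g' 6 w = g 6 w)
    (h7 : ∀ j, g' 7 j = if g 2 (D.par q[i]) = 1 then (if j = q.length then D.par q[i] else g 7 j)
      else g 7 j)
    (h8 : ∀ w, g' 8 w = if D.Full q[i] then (if w = D.par q[i] then g 8 (D.par q[i]) + 1
      else g 8 w) else g 8 w)
    (h9 : ∀ w, g' 9 w = if D.Full q[i] then (if w = D.par q[i] then q[i] else g 9 w) else g 9 w)
    (hrest : ∀ k, k < 2 ∨ 9 < k → ∀ w, g' k w = g k w) : KahnInv D g0 q' (i + 1) g' := by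
  have hc := h.queue.child hi
  have hS := h.queue.notMem hi
  have hpS := h.queue.par_notMem hi
  have htake : q'.take (i + 1) = q.take (i + 1) := by
    rw [hq]
    split_ifs
    · exact List.take_append_of_le_length hi
    · rfl
  have hdeg := D.degOut_insert hc.1 hS
  have hp2 := h.deg _ hc.lt
  have hpos : 1 ≤ g 2 (D.par q[i]) := by
    rw [hp2, hdeg, if_pos rfl]; omega
  have hd' : ∀ v, v < D.n → g' 2 v = D.degOut (q'.take (i + 1)).toFinset v := by
    intro v hv
    have := hdeg v
    rw [htake, take_succ_toFinset hi, h2 v]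
    split_ifs with e
    · rw [if_pos e] at this
      rw [hp2, ← e]; omega
    · rw [h.deg v hv, hdeg v, if_neg e, add_zero]
  have hpq : D.par q[i] ∉ q := by
    rw [h.mem_iff _ hc.lt]; omega
  have hnew : g 2 (D.par q[i]) = 1 → D.par q[i] ≠ D.root ∧
      ∀ x, x < D.n → D.par x = D.par q[i] → x ∈ q.take (i + 1) := by
    intro e
    have h0 : D.degOut (q.take (i + 1)).toFinset (D.par q[i]) = 0 := by
      rw [← htake, ← hd' _ hc.lt, h2, if_pos rfl, e]
    have key : ∀ x, x < D.n → D.par x = D.par q[i] → x ∈ q.take (i + 1) := by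
      intro x hx hxp
      by_contra hn
      have : x ∈ (Finset.range D.n).filter fun x => D.par x = D.par q[i] ∧
          x ∉ (q.take (i + 1)).toFinset := by simp [hx, hxp, hn]
      rw [Finset.card_eq_zero.1 h0] at this
      simp at this
    -- The root counts itself among its children, so its counter never vanishes and it never enters
    -- the queue.
    refine ⟨fun hr => ?_, key⟩
    have := key D.root D.root_lt (by rw [D.par_root, hr])
    exact (h.queue.mem _ (List.mem_of_mem_take this)).2 rfl
  have hQ : Queue D q' := by
    by_cases e : g 2 (D.par q[i]) = 1
    · rw [if_pos e] at hq
      obtain ⟨n1, n2⟩ := hnew e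
      rw [hq]
      refine ⟨?_, ?_, ?_⟩
      · rw [List.nodup_append]
        refine ⟨h.queue.nodup, by simp, ?_⟩
        rintro a ha b hb rfl
        rw [List.mem_singleton] at hb
        exact hpq (hb ▸ ha)
      · intro v hv
        rcases List.mem_append.1 hv with hv | hv
        · exact h.queue.mem v hv
        · rw [List.mem_singleton] at hv
          rw [hv]; exact ⟨hc.lt, n1⟩
      · intro j hj x hx hxp
        simp only [List.length_append, List.length_singleton] at hj
        by_cases hj' : j < q.length
        · rw [List.getElem_append_left hj'] at hxp
          rw [List.take_append_of_le_length (by omega)]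
          exact h.queue.ord j hj' x hx hxp
        · obtain rfl : j = q.length := by omega
          simp only [List.getElem_concat_length] at hxp
          rw [List.take_left]
          exact List.mem_of_mem_take (n2 x hx hxp)
    · rw [if_neg e] at hq
      rw [hq]; exact h.queue
  refine ⟨hQ, ?_, ?_, hd', ?_, ?_, ?_, ?_, ?_, ?_, ?_, ?_⟩
  · rw [hq]
    split_ifs
    · simp; omega
    · exact hi
  · intro j hj
    rw [h7 j]
    by_cases e : g 2 (D.par q[i]) = 1
    · simp only [if_pos e] at hq ⊢
      subst hq
      simp only [List.length_append, List.length_singleton] at hj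
      by_cases hj' : j < q.length
      · rw [if_neg (by omega), List.getElem_append_left hj', h.loc j hj']
      · obtain rfl : j = q.length := by omega
        simp
    · simp only [if_neg e] at hq ⊢
      subst hq
      exact h.loc j hj
  · intro v hv
    rw [h2 v]
    by_cases e : g 2 (D.par q[i]) = 1
    · rw [if_pos e] at hq
      rw [hq, List.mem_append, List.mem_singleton]
      by_cases e' : v = D.par q[i]
      · simp [e', e]
      · simp only [e', or_false, if_false]
        exact h.mem_iff v hv
    · rw [if_neg e] at hq
      rw [hq]
      by_cases e' : v = D.par q[i]
      · rw [if_pos e', e']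
        simp only [hpq, false_iff]
        omega
      · rw [if_neg e']
        exact h.mem_iff v hv
  · rw [htake, take_succ_toFinset hi]
    exact h.cU.step hS hc hpS h3
  · rw [htake, take_succ_toFinset hi]
    exact h.cF.step hS hc hpS h5
  · intro v; rw [h4, h.pU]
  · intro v; rw [h6, h.pF]
  · intro v hv
    rw [htake, take_succ_toFinset hi, sum_filter_insert hS hc, h8 v, ← h.cf v hv]
    by_cases hF : D.Full q[i]
    · simp only [if_pos hF]
      split_ifs with e
      · rw [e]
      · rfl
    · simp [if_neg hF]
  · intro v hv
    rw [h8 v, h9 v]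
    by_cases hF : D.Full q[i]
    · simp only [if_pos hF]
      split_ifs with e
      · intro _
        rw [e]; exact ⟨hc, hF⟩
      · exact h.fc v hv
    · simp only [if_neg hF]
      exact h.fc v hv
  · intro k hk v
    rw [hrest k hk, h.rest k hk]

end kahn

def queueBody : Cmd :=
  .ld 12 2 10 ;; .ifLt 12 1 (.st 7 11 10 ;; .add 11 11 1) .skip ;; .add 10 10 1

def queuePhase : Cmd := (.const 10 0 ;; .const 11 0) ;; .whileLt 10 2 queueBody

theorem nodup_length_le {q : List ℕ} (h : q.Nodup) {n : ℕ} (hq : ∀ v ∈ q, v < n) :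
    q.length ≤ n := by
  rw [← List.toFinset_card_of_nodup h]
  conv_rhs => rw [← Finset.card_range n]
  exact Finset.card_le_card fun v hv => Finset.mem_range.2 (hq v (by simpa using hv))

theorem queuePhase_tri {W B : ℕ} {D : TreeInput} (hF : Fits W B D) {σ : St} (hb : Base D σ) :
    Tri W B queuePhase σ (100 * (D.n + 1)) fun σ' => Base D σ' ∧ σ'.inp = σ.inp ∧
      (∀ k, k ≠ 7 → ∀ v, σ'.g k v = σ.g k v) ∧ ∃ q : List ℕ, σ'.reg 11 = q.length ∧ q.Nodup ∧
        (∀ j (hj : j < q.length), σ'.g 7 j = q[j]) ∧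
        ∀ v, v ∈ q ↔ v < D.n ∧ σ.g 2 v = 0 := by
  have hW := hF.cap
  have hB := hF.base
  refine (Tri.seq (Tri.of_wp _ (Q := fun σ' => Base D σ' ∧ σ'.inp = σ.inp ∧ σ'.g = σ.g ∧
    σ'.reg 10 = 0 ∧ σ'.reg 11 = 0) ?_) (T₂ := D.n * (queueBody.cost + 2) + 2) ?_).mono ?_
    (fun _ h => h)
  · simp only [wp]
    refine ⟨by omega, by omega, hb.congr fun x hx => ?_, by simp, by simp, by simp [St.setReg_reg],
      by simp [St.setReg_reg]⟩
    simp only [St.setReg_reg]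
    rw [if_neg (by omega), if_neg (by omega)]
  · rintro σ₁ ⟨b, ei, eg, e10, e11⟩
    refine (Tri.while_inv (fun i σ' => Base D σ' ∧ σ'.inp = σ.inp ∧
      (∀ k, k ≠ 7 → ∀ v, σ'.g k v = σ.g k v) ∧ σ'.reg 10 = i ∧ ∃ q : List ℕ,
        σ'.reg 11 = q.length ∧ q.Nodup ∧ (∀ j (hj : j < q.length), σ'.g 7 j = q[j]) ∧
        ∀ v, v ∈ q ↔ v < i ∧ σ.g 2 v = 0) queueBody.cost D.n ?_ ?_ ?_).mono le_rfl ?_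
    · rintro i hi τ ⟨b, ei, eg, e10, q, q1, q2, q3, q4⟩
      refine ⟨by rw [e10, b.n]; exact hi, Tri.of_wp _ ?_⟩
      have hql : q.length ≤ i := nodup_length_le q2 fun v hv => ((q4 v).1 hv).1
      have p1 := hF.rec_lt hi
      simp only [queueBody, wp, St.setReg_reg, St.setReg_g, St.setG_reg, e10, q1, b.one,
        Nat.reduceEqDiff, if_true, if_false, OfNat.one_ne_ofNat, Nat.reduceLT, true_and]
      refine ⟨p1, fun h => ⟨by omega, by omega, by omega, ?_⟩, fun h => ⟨by omega, ?_⟩⟩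
      · refine ⟨b.congr fun x hx => ?_, by simpa using ei, ?_, q ++ [i], by simp, ?_,
          ?_, ?_⟩
        · simp only [St.setReg_reg, St.setG_reg]
          rw [if_neg (by omega), if_neg (by omega), if_neg (by omega)]
        · intro k hk v
          simp only [St.setReg_g, St.setG_g]
          rw [if_neg hk, eg k hk]
        · rw [List.nodup_append]
          refine ⟨q2, by simp, ?_⟩
          rintro a ha x hx rfl
          rw [List.mem_singleton] at hx
          have := ((q4 a).1 ha).1
          omega
        · intro j hj
          simp only [List.length_append, List.length_singleton] at hj
          simp only [St.setReg_g, St.setG_g, if_true]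
          by_cases hj' : j < q.length
          · rw [if_neg (by omega), List.getElem_append_left hj', q3 j hj']
          · obtain rfl : j = q.length := by omega
            simp
        · intro v
          rw [List.mem_append, List.mem_singleton, q4 v]
          rw [eg 2 (by omega)] at h
          constructor
          · rintro (h' | rfl)
            · exact ⟨by omega, h'.2⟩
            · exact ⟨by omega, by omega⟩
          · rintro ⟨h1, h2⟩
            rcases Nat.lt_succ_iff_lt_or_eq.1 h1 with h3 | h3
            · exact Or.inl ⟨h3, h2⟩
            · exact Or.inr h3
      · refine ⟨b.congr fun x hx => ?_, by simpa using ei, ?_, q, by simp, q2,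
          by simpa using q3, ?_⟩
        · simp only [St.setReg_reg]
          rw [if_neg (by omega), if_neg (by omega)]
        · intro k hk v
          simpa using eg k hk v
        · intro v
          rw [q4 v]
          rw [eg 2 (by omega)] at h
          constructor
          · exact fun h' => ⟨by omega, h'.2⟩
          · rintro ⟨h1, h2⟩
            rcases Nat.lt_succ_iff_lt_or_eq.1 h1 with h3 | h3
            · exact ⟨h3, h2⟩
            · rw [h3] at h2; omega
    · rintro τ ⟨b, -, -, e10, -⟩
      rw [e10, b.n]; omega
    · exact ⟨b, ei, by intro k _ v; rw [eg], e10, [], by simp [e11], by simp, by simp, by simp⟩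
    · rintro τ ⟨b, ei, eg, e10, q, q1, q2, q3, q4⟩
      exact ⟨b, ei, eg, q, q1, q2, q3, q4⟩
  · simp [queueBody, Cmd.cost]; omega

/-- Both counters of the node are turned into path counts by subtracting upper ends, and are added
to those of the parent. A full node increments field `8` of its parent and becomes its recorded full
child in field `9`. Finally the parent loses an unprocessed child and, if it was the last one, joins
the queue. -/
def kahnBody : Cmd :=
  (.ld 12 7 10 ;; .ld 13 0 12 ;; .ld 14 3 12 ;; .ld 15 4 12 ;; .sub 14 14 15 ;; .st 3 12 14 ;;
    .ld 16 5 12 ;; .ld 15 6 12 ;; .sub 16 16 15 ;; .st 5 12 16 ;; .ld 15 3 13 ;; .add 15 15 14 ;;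
    .st 3 13 15 ;; .ld 15 5 13 ;; .add 15 15 16 ;; .st 5 13 15) ;;
  .ifLt 14 3 .skip (.ifLt 3 14 .skip (.inc 8 13 ;; .st 9 13 12)) ;;
  (.ld 15 2 13 ;; .sub 15 15 1 ;; .st 2 13 15 ;; .ifLt 15 1 (.st 7 11 13 ;; .add 11 11 1) .skip ;;
    .add 10 10 1)

theorem fin_ok (D : TreeInput) : ∀ it ∈ D.fin, it.u < D.n ∧ it.p < D.n ∧ D.le it.p it.u :=
  fun it h => D.item_ok it (List.mem_of_mem_filter h)

open Classical in
/-- The effect of one step of the bottom-up pass, for the node `v = q[i]` with parent `p`. -/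
structure KahnStep (D : TreeInput) (i len v p : ℕ) (σ σ' : St) : Prop where
  reg : ∀ x < 6, σ'.reg x = σ.reg x
  inp : σ'.inp = σ.inp
  r10 : σ'.reg 10 = i + 1
  r11 : σ'.reg 11 = if σ.g 2 p = 1 then len + 1 else len
  g2 : ∀ w, σ'.g 2 w = if w = p then σ.g 2 p - 1 else σ.g 2 w
  g3 : ∀ w, σ'.g 3 w = if w = p then σ.g 3 p + D.cov D.items v else
    if w = v then D.cov D.items v else σ.g 3 w
  g5 : ∀ w, σ'.g 5 w = if w = p then σ.g 5 p + D.cov D.fin v else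
    if w = v then D.cov D.fin v else σ.g 5 w
  g4 : ∀ w, σ'.g 4 w = σ.g 4 w
  g6 : ∀ w, σ'.g 6 w = σ.g 6 w
  g7 : ∀ j, σ'.g 7 j = if σ.g 2 p = 1 then (if j = len then p else σ.g 7 j) else σ.g 7 j
  g8 : ∀ w, σ'.g 8 w = if D.Full v then (if w = p then σ.g 8 p + 1 else σ.g 8 w) else σ.g 8 w
  g9 : ∀ w, σ'.g 9 w = if D.Full v then (if w = p then v else σ.g 9 w) else σ.g 9 w
  rest : ∀ k, k < 2 ∨ 9 < k → ∀ w, σ'.g k w = σ.g k w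

open Classical in
theorem kahnBody_tri {W B : ℕ} {D : TreeInput} (hF : Fits W B D) {g0 q i} {σ : St}
    (hb : Base D σ) (hg0 : ∀ v, v < D.n → g0 0 v = D.par v) (h10 : σ.reg 10 = i)
    (h11 : σ.reg 11 = q.length) (hi : i < q.length) (h : KahnInv D g0 q i σ.g) :
    Tri W B kahnBody σ kahnBody.cost fun σ' => Base D σ' ∧ σ'.inp = σ.inp ∧ σ'.reg 10 = i + 1 ∧
      ∃ q' : List ℕ, σ'.reg 11 = q'.length ∧ KahnInv D g0 q' (i + 1) σ'.g := by
  have hW := hF.cap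
  have hB := hF.base
  have hBi := hF.items
  have hc := h.queue.child hi
  have hS := h.queue.notMem hi
  have hpS := h.queue.par_notMem hi
  have hql := h.queue.length_le
  have hch := h.queue.children_mem hi
  have hv := hc.1
  have hp := hc.lt
  have pv := hF.rec_lt hv
  have pp := hF.rec_lt hp
  have e12 : σ.g 7 i = q[i] := h.loc i hi
  have e13 : σ.g 0 q[i] = D.par q[i] := by rw [h.rest 0 (by omega), hg0 _ hv]
  have hne : D.par q[i] ≠ q[i] := fun e => hc.2.1 (D.par_eq_self hv e)
  have c3 : σ.g 3 q[i] - σ.g 4 q[i] = D.cov D.items q[i] := by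
    rw [h.pU]; exact h.cU.eq D.item_ok hv hS hch
  have c5 : σ.g 5 q[i] - σ.g 6 q[i] = D.cov D.fin q[i] := by
    rw [h.pF]; exact h.cF.eq (fin_ok D) hv hS hch
  have l3 := h.cU.le D.item_ok hS hc hpS
  have l5 := h.cF.le (fin_ok D) hS hc hpS
  have l5' : D.fin.length ≤ D.items.length := List.length_filter_le _ _
  have l8 : σ.g 8 (D.par q[i]) ≤ D.n := by
    rw [h.cf _ hp]
    calc _ ≤ ∑ c ∈ (D.children (D.par q[i])).filter (· ∈ (q.take i).toFinset), 1 :=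
          Finset.sum_le_sum fun c _ => by split_ifs <;> simp
      _ ≤ (Finset.range D.n).card := by
          rw [← Finset.card_eq_sum_ones]
          refine Finset.card_le_card ((Finset.filter_subset _ _).trans ?_)
          exact Finset.filter_subset _ _
      _ = D.n := Finset.card_range _
  set v := q[i] with hvdef
  set p := D.par v with hpdef
  have fin : ∀ σ', KahnStep D i q.length v p σ σ' → Base D σ' ∧ σ'.inp = σ.inp ∧
      σ'.reg 10 = i + 1 ∧ ∃ q' : List ℕ, σ'.reg 11 = q'.length ∧
        KahnInv D g0 q' (i + 1) σ'.g := by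
    intro σ' k
    refine ⟨hb.congr k.reg, k.inp, k.r10, _, ?_,
      h.step hi _ rfl k.g2 k.g3 k.g5 k.g4 k.g6 k.g7 k.g8 k.g9 k.rest⟩
    rw [k.r11]
    split_ifs <;> simp
  refine Tri.of_wp _ (wp_mono _ (Q := KahnStep D i q.length v p σ) ?_ fin)
  simp only [kahnBody, Cmd.inc, wp, St.setReg_reg, St.setReg_g, St.setG_reg, St.setG_g, h10, h11,
    hb.one, hb.K, e12, e13, c3, c5, Nat.reduceEqDiff, if_true, if_false, OfNat.one_ne_ofNat,
    Nat.reduceLT, true_and, if_neg hne]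
  have hp2 : σ.g 2 p ≠ 0 := by
    rw [h.deg _ hp, D.degOut_insert hv hS, if_pos rfl]; omega
  have pi : 16 * i + B + 16 ≤ 2 ^ W := hF.rec_lt (by omega)
  have pq : 16 * q.length + B + 16 ≤ 2 ^ W := by omega
  have hd' : (σ.g 2 p - 1 < 1) = (σ.g 2 p = 1) := propext (by omega)
  have hFull : D.Full v ↔ D.cov D.items v = D.K := Iff.rfl
  have s3 : σ.g 3 p + D.cov D.items v < 2 ^ W := by omega
  have s5 : σ.g 5 p + D.cov D.fin v < 2 ^ W := by omega
  have s8 : σ.g 8 p + 1 < 2 ^ W := by omega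
  have s11 : q.length + 1 < 2 ^ W := by omega
  have s10 : i + 1 < 2 ^ W := by omega
  -- The language tests equality by two strict comparisons, which gives three branches.
  rcases lt_trichotomy (D.cov D.items v) D.K with hK | hK | hK
  · have nF : ¬ D.Full v := by rw [hFull]; omega
    simp only [pi, pv, pp, pq, s3, s5, s8, s10, s11, hd', hK, hK.not_gt, true_and, true_implies,
      not_true_eq_false, not_false_eq_true, false_implies, and_true]
    refine ⟨fun hd => ⟨?_, ?_, ?_, ?_, ?_, ?_, ?_, ?_, ?_, ?_, ?_, ?_, ?_⟩,
      fun hd => ⟨?_, ?_, ?_, ?_, ?_, ?_, ?_, ?_, ?_, ?_, ?_, ?_, ?_⟩⟩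
    all_goals try intro w
    all_goals try intro hw
    all_goals try intro z
    all_goals simp only [St.setReg_reg, St.setReg_g, St.setReg_inp, St.setG_inp, St.setG_reg,
      St.setG_g, hd, nF, h11, Nat.reduceEqDiff, if_true, if_false]
    all_goals repeat rw [if_neg (by omega)]
  · have nF : D.Full v := hFull.2 hK
    have k1 : ¬ D.cov D.items v < D.K := by omega
    have k2 : ¬ D.K < D.cov D.items v := by omega
    simp only [pi, pv, pp, pq, s3, s5, s8, s10, s11, hd', k1, k2, true_and, true_implies,
      not_false_eq_true, false_implies]
    refine ⟨fun hd => ⟨?_, ?_, ?_, ?_, ?_, ?_, ?_, ?_, ?_, ?_, ?_, ?_, ?_⟩,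
      fun hd => ⟨?_, ?_, ?_, ?_, ?_, ?_, ?_, ?_, ?_, ?_, ?_, ?_, ?_⟩⟩
    all_goals try intro w
    all_goals try intro hw
    all_goals try intro z
    all_goals simp only [St.setReg_reg, St.setReg_g, St.setReg_inp, St.setG_inp, St.setG_reg,
      St.setG_g, hd, nF, h11, Nat.reduceEqDiff, if_true, if_false]
    all_goals repeat rw [if_neg (by omega)]
  · have nF : ¬ D.Full v := by rw [hFull]; omega
    simp only [pi, pv, pp, pq, s3, s5, s8, s10, s11, hd', hK, hK.not_gt, true_and, true_implies,
      not_true_eq_false, not_false_eq_true, false_implies, and_true]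
    refine ⟨fun hd => ⟨?_, ?_, ?_, ?_, ?_, ?_, ?_, ?_, ?_, ?_, ?_, ?_, ?_⟩,
      fun hd => ⟨?_, ?_, ?_, ?_, ?_, ?_, ?_, ?_, ?_, ?_, ?_, ?_, ?_⟩⟩
    all_goals try intro w
    all_goals try intro hw
    all_goals try intro z
    all_goals simp only [St.setReg_reg, St.setReg_g, St.setReg_inp, St.setG_inp, St.setG_reg,
      St.setG_g, hd, nF, h11, Nat.reduceEqDiff, if_true, if_false]
    all_goals repeat rw [if_neg (by omega)]

def kahnPhase : Cmd := .const 10 0 ;; .whileLt 10 11 kahnBody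

/-- `q` lists all nodes other than the root, children before parents. -/
structure Order (D : TreeInput) (q : List ℕ) : Prop extends Queue D q where
  mem_of : ∀ v, v < D.n → v ≠ D.root → v ∈ q
  length : q.length = D.n - 1

/-- The records after the bottom-up pass. -/
structure Counted (D : TreeInput) (q : List ℕ) (g : ℕ → ℕ → ℕ) : Prop where
  order : Order D q
  par : ∀ v, v < D.n → g 0 v = D.par v
  len : ∀ v, v < D.n → g 1 v = D.len v
  loc : ∀ j (hj : j < q.length), g 7 j = q[j]
  cU : ∀ v, v < D.n → v ≠ D.root → g 3 v = D.cov D.items v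
  cF : ∀ v, v < D.n → v ≠ D.root → g 5 v = D.cov D.fin v
  cf : ∀ v, v < D.n → g 8 v = D.cf v
  fc : ∀ v, v < D.n → 0 < D.cf v → D.Child v (g 9 v) ∧ D.Full (g 9 v)

theorem Counted.congr {D : TreeInput} {q g g'} (h : Counted D q g)
    (e : ∀ k, k < 10 → ∀ v, g' k v = g k v) : Counted D q g' where
  order := h.order
  par v hv := (e 0 (by omega) v).trans (h.par v hv)
  len v hv := (e 1 (by omega) v).trans (h.len v hv)
  loc j hj := (e 7 (by omega) j).trans (h.loc j hj)
  cU v hv hr := (e 3 (by omega) v).trans (h.cU v hv hr)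
  cF v hv hr := (e 5 (by omega) v).trans (h.cF v hv hr)
  cf v hv := (e 8 (by omega) v).trans (h.cf v hv)
  fc v hv hc := by rw [e 9 (by omega)]; exact h.fc v hv hc

open Classical in
theorem kahnInv_zero {D : TreeInput} {g : ℕ → ℕ → ℕ} {q : List ℕ} (hq : q.Nodup)
    (hloc : ∀ j (hj : j < q.length), g 7 j = q[j])
    (hmem : ∀ v, v ∈ q ↔ v < D.n ∧ g 2 v = 0) (hdeg : ∀ v, v < D.n → g 2 v = D.deg D.n v)
    (h3 : ∀ v, g 3 v = cntU D.items v) (h4 : ∀ v, g 4 v = cntP D.items v)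
    (h5 : ∀ v, g 5 v = cntU D.fin v) (h6 : ∀ v, g 6 v = cntP D.fin v) (h8 : ∀ v, g 8 v = 0) :
    KahnInv D g q 0 g := by
  have key : ∀ v ∈ q, ∀ x, x < D.n → D.par x ≠ v := by
    intro v hv x hx e
    obtain ⟨h1, h2⟩ := (hmem v).1 hv
    rw [hdeg v h1] at h2
    have : x ∈ (Finset.range D.n).filter fun x => D.par x = v := by simp [hx, e]
    rw [Finset.card_eq_zero.1 h2] at this
    simp at this
  have hcnt : ∀ L f, (∀ v, f v = cntU L v) → CntInv D L (q.take 0).toFinset f := by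
    intro L f hf v _
    simp [hf v]
  refine ⟨⟨hq, fun v hv => ⟨((hmem v).1 hv).1, ?_⟩, ?_⟩, by simp, hloc, ?_, ?_, hcnt _ _ h3,
    hcnt _ _ h5, h4, h6, ?_, ?_, by simp⟩
  · rintro rfl
    exact key _ hv D.root D.root_lt D.par_root
  · intro j hj x hx hxp
    exact absurd hxp (key _ (List.getElem_mem hj) x hx)
  · intro v hv
    rw [hdeg v hv]
    simp [Arbor.deg, Arbor.degOut]
  · intro v hv
    rw [hmem v]
    simp [hv]
  · intro v _
    simp [h8 v]
  · intro v _ h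
    rw [h8 v] at h
    omega

open Classical in
theorem KahnInv.counted {D : TreeInput} {g0 g : ℕ → ℕ → ℕ} {q : List ℕ}
    (h : KahnInv D g0 q (D.n - 1) g) (hpar : ∀ v, v < D.n → g0 0 v = D.par v)
    (hlen : ∀ v, v < D.n → g0 1 v = D.len v) : Counted D q g := by
  have hl : q.length = D.n - 1 := le_antisymm h.queue.length_le h.le
  have ht : q.take (D.n - 1) = q := by rw [← hl, List.take_length]
  have hm : ∀ v, v < D.n → v ≠ D.root → v ∈ q := by
    intro v hv hr
    rw [← hl] at h
    exact h.mem_of_ne_root hv hr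
  have hcf : ∀ v, v < D.n → g 8 v = D.cf v := by
    intro v hv
    rw [h.cf v hv, ht, Finset.filter_true_of_mem, TreeInput.cf, Finset.card_filter]
    intro c hc
    have := D.mem_children.1 hc
    exact List.mem_toFinset.2 (hm c this.1 this.2.1)
  refine ⟨⟨h.queue, hm, hl⟩, ?_, ?_, h.loc, ?_, ?_, hcf, ?_⟩
  · intro v hv
    rw [h.rest 0 (by omega), hpar v hv]
  · intro v hv
    rw [h.rest 1 (by omega), hlen v hv]
  · intro v hv hr
    exact (h.cU v hv).1 (by rw [ht]; exact List.mem_toFinset.2 (hm v hv hr))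
  · intro v hv hr
    exact (h.cF v hv).1 (by rw [ht]; exact List.mem_toFinset.2 (hm v hv hr))
  · intro v hv hc
    exact h.fc v hv (by rw [hcf v hv]; exact hc)

theorem kahnPhase_tri {W B : ℕ} {D : TreeInput} (hF : Fits W B D) {σ : St} {q : List ℕ}
    (hb : Base D σ) (h11 : σ.reg 11 = q.length) (h : KahnInv D σ.g q 0 σ.g)
    (hpar : ∀ v, v < D.n → σ.g 0 v = D.par v) (hlen : ∀ v, v < D.n → σ.g 1 v = D.len v) :
    Tri W B kahnPhase σ (200 * (D.n + 1)) fun σ' => Base D σ' ∧ σ'.inp = σ.inp ∧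
      (∀ k, 9 < k → ∀ v, σ'.g k v = σ.g k v) ∧ ∃ q : List ℕ, Counted D q σ'.g := by
  have hW := hF.cap
  have hB := hF.base
  refine (Tri.seq (Tri.of_wp _ (Q := fun σ' => σ' = σ.setReg 10 0) ?_)
    (T₂ := (D.n - 1) * (kahnBody.cost + 2) + 2) ?_).mono ?_ (fun _ h => h)
  · simp only [wp]
    exact ⟨by omega, trivial⟩
  · rintro _ rfl
    refine (Tri.while_inv (fun i σ' => Base D σ' ∧ σ'.inp = σ.inp ∧ σ'.reg 10 = i ∧
      ∃ q : List ℕ, σ'.reg 11 = q.length ∧ KahnInv D σ.g q i σ'.g) kahnBody.cost (D.n - 1)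
      ?_ ?_ ?_).mono le_rfl ?_
    · rintro i hi τ ⟨b, ei, e10, q, e11, hk⟩
      have hlt := hk.lt_length hi
      refine ⟨by omega, (kahnBody_tri hF b hpar e10 e11 hlt hk).mono le_rfl ?_⟩
      rintro τ' ⟨t1, t2, t3, t4⟩
      exact ⟨t1, t2.trans ei, t3, t4⟩
    · rintro τ ⟨b, ei, e10, q, e11, hk⟩
      have := hk.queue.length_le
      omega
    · refine ⟨hb.congr fun x hx => ?_, by simp, by simp [St.setReg_reg], q, ?_, h⟩
      · simp only [St.setReg_reg]
        rw [if_neg (by omega)]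
      · simp [St.setReg_reg, h11]
    · rintro τ ⟨b, ei, e10, q, e11, hk⟩
      exact ⟨b, ei, fun k hk' v => hk.rest k (Or.inr hk') v, q, hk.counted hpar hlen⟩
  · simp [kahnBody, Cmd.inc, Cmd.cost]
    omega

/-! ## The top-down passes -/

/-- A child of `q[i]` stands before `q[i]` in the order. Hence writing the record of `q[i]` in a
top-down pass leaves the parents of all nodes treated so far untouched, and the recursive equations
already established stay valid. -/
theorem Queue.par_ne {D : TreeInput} {q : List ℕ} (h : Order D q) {i t : ℕ} (hit : i ≤ t)
    (ht : t < q.length) : D.par q[t] ≠ q[i] := by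
  intro e
  have h1 := h.ord i (by omega) q[t] (h.mem _ (List.getElem_mem ht)).1 e
  exact getElem_notMem_take h.nodup ht (List.take_subset_take_left _ hit h1)

theorem Order.exists_index {D : TreeInput} {q : List ℕ} (h : Order D q) {v : ℕ} (hv : v < D.n)
    (hr : v ≠ D.root) : ∃ (t : ℕ) (ht : t < q.length), v = q[t] := by
  obtain ⟨t, ht, e⟩ := List.getElem_of_mem (h.mem_of v hv hr)
  exact ⟨t, ht, e.symm⟩

/-- A pass over all nodes except the root, parents first. The register `12` receives the node and
the register `13` its parent. -/
def downLoop (body : Cmd) : Cmd :=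
  (.add 10 2 0 ;; .sub 10 10 1) ;; .whileLt 0 10 (.sub 10 10 1 ;; .ld 12 7 10 ;; .ld 13 0 12 ;; body)

/-- The bottom-up order read backwards visits parents first; `J i` is the assertion once the nodes
from index `i` on are done. -/
theorem downLoop_tri {W B : ℕ} {D : TreeInput} {body : Cmd} {q : List ℕ} {inp : ℕ → ℕ}
    (hF : Fits W B D) (hq : Order D q)
    (J : ℕ → (ℕ → ℕ → ℕ) → Prop) (hJ : ∀ i g, J i g → Counted D q g)
    (hb : ∀ i (hi : i < q.length) σ, Base D σ → J (i + 1) σ.g → σ.reg 12 = q[i] →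
      σ.reg 13 = D.par q[i] →
      wp W B body (fun σ' => J i σ'.g ∧ σ'.inp = σ.inp ∧ ∀ x < 12, σ'.reg x = σ.reg x) σ)
    {σ : St} (hbase : Base D σ) (hinp : σ.inp = inp) (h0 : J q.length σ.g) :
    Tri W B (downLoop body) σ ((body.cost + 20) * (D.n + 1)) fun σ' => Base D σ' ∧
      σ'.inp = inp ∧ J 0 σ'.g := by
  have hW := hF.cap
  have hl := hq.length
  refine (Tri.seq (Tri.of_wp _ (Q := fun σ' => Base D σ' ∧ σ'.inp = inp ∧
    σ'.reg 10 = q.length - 0 ∧ J (q.length - 0) σ'.g) ?_)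
    (T₂ := q.length * (body.cost + 11 + 2) + 2) ?_).mono ?_ (fun _ h => h)
  · simp only [wp, St.setReg_reg, St.setReg_g, St.setReg_inp, hbase.n, hbase.zero, hbase.one,
      if_true, if_false, OfNat.one_ne_ofNat]
    refine ⟨by omega, hbase.congr fun x hx => ?_, hinp, by omega, h0⟩
    simp only [St.setReg_reg]
    rw [if_neg (by omega), if_neg (by omega)]
  · rintro σ₁ h₁
    refine (Tri.while_inv (fun i σ' => Base D σ' ∧ σ'.inp = inp ∧
      σ'.reg 10 = q.length - i ∧ J (q.length - i) σ'.g) (body.cost + 11) q.length ?_ ?_ h₁).mono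
      le_rfl ?_
    · rintro i hi τ ⟨b, ei, e10, hj⟩
      refine ⟨by rw [b.zero]; omega, (Tri.of_wp _ ?_).mono (by simp [Cmd.cost]; omega)
        (fun _ h => h)⟩
      have hc := hJ _ _ hj
      have hi' : q.length - (i + 1) < q.length := by omega
      have hm := hq.mem _ (List.getElem_mem hi')
      have e7 := hc.loc _ hi'
      have e0 := hc.par _ hm.1
      have p1 := hF.rec_lt hm.1
      have hs : q.length - i - 1 = q.length - (i + 1) := by omega
      simp only [wp, St.setReg_reg, St.setReg_g, b.one, e10, hs, e7, e0, Nat.reduceEqDiff,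
        if_true, if_false, Nat.reduceLT, true_and]
      refine ⟨by omega, p1, wp_mono _ (hb (q.length - (i + 1)) hi' _ ?_ ?_ ?_ ?_) ?_⟩
      · refine b.congr fun x hx => ?_
        simp only [St.setReg_reg]
        rw [if_neg (by omega), if_neg (by omega), if_neg (by omega)]
      · simpa [show q.length - (i + 1) + 1 = q.length - i by omega] using hj
      · simp [St.setReg_reg]
      · simp [St.setReg_reg]
      · rintro σ' ⟨s1, s2, s3⟩
        refine ⟨b.congr fun x hx => ?_, by simpa [ei] using s2, ?_, s1⟩
        · rw [s3 x (by omega)]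
          simp only [St.setReg_reg]
          rw [if_neg (by omega), if_neg (by omega), if_neg (by omega)]
        · rw [s3 10 (by omega)]
          simp [St.setReg_reg]
    · rintro τ ⟨b, ei, e10, hj⟩
      rw [b.zero]; omega
    · rintro τ ⟨b, ei, e10, hj⟩
      exact ⟨b, ei, by simpa using hj⟩
  · simp only [Cmd.cost]
    rw [hl]
    have : (D.n - 1) * (body.cost + 11 + 2) ≤ D.n * (body.cost + 13) :=
      Nat.mul_le_mul (by omega) (by omega)
    nlinarith

/-- Fields `10` and `11` receive the maps `f` and `h` of `TreeInput.Tables`, with the value of the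
parent as default. -/
def tableBody : Cmd :=
  .ld 14 3 12 ;; .ld 15 10 13 ;;
  .ifLt 14 3 .skip (.ifLt 3 14 .skip (.add 15 12 0)) ;; .st 10 12 15 ;;
  .ld 14 8 13 ;; .ld 15 11 13 ;; .ifLt 1 14 (.add 15 12 0) .skip ;; .st 11 12 15

open Classical in
structure TableInv (D : TreeInput) (q : List ℕ) (g0 : ℕ → ℕ → ℕ) (i : ℕ) (g : ℕ → ℕ → ℕ) :
    Prop where
  counted : Counted D q g
  root : g 10 D.root = D.root
  f : ∀ t (ht : t < q.length), i ≤ t → g 10 q[t] = if D.Full q[t] then q[t] else g 10 (D.par q[t])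
  h : ∀ t (ht : t < q.length), i ≤ t →
    g 11 q[t] = if 2 ≤ D.cf (D.par q[t]) then q[t] else g 11 (D.par q[t])
  rest : ∀ k, k ≠ 10 → k ≠ 11 → ∀ v, g k v = g0 k v

open Classical in
theorem TableInv.step {D : TreeInput} {q g0 i g g'} (hq : Order D q)
    (h : TableInv D q g0 (i + 1) g) (hi : i < q.length)
    (h10 : ∀ w, g' 10 w = if w = q[i] then (if D.Full q[i] then q[i] else g 10 (D.par q[i]))
      else g 10 w)
    (h11 : ∀ w, g' 11 w = if w = q[i] then (if 2 ≤ D.cf (D.par q[i]) then q[i] else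
      g 11 (D.par q[i])) else g 11 w)
    (hrest : ∀ k, k ≠ 10 → k ≠ 11 → ∀ w, g' k w = g k w) : TableInv D q g0 i g' := by
  have hne : ∀ t (ht : t < q.length), i + 1 ≤ t → q[t] ≠ q[i] := by
    intro t ht hit e
    have := (hq.nodup.getElem_inj_iff).1 e
    omega
  refine ⟨h.counted.congr fun k hk v => hrest k (by omega) (by omega) v, ?_, ?_, ?_, ?_⟩
  · rw [h10, if_neg (Ne.symm (hq.mem _ (List.getElem_mem hi)).2), h.root]
  · intro t ht hit
    rw [h10 (D.par q[t]), if_neg (Queue.par_ne hq hit ht), h10]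
    by_cases e : t = i
    · subst e; rw [if_pos rfl]
    · rw [if_neg (hne t ht (by omega)), h.f t ht (by omega)]
  · intro t ht hit
    rw [h11 (D.par q[t]), if_neg (Queue.par_ne hq hit ht), h11]
    by_cases e : t = i
    · subst e; rw [if_pos rfl]
    · rw [if_neg (hne t ht (by omega)), h.h t ht (by omega)]
  · intro k h1 h2 v
    rw [hrest k h1 h2, h.rest k h1 h2]

theorem TableInv.tables {D : TreeInput} {q g0 g} (h : TableInv D q g0 0 g) :
    TreeInput.Tables D (g 10) (g 11) (g 9) where
  f_root := h.root
  f_eq v hv hr := by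
    obtain ⟨t, ht, rfl⟩ := h.counted.order.exists_index hv hr
    exact h.f t ht (by omega)
  h_eq v hv hr := by
    obtain ⟨t, ht, rfl⟩ := h.counted.order.exists_index hv hr
    exact h.h t ht (by omega)
  fc_mem := h.counted.fc

open Classical in
theorem tableBody_spec {W B : ℕ} {D : TreeInput} {q g0} (hF : Fits W B D) (hq : Order D q)
    (i : ℕ) (hi : i < q.length) (σ : St) (hb : Base D σ) (h : TableInv D q g0 (i + 1) σ.g)
    (h12 : σ.reg 12 = q[i]) (h13 : σ.reg 13 = D.par q[i]) :
    wp W B tableBody (fun σ' => TableInv D q g0 i σ'.g ∧ σ'.inp = σ.inp ∧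
      ∀ x < 12, σ'.reg x = σ.reg x) σ := by
  have hW := hF.cap
  have hm := hq.mem _ (List.getElem_mem hi)
  have hp := D.par_lt _ hm.1
  have p1 := hF.rec_lt hm.1
  have p2 := hF.rec_lt hp
  have e3 := h.counted.cU _ hm.1 hm.2
  have e8 := h.counted.cf _ hp
  have s0 : q[i] + 0 < 2 ^ W := by omega
  have hFull : D.Full q[i] ↔ D.cov D.items q[i] = D.K := Iff.rfl
  have hcf : 1 < D.cf (D.par q[i]) ↔ 2 ≤ D.cf (D.par q[i]) := Iff.rfl
  simp only [tableBody, wp, St.setReg_reg, St.setReg_g, St.setG_reg, St.setG_g, h12, h13, e3, e8,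
    hb.K, hb.zero, hb.one, p1, p2, s0, Nat.reduceEqDiff, if_true, if_false, OfNat.one_ne_ofNat,
    OfNat.zero_ne_ofNat, Nat.reduceLT, true_and, hcf]
  rcases lt_trichotomy (D.cov D.items q[i]) D.K with hK | hK | hK
  · have nF : ¬ D.Full q[i] := by rw [hFull]; omega
    simp only [hK, hK.not_gt, true_implies, false_implies, not_true_eq_false, and_true]
    refine ⟨fun hc => ⟨h.step hq hi ?_ ?_ ?_, rfl, ?_⟩,
      fun hc => ⟨h.step hq hi ?_ ?_ ?_, rfl, ?_⟩⟩
    all_goals intro w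
    all_goals try intro hw
    all_goals try intro hw'
    all_goals try intro z
    all_goals try simp only [St.setReg_g, St.setG_g, hc, nF,
      Nat.reduceEqDiff, if_true, if_false, add_zero]
    all_goals repeat rw [if_neg (by omega)]
  · have nF : D.Full q[i] := hFull.2 hK
    have k1 : ¬ D.cov D.items q[i] < D.K := by omega
    have k2 : ¬ D.K < D.cov D.items q[i] := by omega
    simp only [k1, k2, true_implies, false_implies, not_false_eq_true, true_and]
    refine ⟨fun hc => ⟨h.step hq hi ?_ ?_ ?_, rfl, ?_⟩,
      fun hc => ⟨h.step hq hi ?_ ?_ ?_, rfl, ?_⟩⟩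
    all_goals intro w
    all_goals try intro hw
    all_goals try intro hw'
    all_goals try intro z
    all_goals try simp only [St.setReg_g, St.setG_g, hc, nF,
      Nat.reduceEqDiff, if_true, if_false, add_zero]
    all_goals repeat rw [if_neg (by omega)]
  · have nF : ¬ D.Full q[i] := by rw [hFull]; omega
    simp only [hK, hK.not_gt, true_implies, false_implies, not_true_eq_false, not_false_eq_true,
      and_true, true_and]
    refine ⟨fun hc => ⟨h.step hq hi ?_ ?_ ?_, rfl, ?_⟩,
      fun hc => ⟨h.step hq hi ?_ ?_ ?_, rfl, ?_⟩⟩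
    all_goals intro w
    all_goals try intro hw
    all_goals try intro hw'
    all_goals try intro z
    all_goals try simp only [St.setReg_g, St.setG_g, hc, nF,
      Nat.reduceEqDiff, if_true, if_false, add_zero]
    all_goals repeat rw [if_neg (by omega)]

/-! ## Attaching the weights -/

def attachMax : Cmd := .ld 17 12 16 ;; .ifLt 17 14 (.st 12 16 14) .skip

/-- The condition `f it.u ≠ it.p` is tested as positivity of the sum of the two truncated
differences. The node where the weight is stored is the one given by `Tables.attach_iff`; its field
`12` keeps the maximum. -/
def attachBody : Cmd :=
  .ld 15 8 13 ;; .ifLt 0 15 (.ld 16 10 12 ;; .sub 17 16 13 ;; .sub 18 13 16 ;; .add 17 17 18 ;;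
    .ifLt 0 17 (.ifLt 1 15 (.ld 16 11 16) (.ld 16 9 13) ;; attachMax) .skip) .skip

/-- The weight of the path `it` is relevant for the child `a` of its upper end. -/
def AttachTo (D : TreeInput) (it : Item) (a : ℕ) : Prop :=
  D.Child it.p a ∧ D.Full a ∧ D.le a it.u

/-- The maximum is described by its upper bounds, so that a node without weights has the value `0`
and needs no separate case. -/
structure AttachInv (D : TreeInput) (g0 : ℕ → ℕ → ℕ) (done : List Item) (g : ℕ → ℕ → ℕ) :
    Prop where
  sup : ∀ a x, g 12 a ≤ x ↔ ∀ it ∈ done, AttachTo D it a → it.q ≤ x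
  rest : ∀ k, k ≠ 12 → ∀ v, g k v = g0 k v

theorem AttachInv.step_none {D : TreeInput} {g0 done g g'} {it : Item}
    (h : AttachInv D g0 done g) (hn : ∀ a, ¬ AttachTo D it a) (hg : ∀ k v, g' k v = g k v) :
    AttachInv D g0 (done ++ [it]) g' := by
  refine ⟨fun a x => ?_, fun k hk v => (hg k v).trans (h.rest k hk v)⟩
  rw [hg, h.sup]
  simp [or_imp, forall_and, hn]

theorem AttachInv.step_some {D : TreeInput} {g0 done g g'} {it : Item} {a : ℕ}
    (h : AttachInv D g0 done g) (ha : ∀ b, AttachTo D it b ↔ b = a)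
    (h12 : ∀ v, g' 12 v = if v = a then max (g 12 a) it.q else g 12 v)
    (hg : ∀ k, k ≠ 12 → ∀ v, g' k v = g k v) :
    AttachInv D g0 (done ++ [it]) g' := by
  refine ⟨fun b x => ?_, fun k hk v => (hg k hk v).trans (h.rest k hk v)⟩
  rw [h12]
  split_ifs with e
  · subst e
    rw [max_le_iff, h.sup]
    simp [or_imp, forall_and, ha]
  · rw [h.sup]
    simp [or_imp, forall_and, ha, e]

theorem attachBody_spec {W B : ℕ} {D : TreeInput} (hF : Fits W B D) (hD : D.Good) {r inp q g1}
    {g0 : ℕ → ℕ → ℕ} (hT : TableInv D q g1 0 g0) (r0 : r 0 = 0) (r1 : r 1 = 1) :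
    BodySpec W B attachBody r inp D.items (AttachInv D g0) := by
  intro done it rest σ hd hr hi hJ hu hp hq
  have hit : it ∈ D.items := by rw [← hd]; simp
  obtain ⟨iu, ip, -⟩ := D.item_ok it hit
  have pu := hF.rec_lt iu
  have pp := hF.rec_lt ip
  have hW := hF.cap
  have tT := hT.tables
  have hatt := tT.attach_iff hD hit
  obtain ⟨f0, -⟩ := tT.f_spec iu
  have e0 : σ.reg 0 = 0 := (hr 0 (by omega)).trans r0
  have e1 : σ.reg 1 = 1 := (hr 1 (by omega)).trans r1
  have e8 : σ.g 8 it.p = D.cf it.p := by rw [hJ.rest 8 (by omega), hT.counted.cf _ ip]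
  have e9 : σ.g 9 it.p = g0 9 it.p := hJ.rest 9 (by omega) _
  have e10 : σ.g 10 it.u = g0 10 it.u := hJ.rest 10 (by omega) _
  have e11 : σ.g 11 (g0 10 it.u) = g0 11 (g0 10 it.u) := hJ.rest 11 (by omega) _
  have pf := hF.rec_lt f0
  have hs : g0 10 it.u - it.p + (it.p - g0 10 it.u) < 2 ^ W := by omega
  have hne : 0 < g0 10 it.u - it.p + (it.p - g0 10 it.u) ↔ g0 10 it.u ≠ it.p := by omega
  have hcf : 1 < D.cf it.p ↔ 2 ≤ D.cf it.p := Iff.rfl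
  simp only [attachBody, wp, St.setReg_reg, St.setReg_g, e0, e1, hu, hp, e8,
    e10, e9, pu, pp, hs, hne, hcf, Nat.reduceEqDiff, if_true, if_false, OfNat.one_ne_ofNat,
    OfNat.zero_ne_ofNat, Nat.reduceLT, true_and]
  have fin : ∀ a, 0 < D.cf it.p → g0 10 it.u ≠ it.p →
      (a = if 2 ≤ D.cf it.p then g0 11 (g0 10 it.u) else g0 9 it.p) → ∀ τ : St,
      τ.reg 16 = a → τ.reg 14 = it.q → τ.g = σ.g → τ.inp = σ.inp →
      (∀ x < 12, τ.reg x = σ.reg x) →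
      wp W B attachMax
        (fun σ' => AttachInv D g0 (done ++ [it]) σ'.g ∧ σ'.inp = σ.inp ∧
          ∀ x < 12, σ'.reg x = σ.reg x) τ := by
    intro a h1 h2 h3 τ t1 t2 t3 t4 t5
    have hAt : ∀ b, AttachTo D it b ↔ b = a := by
      intro b
      rw [AttachTo, ← hatt b, ← h3]
      simp [h1, h2]
    have pa := hF.rec_lt ((hAt a).2 rfl).1.1
    simp only [attachMax, wp, St.setReg_reg, St.setReg_g, t1, t2, t3, pa, Nat.reduceEqDiff, if_true, if_false,
      Nat.reduceLT, true_and]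
    refine ⟨fun hlt => ⟨hJ.step_some hAt ?_ ?_, t4, fun x hx => ?_⟩,
      fun hlt => ⟨hJ.step_some hAt ?_ ?_, t4, fun x hx => ?_⟩⟩
    · intro v
      simp [St.setG_g, t3, max_eq_right hlt.le]
    · intro k hk v
      simp [St.setG_g, t3, hk]
    · simp only [St.setG_reg, St.setReg_reg]
      rw [if_neg (by omega), t5 x hx]
    · intro v
      rw [max_eq_left (not_lt.1 hlt)]
      split_ifs with e
      · rw [e]
      · rfl
    · intro k hk v
      rfl
    · rw [if_neg (by omega), t5 x hx]
  have nofin : (¬ 0 < D.cf it.p ∨ ¬ g0 10 it.u ≠ it.p) → ∀ a, ¬ AttachTo D it a := by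
    intro h a ha
    have := (hatt a).2 ha
    tauto
  refine ⟨fun h1 => ⟨fun h2 => ⟨fun h3 => ⟨pf, ?_⟩, fun h3 => ?_⟩, fun h2 => ?_⟩, fun h1 => ?_⟩
  · refine fin _ h1 h2 rfl _ ?_ ?_ rfl rfl ?_
    · simp [St.setReg_reg, h3, e11]
    · simp [St.setReg_reg, hq]
    · intro x hx
      simp only [St.setReg_reg]
      rw [if_neg (by omega), if_neg (by omega), if_neg (by omega), if_neg (by omega),
        if_neg (by omega), if_neg (by omega)]
  · refine fin _ h1 h2 rfl _ ?_ ?_ rfl rfl ?_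
    · simp [St.setReg_reg, h3]
    · simp [St.setReg_reg, hq]
    · intro x hx
      simp only [St.setReg_reg]
      rw [if_neg (by omega), if_neg (by omega), if_neg (by omega), if_neg (by omega),
        if_neg (by omega), if_neg (by omega)]
  · refine ⟨hJ.step_none (nofin (Or.inr h2)) fun _ _ => rfl, rfl, fun x hx => ?_⟩
    rw [if_neg (by omega), if_neg (by omega), if_neg (by omega), if_neg (by omega),
      if_neg (by omega)]
  · refine ⟨hJ.step_none (nofin (Or.inl h1)) fun _ _ => rfl, rfl, fun x hx => ?_⟩
    rw [if_neg (by omega)]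

/-! ## The results -/

/-- Maxima are computed as `x + (y - x)` with truncated subtraction. Field `12` turns from the
maximum stored at the node into the maximum along its root path; field `13` keeps its initial value
`0` unless all tests succeed. -/
def finalBody : Cmd :=
  .ld 14 12 13 ;; .ld 15 12 12 ;; .sub 17 14 15 ;; .add 15 15 17 ;; .st 12 12 15 ;; .ld 16 1 13 ;;
    .add 16 16 1 ;; .sub 17 15 16 ;; .add 16 16 17 ;; .ld 17 5 12 ;; .ld 18 1 12 ;;
    .ifLt 17 3 .skip (.ifLt 3 17 .skip (.ifLt 4 16 .skip (.ifLt 18 16 .skip (.st 13 12 16))))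

namespace TreeInput

/-- All weights that are relevant for `v` are at most `x`. -/
def Bound (D : TreeInput) (v x : ℕ) : Prop := ∀ it ∈ D.items, D.Relevant v it → it.q ≤ x

/-- The result for the node `v` if the largest relevant weight is `Q`. -/
noncomputable def out (D : TreeInput) (Q v : ℕ) : ℕ :=
  if D.cov D.fin v = D.K ∧ max (D.len (D.par v) + 1) Q ≤ D.m ∧
    max (D.len (D.par v) + 1) Q ≤ D.len v then max (D.len (D.par v) + 1) Q else 0

theorem bound_root (D : TreeInput) (x : ℕ) : D.Bound D.root x := by
  rintro it - ⟨a, h1, -, -, h4⟩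
  exact absurd (D.antisymm h1.1 D.root_lt h4 (D.root_le h1.1)) h1.2.1

/-- The top node through which a path is relevant for `v` is either `v` itself or an ancestor of its
parent. Therefore a running maximum from the root downwards computes all bounds. -/
theorem bound_iff (D : TreeInput) {v : ℕ} (hv : v < D.n) (hr : v ≠ D.root) (x : ℕ) :
    D.Bound v x ↔ (∀ it ∈ D.items, AttachTo D it v → it.q ≤ x) ∧ D.Bound (D.par v) x := by
  have key : ∀ it, D.Relevant v it ↔ AttachTo D it v ∨ D.Relevant (D.par v) it := by
    intro it
    constructor
    · rintro ⟨a, h1, h2, h3, h4⟩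
      rcases (D.le_iff _ _ h1.1 hv).1 h4 with rfl | ⟨_, h5⟩
      · exact Or.inl ⟨h1, h2, h3⟩
      · exact Or.inr ⟨a, h1, h2, h3, h5⟩
    · rintro (⟨h1, h2, h3⟩ | ⟨a, h1, h2, h3, h4⟩)
      · exact ⟨v, h1, h2, h3, D.le_refl hv⟩
      · exact ⟨a, h1, h2, h3, (D.le_iff _ _ h1.1 hv).2 (Or.inr ⟨hr, h4⟩)⟩
  simp only [Bound, key, or_imp, forall_and]

end TreeInput

structure FinalInv (D : TreeInput) (q : List ℕ) (g0 : ℕ → ℕ → ℕ) (i : ℕ) (g : ℕ → ℕ → ℕ) :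
    Prop where
  counted : Counted D q g
  root : g 12 D.root = 0 ∧ g 13 D.root = 0
  done : ∀ t (ht : t < q.length), i ≤ t → (∀ x, g 12 q[t] ≤ x ↔ D.Bound q[t] x) ∧
    g 13 q[t] = D.out (g 12 q[t]) q[t]
  todo : ∀ t (ht : t < q.length), t < i → g 12 q[t] = g0 12 q[t] ∧ g 13 q[t] = 0

theorem FinalInv.par_bound {D : TreeInput} {q g0 i g} (hq : Order D q)
    (h : FinalInv D q g0 (i + 1) g) (hi : i < q.length) (x : ℕ) :
    g 12 (D.par q[i]) ≤ x ↔ D.Bound (D.par q[i]) x := by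
  have hm := hq.mem _ (List.getElem_mem hi)
  by_cases hr : D.par q[i] = D.root
  · rw [hr, h.root.1]
    simp [D.bound_root x]
  · obtain ⟨t, ht, e⟩ := hq.exists_index (D.par_lt _ hm.1) hr
    have h1 := hq.ord t ht q[i] hm.1 e
    have hit : i < t := by
      by_contra hn
      exact getElem_notMem_take hq.nodup hi (List.take_subset_take_left _ (not_lt.1 hn) h1)
    rw [e]
    exact (h.done t ht hit).1 x

theorem FinalInv.step {D : TreeInput} {q g0 i g g'} (hq : Order D q)
    (h0 : ∀ a x, g0 12 a ≤ x ↔ ∀ it ∈ D.items, AttachTo D it a → it.q ≤ x)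
    (h : FinalInv D q g0 (i + 1) g) (hi : i < q.length)
    (h12 : ∀ w, g' 12 w = if w = q[i] then max (g 12 q[i]) (g 12 (D.par q[i])) else g 12 w)
    (h13 : ∀ w, g' 13 w = if w = q[i] then D.out (max (g 12 q[i]) (g 12 (D.par q[i]))) q[i]
      else g 13 w)
    (hrest : ∀ k, k < 12 → ∀ w, g' k w = g k w) : FinalInv D q g0 i g' := by
  have hne : ∀ t (ht : t < q.length), t ≠ i → q[t] ≠ q[i] := by
    intro t ht hit e
    exact hit ((hq.nodup.getElem_inj_iff).1 e)
  have hm := hq.mem _ (List.getElem_mem hi)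
  refine ⟨h.counted.congr fun k hk v => hrest k (by omega) v, ?_, ?_, ?_⟩
  · rw [h12, h13, if_neg (Ne.symm hm.2), if_neg (Ne.symm hm.2)]
    exact h.root
  · intro t ht hit
    rw [h12, h13]
    by_cases e : t = i
    · subst e
      rw [if_pos rfl, if_pos rfl]
      refine ⟨fun x => ?_, rfl⟩
      rw [max_le_iff, h.par_bound hq hi, (h.todo t ht (by omega)).1, h0, ← D.bound_iff hm.1 hm.2]
    · rw [if_neg (hne t ht e), if_neg (hne t ht e)]
      exact h.done t ht (by omega)
  · intro t ht hit
    rw [h12, h13, if_neg (hne t ht (by omega)), if_neg (hne t ht (by omega))]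
    exact h.todo t ht (by omega)

theorem finalBody_spec {W B : ℕ} {D : TreeInput} {q g0} (hF : Fits W B D) (hq : Order D q)
    (h0 : ∀ a x, g0 12 a ≤ x ↔ ∀ it ∈ D.items, AttachTo D it a → it.q ≤ x)
    (i : ℕ) (hi : i < q.length) (σ : St) (hb : Base D σ) (h : FinalInv D q g0 (i + 1) σ.g)
    (h12 : σ.reg 12 = q[i]) (h13 : σ.reg 13 = D.par q[i]) :
    wp W B finalBody (fun σ' => FinalInv D q g0 i σ'.g ∧ σ'.inp = σ.inp ∧
      ∀ x < 12, σ'.reg x = σ.reg x) σ := by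
  have hW := hF.cap
  have hm := hq.mem _ (List.getElem_mem hi)
  have hp := D.par_lt _ hm.1
  have p1 := hF.rec_lt hm.1
  have p2 := hF.rec_lt hp
  have e5 := h.counted.cF _ hm.1 hm.2
  have el := h.counted.len _ hm.1
  have ep := h.counted.len _ hp
  have lp := hF.len _ hp
  have b1 : σ.g 12 q[i] ≤ 2 ^ W - 1 := by
    rw [(h.todo i hi (by omega)).1, h0]
    intro it hit _
    have := hF.q it hit
    omega
  have b2 : σ.g 12 (D.par q[i]) ≤ 2 ^ W - 1 := by
    rw [h.par_bound hq hi]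
    intro it hit _
    have := hF.q it hit
    omega
  have s1 : σ.g 12 q[i] + (σ.g 12 (D.par q[i]) - σ.g 12 q[i]) =
      max (σ.g 12 q[i]) (σ.g 12 (D.par q[i])) := by omega
  have s2 : D.len (D.par q[i]) + 1 + (max (σ.g 12 q[i]) (σ.g 12 (D.par q[i])) -
      (D.len (D.par q[i]) + 1)) = max (D.len (D.par q[i]) + 1)
        (max (σ.g 12 q[i]) (σ.g 12 (D.par q[i]))) := by omega
  have s3 : max (σ.g 12 q[i]) (σ.g 12 (D.par q[i])) < 2 ^ W := by omega
  have s4 : max (D.len (D.par q[i]) + 1) (max (σ.g 12 q[i]) (σ.g 12 (D.par q[i]))) < 2 ^ W := by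
    omega
  simp only [finalBody, wp, St.setReg_reg, St.setReg_g, St.setG_reg, St.setG_g, h12, h13, e5, el,
    ep, hb.K, hb.m, hb.one, p1, p2, s1, s2, s3, s4, lp, Nat.reduceEqDiff, if_true, if_false,
    OfNat.one_ne_ofNat, Nat.reduceLT, true_and]
  set M := max (σ.g 12 q[i]) (σ.g 12 (D.par q[i])) with hM
  set X := max (D.len (D.par q[i]) + 1) M with hX
  have hout : D.out M q[i] = if D.cov D.fin q[i] = D.K ∧ X ≤ D.m ∧ X ≤ D.len q[i] then X else 0 :=
    rfl
  have fr : ∀ x < 12, x ≠ 14 ∧ x ≠ 15 ∧ x ≠ 16 ∧ x ≠ 17 ∧ x ≠ 18 := by omega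
  have z : ∀ w, σ.g 13 w = if w = q[i] then 0 else σ.g 13 w := by
    intro w
    split_ifs with e
    · rw [e, (h.todo i hi (by omega)).2]
    · rfl
  refine ⟨fun h1 => ⟨h.step hq h0 hi ?_ ?_ ?_, rfl, ?_⟩, fun h1 =>
    ⟨fun h2 => ⟨h.step hq h0 hi ?_ ?_ ?_, rfl, ?_⟩, fun h2 =>
    ⟨fun h3 => ⟨h.step hq h0 hi ?_ ?_ ?_, rfl, ?_⟩, fun h3 =>
    ⟨fun h4 => ⟨h.step hq h0 hi ?_ ?_ ?_, rfl, ?_⟩, fun h4 =>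
      ⟨h.step hq h0 hi ?_ ?_ ?_, rfl, ?_⟩⟩⟩⟩⟩
  all_goals intro w
  all_goals try intro hw
  all_goals try intro v
  all_goals try simp only [St.setG_g, St.setReg_g, Nat.reduceEqDiff, if_true, if_false, ← hM]
  · rw [hout, if_neg (show ¬ (_ = _ ∧ X ≤ D.m ∧ X ≤ D.len q[i]) by omega)]; exact z w
  · rw [if_neg (by omega)]
  · simp [fr w hw]
  · rw [hout, if_neg (show ¬ (_ = _ ∧ X ≤ D.m ∧ X ≤ D.len q[i]) by omega)]; exact z w
  · rw [if_neg (by omega)]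
  · simp [fr w hw]
  · rw [hout, if_neg (show ¬ (_ = _ ∧ X ≤ D.m ∧ X ≤ D.len q[i]) by omega)]; exact z w
  · rw [if_neg (by omega)]
  · simp [fr w hw]
  · rw [hout, if_neg (show ¬ (_ = _ ∧ X ≤ D.m ∧ X ≤ D.len q[i]) by omega)]; exact z w
  · rw [if_neg (by omega)]
  · simp [fr w hw]
  · rw [hout, if_pos (show _ = _ ∧ X ≤ D.m ∧ X ≤ D.len q[i] by omega)]
  · rw [if_neg (by omega), if_neg (by omega)]
  · simp [fr w hw]

/-- The results overwrite the input from cell `0` on; at this stage the input is no longer needed.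
-/
def outPhase : Cmd := .const 10 0 ;; .whileLt 10 2 (.ld 12 13 10 ;; .wr 10 12 ;; .add 10 10 1)

theorem outPhase_tri {W B : ℕ} {D : TreeInput} (hF : Fits W B D) {σ : St} (hb : Base D σ) :
    Tri W B outPhase σ (20 * (D.n + 1)) fun σ' => ∀ v, v < D.n → σ'.inp v = σ.g 13 v := by
  have hW := hF.cap
  have hn := hF.n
  refine (Tri.seq (Tri.of_wp _ (Q := fun σ' => Base D σ' ∧ σ'.g = σ.g ∧ σ'.reg 10 = 0) ?_)
    (T₂ := D.n * (7 + 2) + 2) ?_).mono ?_ (fun _ h => h)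
  · simp only [wp]
    refine ⟨by omega, hb.congr fun x hx => ?_, rfl, by simp [St.setReg_reg]⟩
    simp only [St.setReg_reg]
    rw [if_neg (by omega)]
  · rintro σ₁ ⟨b, eg, e10⟩
    refine (Tri.while_inv (fun i σ' => Base D σ' ∧ σ'.g = σ.g ∧ σ'.reg 10 = i ∧
      ∀ v, v < i → σ'.inp v = σ.g 13 v) 7 D.n ?_ ?_ ⟨b, eg, e10, by omega⟩).mono le_rfl
      fun σ' h => h.2.2.2
    · rintro i hi τ ⟨b, eg, e10, hv⟩
      refine ⟨by rw [e10, b.n]; exact hi, Tri.of_wp _ ?_⟩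
      have p1 := hF.rec_lt hi
      simp only [wp, St.setReg_reg, St.setInp_reg, e10, eg, b.one, p1, Nat.reduceEqDiff, if_true,
        if_false, Nat.reduceLT, true_and, OfNat.one_ne_ofNat]
      refine ⟨by omega, by omega, b.congr fun x hx => ?_, eg, fun v hv' => ?_⟩
      · simp only [St.setReg_reg, St.setInp_reg]
        rw [if_neg (by omega), if_neg (by omega)]
      · simp only [St.setReg_inp, St.setInp_inp]
        split_ifs with e
        · rw [e]
        · exact hv v (by omega)
    · rintro τ ⟨b, -, e10, -⟩
      rw [e10, b.n]; omega
  · simp only [Cmd.cost]; omega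

/-! ## The whole program -/

/-- The items are scanned twice: once for the counts, and again for the weights when the tables are
available. The single store sets the value of `f` at the root, where its recursion starts. -/
def mergeCmd : Cmd :=
  initPhase ;; itemLoop countBody ;; queuePhase ;; kahnPhase ;; .st 10 5 5 ;;
    downLoop tableBody ;; itemLoop attachBody ;; downLoop finalBody ;; outPhase

theorem mergeCmd_tri {W B : ℕ} {D : TreeInput} (hF : Fits W B D) (hD : D.Good) {σ : St}
    (blocks : List Block) (hH : Header D σ.inp) (hg : ∀ k < 16, ∀ v, σ.g k v = 0)
    (hin : Holds σ.inp (5 + 3 * D.n) (blocks.flatMap Block.enc)) (hK : blocks.length = D.K)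
    (hit : blocks.flatMap Block.items = D.items)
    (hlen : 5 + 3 * D.n + 4 * (blocks.flatMap Block.enc).length + 3 ≤ B) :
    Tri W B mergeCmd σ (2000 * (D.n + D.items.length + D.K + 1)) fun σ' =>
      ∃ Q : ℕ → ℕ, (∀ v, v < D.n → ∀ x, Q v ≤ x ↔ D.Bound v x) ∧
        ∀ v, v < D.n → σ'.inp v = if v = D.root then 0 else D.out (Q v) v := by
  have hW := hF.cap
  have hB := hF.base
  have hroot := hF.rec_lt D.root_lt
  have hn := D.root_lt
  have itemTri : ∀ {body : Cmd} {J} (τ : St), Base D τ → τ.inp = σ.inp → J [] τ.g →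
      BodySpec W B body τ.reg σ.inp D.items J → Tri W B (itemLoop body) τ
        ((body.cost + 20) * (D.items.length + D.K + 1)) fun σ' => Base D σ' ∧ σ'.inp = σ.inp ∧
          J D.items σ'.g := by
    intro body J τ b ei hJ hbody
    rw [← hit] at hbody ⊢
    rw [← hK]
    refine (itemLoop_tri blocks (by omega) b.one (by rw [b.K, hK]) hbody (by rw [b.n]; exact hin)
      (by rw [b.n]; exact hlen) (fun _ _ => rfl) ei hJ).mono le_rfl ?_
    rintro σ' ⟨s1, s2, s3⟩
    exact ⟨b.congr s1, s2, s3⟩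
  -- The decreasing constants `1900`, `1700`, … are the time left for the remaining phases; they are
  -- generous, only linearity matters.
  refine (Tri.seq (initPhase_tri hF hH hg) (T₂ := 1900 * (D.n + D.items.length + D.K + 1)) ?_).mono
    (by omega) (fun _ h => h)
  rintro σ₁ ⟨b₁, i₁, h₁, z₁⟩
  refine (Tri.seq (itemTri (J := CountInv σ₁.g) σ₁ b₁ i₁ ?_ (countBody_spec hF _ b₁.zero b₁.one))
    (T₂ := 1700 * (D.n + D.items.length + D.K + 1)) ?_).mono ?_ (fun _ h => h)
  · refine ⟨?_, ?_, ?_, ?_, fun _ _ _ => rfl⟩ <;> intro v <;>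
      rw [z₁ _ (by omega) (by omega)] <;> rfl
  rotate_left
  · simp [countBody, Cmd.inc, Cmd.cost]; omega
  rintro σ₂ ⟨b₂, i₂, c₂⟩
  refine (Tri.seq (queuePhase_tri hF b₂) (T₂ := 1600 * (D.n + D.items.length + D.K + 1)) ?_).mono
    (by omega) (fun _ h => h)
  rintro σ₃ ⟨b₃, i₃, e₃, q₀, q1, q2, q3, q4⟩
  have g3 : ∀ k, k ≠ 7 → (k < 3 ∨ 6 < k) → ∀ v, σ₃.g k v = σ₁.g k v := fun k hk hk' v =>
    (e₃ k hk v).trans (c₂.rest k hk' v)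
  have h₃ : ∀ v, v < D.n → σ₃.g 0 v = D.par v ∧ σ₃.g 1 v = D.len v ∧ σ₃.g 2 v = D.deg D.n v := by
    intro v hv
    rw [g3 0 (by omega) (by omega), g3 1 (by omega) (by omega), g3 2 (by omega) (by omega)]
    exact h₁ v hv
  have z₃ : ∀ k, 7 < k → k < 16 → ∀ v, σ₃.g k v = 0 := fun k hk hk' v =>
    (g3 k (by omega) (by omega) v).trans (z₁ k (by omega) hk' v)
  have kz : KahnInv D σ₃.g q₀ 0 σ₃.g := by
    refine kahnInv_zero q2 q3 (fun v => ?_) (fun v hv => (h₃ v hv).2.2)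
      (fun v => (e₃ 3 (by omega) v).trans (c₂.u v)) (fun v => (e₃ 4 (by omega) v).trans (c₂.p v))
      (fun v => (e₃ 5 (by omega) v).trans (c₂.uf v)) (fun v => (e₃ 6 (by omega) v).trans (c₂.pf v))
      (z₃ 8 (by omega) (by omega))
    rw [q4, e₃ 2 (by omega)]
  refine (Tri.seq (kahnPhase_tri hF b₃ q1 kz (fun v hv => (h₃ v hv).1) (fun v hv => (h₃ v hv).2.1))
    (T₂ := 1400 * (D.n + D.items.length + D.K + 1)) ?_).mono (by omega) (fun _ h => h)
  rintro σ₄ ⟨b₄, i₄, e₄, q, c₄⟩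
  have hq := c₄.order
  have z₄ : ∀ k, 9 < k → k < 16 → ∀ v, σ₄.g k v = 0 := fun k hk hk' v =>
    (e₄ k hk v).trans (z₃ k (by omega) hk' v)
  refine (Tri.seq (Tri.of_wp _ (Q := fun σ' => σ' = σ₄.setG 10 D.root D.root) ?_)
    (T₂ := 1390 * (D.n + D.items.length + D.K + 1)) ?_).mono (by simp only [Cmd.cost]; omega)
    (fun _ h => h)
  · simp only [wp, b₄.root]
    exact ⟨⟨by omega, hroot⟩, trivial⟩
  rintro _ rfl
  have t5 : TableInv D q σ₄.g q.length (σ₄.setG 10 D.root D.root).g := by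
    refine ⟨c₄.congr fun k hk v => ?_, ?_, by omega, by omega, fun k h1 h2 v => ?_⟩
    · rw [St.setG_g, if_neg (by omega)]
    · simp [St.setG_g]
    · rw [St.setG_g, if_neg h1]
  refine (Tri.seq (downLoop_tri (σ := σ₄.setG 10 D.root D.root) hF hq (TableInv D q σ₄.g) (fun _ _ h => h.counted)
    (tableBody_spec hF hq) (b₄.congr fun _ _ => rfl) rfl t5)
    (T₂ := 1300 * (D.n + D.items.length + D.K + 1)) ?_).mono ?_ (fun _ h => h)
  rotate_left
  · simp [tableBody, Cmd.cost]; omega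
  rintro σ₅ ⟨b₅, i₅, t₅⟩
  have i₅' : σ₅.inp = σ.inp := i₅.trans (i₄.trans (i₃.trans i₂))
  have z₅ : ∀ k, 11 < k → k < 16 → ∀ v, σ₅.g k v = 0 := fun k hk hk' v =>
    (t₅.rest k (by omega) (by omega) v).trans (z₄ k (by omega) hk' v)
  refine (Tri.seq (itemTri (J := AttachInv D σ₅.g) σ₅ b₅ i₅' ?_
    (attachBody_spec hF hD t₅ b₅.zero b₅.one))
    (T₂ := 1200 * (D.n + D.items.length + D.K + 1)) ?_).mono ?_ (fun _ h => h)
  · refine ⟨fun a x => ?_, fun _ _ _ => rfl⟩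
    rw [z₅ 12 (by omega) (by omega)]
    simp
  rotate_left
  · simp [attachBody, attachMax, Cmd.cost]; omega
  rintro σ₆ ⟨b₆, i₆, a₆⟩
  have z₆ : ∀ v, σ₆.g 13 v = 0 := fun v =>
    (a₆.rest 13 (by omega) v).trans (z₅ 13 (by omega) (by omega) v)
  have f₆ : FinalInv D q σ₆.g q.length σ₆.g := by
    refine ⟨t₅.counted.congr fun k hk v => a₆.rest k (by omega) v, ⟨?_, z₆ _⟩, by omega,
      fun t ht _ => ⟨rfl, z₆ _⟩⟩
    have := (a₆.sup D.root 0).2 fun it _ h => absurd rfl h.1.2.1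
    omega
  refine (Tri.seq (downLoop_tri hF hq (FinalInv D q σ₆.g) (fun _ _ h => h.counted)
    (finalBody_spec hF hq a₆.sup) b₆ rfl f₆)
    (T₂ := 1000 * (D.n + D.items.length + D.K + 1)) ?_).mono ?_ (fun _ h => h)
  rotate_left
  · simp [finalBody, Cmd.cost]; omega
  rintro σ₇ ⟨b₇, i₇, f₇⟩
  refine (outPhase_tri hF b₇).mono (by omega) fun σ' h => ?_
  refine ⟨σ₇.g 12, fun v hv x => ?_, fun v hv => ?_⟩
  · by_cases hr : v = D.root
    · rw [hr, f₇.root.1]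
      simp [D.bound_root x]
    · obtain ⟨t, ht, rfl⟩ := hq.exists_index hv hr
      exact (f₇.done t ht (by omega)).1 x
  · rw [h v hv]
    split_ifs with hr
    · rw [hr, f₇.root.2]
    · obtain ⟨t, ht, rfl⟩ := hq.exists_index hv hr
      exact (f₇.done t ht (by omega)).2

/-! ## Induced suffix trees: nodes, parents and covers -/

section Words

variable {α : Type}

theorem markedSuffix_eq {w : List α} {k : ℕ} (hk : k ≤ w.length) :
    markedSuffix w k = (w.drop (k - 1)).map some ++ [none] := by
  rw [markedSuffix, List.drop_append_of_le_length (by simp; omega), List.map_drop]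

theorem append_singleton_of_prefix {v s : List (Option α)} (h : v <+: s) (hne : v ≠ s) :
    ∃ a, v ++ [a] <+: s := by
  obtain ⟨t, rfl⟩ := h
  cases t with
  | nil => simp at hne
  | cons a t => exact ⟨a, t, by simp⟩

theorem isPrefix_antisymm {u v : List (Option α)} (h : u <+: v) (h' : v <+: u) : u = v :=
  h.eq_of_length (le_antisymm h.length_le h'.length_le)

/-- Two words, none of which is a prefix of the other, diverge. -/
theorem exists_diverge {u v : List (Option α)} (h : ¬ u <+: v) (h' : ¬ v <+: u) :
    ∃ c a b, a ≠ b ∧ c ++ [a] <+: u ∧ c ++ [b] <+: v := by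
  induction u generalizing v with
  | nil => simp at h
  | cons x u ih =>
    cases v with
    | nil => simp at h'
    | cons y v =>
      by_cases e : x = y
      · subst e
        simp only [List.cons_prefix_cons, true_and] at h h'
        obtain ⟨c, a, b, hab, h1, h2⟩ := ih h h'
        exact ⟨x :: c, a, b, hab, by simpa using h1, by simpa using h2⟩
      · exact ⟨[], x, y, e, by simp, by simp⟩

/-- A common prefix of two words is a prefix of the point at which they diverge. -/
theorem prefix_of_diverge {u v x c : List (Option α)} {a b : Option α} (hab : a ≠ b)
    (hu : c ++ [a] <+: u) (hv : c ++ [b] <+: v) (h : x <+: u) (h' : x <+: v) : x <+: c := by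
  rcases List.prefix_or_prefix_of_prefix h ((List.prefix_append c [a]).trans hu) with h1 | h1
  · exact h1
  · by_cases e : c = x
    · rw [e]
    · obtain ⟨z, hz⟩ := append_singleton_of_prefix h1 e
      have key : ∀ (y : List (Option α)) (d : Option α), x <+: y → c ++ [d] <+: y → z = d := by
        intro y d h2 h3
        have := List.prefix_of_prefix_length_le (hz.trans h2) h3 (by simp)
        simpa using this.eq_of_length (by simp)
      exact absurd ((key u a h hu).symm.trans (key v b h' hv)) hab

theorem mem_occ {w : List α} {v : List (Option α)} {γ : Interval} {k : ℕ} :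
    k ∈ occ w v γ ↔ (γ.lo ≤ k ∧ k ≤ γ.hi) ∧ v <+: markedSuffix w k := by
  simp [occ]

/-- `l` is a subinterval of `γ`. -/
def Interval.Sub (l γ : Interval) : Prop := γ.lo ≤ l.lo ∧ l.hi ≤ γ.hi

theorem mem_occ_of_sub {w : List α} {v : List (Option α)} {γ l : Interval} (h : l.Sub γ) {k : ℕ} :
    k ∈ occ w v l ↔ k ∈ occ w v γ ∧ l.lo ≤ k ∧ k ≤ l.hi := by
  have := h.1
  have := h.2
  simp only [mem_occ]
  constructor
  · rintro ⟨h1, h2⟩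
    exact ⟨⟨by omega, h2⟩, h1⟩
  · rintro ⟨⟨h1, h2⟩, h3⟩
    exact ⟨h3, h2⟩

theorem occ_mono_prefix {w : List α} {u v : List (Option α)} {γ : Interval} (h : v <+: u) :
    occ w u γ ⊆ occ w v γ := by
  intro k hk
  rw [mem_occ] at hk ⊢
  exact ⟨hk.1, h.trans hk.2⟩

theorem IsNode.of_prefix {w : List α} {u v : List (Option α)} {γ : Interval} (h : IsNode w γ u)
    (hv : v <+: u) : IsNode w γ v :=
  h.mono (occ_mono_prefix hv)

theorem IsNode.of_sub {w : List α} {v : List (Option α)} {γ l : Interval} (hl : l.Sub γ)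
    (h : IsNode w l v) : IsNode w γ v :=
  h.mono fun _ hk => ((mem_occ_of_sub hl).1 hk).1

theorem IsExplicit.of_sub {w : List α} {v : List (Option α)} {γ l : Interval} (hl : l.Sub γ)
    (h : IsExplicit w l v) : IsExplicit w γ v := by
  rcases h with h | ⟨k, h1, h2, h3⟩ | ⟨a, b, hab, h1, h2⟩
  · exact Or.inl h
  · exact Or.inr (Or.inl ⟨k, hl.1.trans h1, h2.trans hl.2, h3⟩)
  · exact Or.inr (Or.inr ⟨a, b, hab, h1.of_sub hl, h2.of_sub hl⟩)

theorem IsExplicit.isNode {w : List α} {v : List (Option α)} {γ : Interval} (hγ : γ.lo ≤ γ.hi)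
    (h : IsExplicit w γ v) : IsNode w γ v := by
  rcases h with rfl | ⟨k, h1, h2, rfl⟩ | ⟨a, b, hab, h1, h2⟩
  · exact ⟨γ.lo, by simp [mem_occ, hγ]⟩
  · exact ⟨k, by simp [mem_occ, h1, h2]⟩
  · exact h1.of_prefix (List.prefix_append _ _)

theorem isExplicit_nil {w : List α} {γ : Interval} : IsExplicit w γ [] := Or.inl rfl

theorem isExplicit_of_diverge {w : List α} {γ : Interval} {u v c : List (Option α)}
    {a b : Option α} (hu : IsNode w γ u) (hv : IsNode w γ v) (hab : a ≠ b) (h : c ++ [a] <+: u)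
    (h' : c ++ [b] <+: v) : IsExplicit w γ c :=
  Or.inr (Or.inr ⟨a, b, hab, hu.of_prefix h, hv.of_prefix h'⟩)

/-! ### Parents -/

theorem parent_nil {w : List α} {γ : Interval} : parent w γ [] = [] := by simp [parent]

theorem parent_prefix {w : List α} {γ : Interval} {v : List (Option α)} :
    parent w γ v <+: v :=
  List.take_prefix _ _

open Classical in
theorem parent_spec {w : List α} {γ : Interval} {v : List (Option α)} (hv : v ≠ []) :
    (parent w γ v).length < v.length ∧ IsExplicit w γ (parent w γ v) := by
  have h := Nat.findGreatest_spec (P := fun d => d < v.length ∧ IsExplicit w γ (v.take d))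
    (Nat.zero_le v.length) ⟨List.length_pos_iff.2 hv, isExplicit_nil⟩
  refine ⟨?_, ?_⟩
  · rw [parent, List.length_take]
    have := h.1
    omega
  · exact h.2

theorem parent_ne {w : List α} {γ : Interval} {v : List (Option α)} (hv : v ≠ []) :
    parent w γ v ≠ v := fun e => by
  have := (parent_spec (w := w) (γ := γ) hv).1
  rw [e] at this
  omega

theorem IsExplicit.parent {w : List α} {γ : Interval} {v : List (Option α)} :
    IsExplicit w γ (parent w γ v) := by
  by_cases h : v = []
  · rw [h, parent_nil]; exact isExplicit_nil
  · exact (parent_spec h).2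

open Classical in
theorem prefix_parent {w : List α} {γ : Interval} {u v : List (Option α)} (hu : IsExplicit w γ u)
    (h : u <+: v) (hne : u ≠ v) : u <+: parent w γ v := by
  have hl : u.length < v.length := lt_of_le_of_ne h.length_le fun e => hne (h.eq_of_length e)
  have e := List.prefix_iff_eq_take.1 h
  refine List.prefix_of_prefix_length_le h parent_prefix ?_
  have := Nat.le_findGreatest (P := fun d => d < v.length ∧ IsExplicit w γ (v.take d))
    hl.le ⟨hl, e ▸ hu⟩
  rw [SeedMerge.parent, List.length_take]
  exact le_min this hl.le

/-! ### Covers -/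

/-- The node `v` of the trie lies on the edge of the compacted trie that leads to `u`. -/
structure Covers (w : List α) (l : Interval) (v u : List (Option α)) : Prop where
  explicit : IsExplicit w l u
  pre : v <+: u
  par : ¬ v <+: parent w l u

theorem Covers.parent_prefix {w : List α} {l : Interval} {v u : List (Option α)}
    (h : Covers w l v u) : SeedMerge.parent w l u <+: v :=
  (List.prefix_or_prefix_of_prefix SeedMerge.parent_prefix h.pre).resolve_right h.par

/-- The shortest explicit node that extends `v` works, because its parent is explicit and shorter.
There is one, since a leaf extends `v`. -/
theorem exists_covers {w : List α} {l : Interval} {v : List (Option α)} (hv : v ≠ [])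
    (h : IsNode w l v) : ∃ u, Covers w l v u := by
  classical
  have hex : ∃ d u, IsExplicit w l u ∧ v <+: u ∧ u.length = d := by
    obtain ⟨k, hk⟩ := h
    rw [mem_occ] at hk
    exact ⟨_, markedSuffix w k, Or.inr (Or.inl ⟨k, hk.1.1, hk.1.2, rfl⟩), hk.2, rfl⟩
  obtain ⟨u, h1, h2, h3⟩ := Nat.find_spec hex
  refine ⟨u, h1, h2, fun h4 => ?_⟩
  have hu : u ≠ [] := by
    rintro rfl
    exact hv (List.prefix_nil.1 h2)
  have h5 := parent_spec (w := w) (γ := l) hu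
  exact Nat.find_min hex (h3 ▸ h5.1) ⟨_, h5.2, h4, rfl⟩

/-- If one cover is a proper prefix of the other, it lies between `v` and the parent of the longer
one. If they diverge, they do so at an explicit node extending `v`, which then lies between `v` and
the parent of the first. Both contradict the definition of a cover. -/
theorem Covers.unique {w : List α} {l : Interval} (hl : l.lo ≤ l.hi) {v u u' : List (Option α)}
    (h : Covers w l v u) (h' : Covers w l v u') : u = u' := by
  have key : ∀ {u u'}, Covers w l v u → Covers w l v u' → u <+: u' → u = u' := by
    intro u u' h h' hp
    by_contra hne
    exact h'.par (h.pre.trans (prefix_parent h.explicit hp hne))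
  by_cases h1 : u <+: u'
  · exact key h h' h1
  by_cases h2 : u' <+: u
  · exact (key h' h h2).symm
  exfalso
  obtain ⟨c, a, b, hab, h3, h4⟩ := exists_diverge h1 h2
  have h5 := prefix_of_diverge hab h3 h4 h.pre h'.pre
  refine h.par (h5.trans (prefix_parent (isExplicit_of_diverge (h.explicit.isNode hl)
    (h'.explicit.isNode hl) hab h3 h4) ((List.prefix_append _ _).trans h3) ?_))
  rintro rfl
  simpa using h3.length_le

/-- A node has the same occurrences as each of its prefixes from which it is not separated by an
explicit node. -/
theorem occ_eq_of_not_explicit {w : List α} {γ : Interval} {u v : List (Option α)}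
    (hu : IsNode w γ u) (hvu : v <+: u)
    (h : ∀ c, IsExplicit w γ c → v <+: c → c <+: u → c = u) : occ w v γ = occ w u γ := by
  refine (Finset.Subset.antisymm (occ_mono_prefix hvu) fun k hk => ?_).symm
  rw [mem_occ] at hk ⊢
  refine ⟨hk.1, ?_⟩
  by_contra h1
  by_cases h2 : markedSuffix w k <+: u
  · have := h _ (Or.inr (Or.inl ⟨k, hk.1.1, hk.1.2, rfl⟩)) hk.2 h2
    exact h1 (this ▸ List.prefix_refl _)
  · obtain ⟨c, a, b, hab, h3, h4⟩ := exists_diverge h1 h2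
    have h5 := prefix_of_diverge hab h3 h4 hvu hk.2
    have h6 : c = u := by
      refine h c (isExplicit_of_diverge (v := markedSuffix w k) hu ?_ hab h3 h4) h5
        ((List.prefix_append _ _).trans h3)
      exact ⟨k, mem_occ.2 ⟨hk.1, List.prefix_refl _⟩⟩
    subst h6
    simpa using h3.length_le

theorem Covers.occ_eq {w : List α} {l : Interval} (hl : l.lo ≤ l.hi) {v u : List (Option α)}
    (h : Covers w l v u) : occ w v l = occ w u l := by
  refine occ_eq_of_not_explicit (h.explicit.isNode hl) h.pre fun c h1 h2 h3 => ?_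
  by_contra hne
  exact h.par (h2.trans (prefix_parent h1 h3 hne))

/-! ### Lengths -/

theorem nodeLength_append (u v : List (Option α)) :
    nodeLength (u ++ v) = nodeLength u + nodeLength v := by
  simp [nodeLength, List.reduceOption_append]

theorem nodeLength_mono {u v : List (Option α)} (h : u <+: v) : nodeLength u ≤ nodeLength v := by
  obtain ⟨t, rfl⟩ := h
  rw [nodeLength_append]
  omega

theorem nodeLength_map_some (x : List α) : nodeLength (x.map some) = x.length := by
  simp [nodeLength, List.reduceOption, List.filterMap_map]

/-- A node is either free of the end-marker, or a leaf. -/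
theorem node_cases {w : List α} {k : ℕ} (hk : k ≤ w.length) {v : List (Option α)}
    (h : v <+: markedSuffix w k) :
    (∃ x, x <+: w.drop (k - 1) ∧ v = x.map some) ∨ v = markedSuffix w k := by
  rw [markedSuffix_eq hk] at h ⊢
  rcases List.prefix_concat_iff.1 h with h | h
  · exact Or.inr h
  · left
    rw [List.prefix_iff_eq_take.1 h, ← List.map_take]
    exact ⟨_, List.take_prefix _ _, rfl⟩

theorem nodeLength_markedSuffix {w : List α} {k : ℕ} (hk : k ≤ w.length) :
    nodeLength (markedSuffix w k) = w.length - (k - 1) := by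
  rw [markedSuffix_eq hk, nodeLength_append, nodeLength_map_some]
  simp [nodeLength, List.reduceOption]

theorem take_nodeLength {w : List α} {k : ℕ} (hk : k ≤ w.length) {v : List (Option α)}
    (h : v <+: markedSuffix w k) {g : ℕ} (hg : g ≤ nodeLength v) :
    ∃ x : List α, v.take g = x.map some ∧ x.length = g := by
  rcases node_cases hk h with ⟨x, -, rfl⟩ | rfl
  · rw [nodeLength_map_some] at hg
    exact ⟨x.take g, by rw [List.map_take], by simpa using hg⟩
  · rw [nodeLength_markedSuffix hk] at hg
    rw [markedSuffix_eq hk]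
    refine ⟨(w.drop (k - 1)).take g, ?_, by simp; omega⟩
    rw [List.take_append_of_le_length (by simp; omega), List.map_take]

/-- The end-marker occurs only at the end of a leaf, so a proper prefix of a node is free of it. -/
theorem nodeLength_eq_of_lt {w : List α} {k : ℕ} (hk : k ≤ w.length) {u v : List (Option α)}
    (h : v <+: markedSuffix w k) (hu : u <+: v) (hne : u ≠ v) : nodeLength u = u.length := by
  rcases node_cases hk (hu.trans h) with ⟨x, -, rfl⟩ | rfl
  · simp [nodeLength_map_some]
  · exact absurd (isPrefix_antisymm hu h) hne

end Words

/-! ## Quasigaps and dense sets of positions -/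

/-- The set `X` of positions in `γ` has no gap that is larger than `g`, and the last element of `X`
is close to the end of `γ`. -/
def Dense (X : Finset ℕ) (γ : Interval) (g : ℕ) : Prop :=
  1 ≤ g ∧ ∃ e ∈ X, (∀ x ∈ X, x ≤ e) ∧ γ.hi + 2 ≤ e + 2 * g ∧
    ∀ p, γ.lo ≤ p → p ≤ e → ∃ q ∈ X, p ≤ q ∧ q < p + g

theorem Dense.nonempty {X : Finset ℕ} {γ : Interval} {g : ℕ} (h : Dense X γ g) : X.Nonempty := by
  obtain ⟨-, e, he, -⟩ := h
  exact ⟨e, he⟩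

theorem maxgap_le_iff {X : Finset ℕ} {g : ℕ} : maxgap X ≤ g ↔
    ∀ a ∈ X, ∀ b ∈ X, a < b → (∀ c ∈ X, ¬ (a < c ∧ c < b)) → b - a ≤ g := by
  simp only [maxgap, Finset.sup_le_iff, Finset.mem_filter, Finset.mem_product]
  constructor
  · intro h a ha b hb hab hc
    exact h (a, b) ⟨⟨ha, hb⟩, hab, hc⟩
  · rintro h ⟨a, b⟩ ⟨⟨ha, hb⟩, hab, hc⟩
    exact h a ha b hb hab hc

/-- Windows starting right behind an element of `X` express the bound on `maxgap`, the window
starting at `γ.lo` the bound on the first element, and the condition at the end is the rounded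
fraction with its denominator cleared. -/
theorem dense_iff {X : Finset ℕ} {γ : Interval} {g : ℕ} (hX : ∀ x ∈ X, γ.lo ≤ x ∧ x ≤ γ.hi)
    (h : X.Nonempty) : Dense X γ g ↔ maxgap X ≤ g ∧ X.min' h - γ.lo + 1 ≤ g ∧
      (γ.hi - X.max' h) ⌈/⌉ 2 + 1 ≤ g := by
  have hlast := X.max'_mem h
  have hfirst := X.min'_mem h
  have hhi := (hX _ hlast).2
  have hlo := (hX _ hfirst).1
  have hceil : (γ.hi - X.max' h) ⌈/⌉ 2 + 1 ≤ g ↔ 1 ≤ g ∧ γ.hi + 2 ≤ X.max' h + 2 * g := by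
    rw [Nat.ceilDiv_eq_add_pred_div]
    omega
  rw [hceil, maxgap_le_iff]
  constructor
  · rintro ⟨h1, e, he, hmax, h2, h3⟩
    have e1 : X.max' h = e := le_antisymm (hmax _ hlast) (X.le_max' _ he)
    rw [e1]
    refine ⟨fun a ha b hb hab hc => ?_, ?_, h1, h2⟩
    · obtain ⟨q, hq, hq1, hq2⟩ := h3 (a + 1) (by have := (hX a ha).1; omega)
        (by have := hmax b hb; omega)
      have := hc q hq
      omega
    · obtain ⟨q, hq, hq1, hq2⟩ := h3 γ.lo le_rfl ((hX e he).1)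
      have := X.min'_le _ hq
      omega
  · rintro ⟨h1, h2, h3, h4⟩
    refine ⟨h3, _, hlast, fun x hx => X.le_max' x hx, h4, fun p hp hp' => ?_⟩
    have hex : ∃ q, q ∈ X ∧ p ≤ q := ⟨_, hlast, hp'⟩
    obtain ⟨q, ⟨hq, hpq⟩, hmin⟩ : ∃ q, (q ∈ X ∧ p ≤ q) ∧ ∀ r, r ∈ X → p ≤ r → q ≤ r :=
      ⟨_, Nat.find_spec hex, fun r hr hr' => Nat.find_min' hex ⟨hr, hr'⟩⟩
    refine ⟨q, hq, hpq, ?_⟩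
    by_cases hf : q ≤ X.min' h
    · omega
    -- The predecessor of `q` in `X` lies before `p`, by the choice of `q` as the least element from
    -- `p` on; as it is at distance at most `g` from `q`, it follows that `q < p + g`.
    · have hY : (X.filter (· < q)).Nonempty := ⟨_, Finset.mem_filter.2 ⟨hfirst, by omega⟩⟩
      have hz := Finset.mem_filter.1 ((X.filter (· < q)).max'_mem hY)
      have := h1 _ hz.1 q hq hz.2 fun c hc hcc => by
        have := (X.filter (· < q)).le_max' c (Finset.mem_filter.2 ⟨hc, hcc.2⟩)
        omega
      have := hz.2
      by_contra hn
      have := hmin _ hz.1 (by omega)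
      omega

/-- An interval of the staircase is either all of `γ` or contains more than `2 * m` positions. In
the second case it contains the last occurrence in `γ`, which is less than `2 * g` from the end of
`γ`, or else the window formed by its own last `g` positions contains an occurrence. Either way its
last occurrence is near its end. -/
theorem Dense.of_staircase {X Y : Finset ℕ} {γ l : Interval} {g m : ℕ} (h : Dense X γ g)
    (hg : g ≤ m) (hl : InStaircase γ m l) (hm : 1 ≤ m) (hmN : m ≤ γ.length)
    (hX : ∀ x ∈ X, γ.lo ≤ x ∧ x ≤ γ.hi) (hY : ∀ k, k ∈ Y ↔ k ∈ X ∧ l.lo ≤ k ∧ k ≤ l.hi) :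
    Dense Y l g := by
  obtain ⟨h1, e, he, hmax, h2, h3⟩ := h
  obtain ⟨k, hk, hlo, hhi⟩ := hl
  have hN : γ.length = γ.hi + 1 - γ.lo := rfl
  refine ⟨h1, ?_⟩
  -- With at most three blocks of length `m` the staircase is the single interval `γ`; otherwise
  -- only the last third of an interval can be cut off, and never completely.
  have hcase : (k = 0 ∧ l.hi = γ.hi ∧ l.lo = γ.lo) ∨ (l.lo + 2 * m ≤ l.hi ∧ l.hi ≤ γ.hi) := by
    rw [Nat.ceilDiv_eq_add_pred_div] at hk
    by_cases h0 : (γ.length + m - 1) / m ≤ 2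
    · left
      have h5 : γ.length + m - 1 < 3 * m := (Nat.div_lt_iff_lt_mul (by omega)).1 (by omega)
      have hk0 : k = 0 := by omega
      subst hk0
      omega
    · right
      have h5 : k * m + 3 * m ≤ γ.length + m - 1 := by
        rw [← Nat.add_mul]
        exact (Nat.le_div_iff_mul_le (by omega)).1 (by omega)
      rw [Nat.add_mul] at hhi
      omega
  rcases hcase with ⟨-, e1, e2⟩ | ⟨h4, h5⟩
  · rw [e1, e2]
    simp only [e1, e2] at hY
    refine ⟨e, (hY e).2 ⟨he, hX e he⟩, fun x hx => hmax x ((hY x).1 hx).1, h2, fun p hp hp' => ?_⟩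
    obtain ⟨q, hq, hq'⟩ := h3 p hp hp'
    exact ⟨q, (hY q).2 ⟨hq, hX q hq⟩, hq'⟩
  have hlo' : γ.lo ≤ l.lo := by omega
  have hne : Y.Nonempty := by
    by_cases hel : e ≤ l.hi
    · exact ⟨e, (hY e).2 ⟨he, by omega, hel⟩⟩
    · obtain ⟨q, hq, h6, h7⟩ := h3 (l.hi + 1 - g) (by omega) (by omega)
      exact ⟨q, (hY q).2 ⟨hq, by omega, by omega⟩⟩
  have hmem := (hY _).1 (Y.max'_mem hne)
  refine ⟨Y.max' hne, Y.max'_mem hne, fun x hx => Y.le_max' x hx, ?_, fun p hp hp' => ?_⟩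
  · by_cases hel : e ≤ l.hi
    · have := Y.le_max' e ((hY e).2 ⟨he, by omega, hel⟩)
      omega
    · obtain ⟨q, hq, h6, h7⟩ := h3 (l.hi + 1 - g) (by omega) (by omega)
      have := Y.le_max' q ((hY q).2 ⟨hq, by omega, by omega⟩)
      omega
  · obtain ⟨q, hq, h6, h7⟩ := h3 p (by omega) (by have := hmax _ hmem.1; omega)
    by_cases hqe : q ≤ Y.max' hne
    · exact ⟨q, (hY q).2 ⟨hq, by omega, by omega⟩, h6, h7⟩
    · exact ⟨_, Y.max'_mem hne, hp', by omega⟩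

/-! ### Small quasigaps as density; copies of factors -/

section Words

variable {α : Type}

/-- The condition that the maximum in the definition is at most `|v|` is absorbed into `min g
(nodeLength v)`, so the value `∞` needs no further treatment. -/
theorem quasigap_le_iff {w : List α} {v : List (Option α)} {γ : Interval} {g : ℕ} :
    quasigap w v γ ≤ (g : ℕ∞) ↔ Dense (occ w v γ) γ (min g (nodeLength v)) ∧
      nodeLength (parent w γ v) + 1 ≤ min g (nodeLength v) := by
  unfold quasigap
  split_ifs with h
  · rw [dense_iff (fun x hx => (mem_occ.1 hx).1) h]
    dsimp only
    split_ifs with h'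
    · rw [Nat.cast_le]
      simp only [max_le_iff, le_min_iff] at h' ⊢
      tauto
    · simp only [max_le_iff, le_min_iff] at h' ⊢
      simp only [top_le_iff, ENat.natCast_ne_top, false_iff]
      tauto
  · simp only [top_le_iff, ENat.natCast_ne_top, false_iff]
    exact fun h' => h h'.1.nonempty

theorem map_some_prefix_iff {w x : List α} {k : ℕ} :
    x.map some <+: markedSuffix w k ↔ ∀ t (h : t < x.length), w[k - 1 + t]? = some x[t] := by
  simp only [List.prefix_iff_getElem?, markedSuffix, List.getElem?_drop, List.length_map]
  refine forall₂_congr fun t h => ?_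
  rw [List.getElem?_append]
  split_ifs with h'
  · simp
  · simp only [List.length_map, not_lt] at h'
    rw [List.getElem?_eq_none h', List.getElem?_singleton]
    split_ifs <;> simp

theorem subword_getElem? {w : List α} {γ : Interval} {t : ℕ} (ht : t < γ.length) :
    (subword w γ)[t]? = w[γ.lo - 1 + t]? := by
  rw [subword, List.getElem?_take_of_lt ht, List.getElem?_drop]

theorem length_subword {w : List α} {γ : Interval} (h : IsIntervalOf w γ) :
    (subword w γ).length = γ.length := by
  obtain ⟨h1, h2, h3⟩ := h
  simp only [subword, List.length_take, List.length_drop, Interval.length]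
  omega

/-- A factor that is not a single letter has an earlier occurrence. -/
theorem IsFactorization.exists_copy {u : List α} {F : List (List α)} (h : IsFactorization u F)
    {k : ℕ} (hk : k < F.length) (h1 : F[k].length ≠ 1) :
    ∃ a, a + F[k].length ≤ (F.take k).flatten.length ∧ ∀ t, t < F[k].length →
      u[(F.take k).flatten.length + t]? = u[a + t]? := by
  obtain ⟨A, B, e⟩ := (h.2 k hk).resolve_right h1
  have hu : u = (F.take k).flatten ++ (F[k] ++ (F.drop (k + 1)).flatten) := by
    rw [← h.1, ← List.flatten_cons, ← List.drop_eq_getElem_cons hk, ← List.flatten_append,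
      List.take_append_drop]
  refine ⟨A.length, ?_, fun t ht => ?_⟩
  · rw [← e]
    simp
  · have e1 : u[(F.take k).flatten.length + t]? = F[k][t]? := by
      rw [hu, List.getElem?_append_right (by omega), Nat.add_sub_cancel_left,
        List.getElem?_append_left ht]
    rw [e1, hu, List.getElem?_append_left (by rw [← e]; simp; omega), ← e, List.append_assoc,
      List.getElem?_append_right (by omega), Nat.add_sub_cancel_left,
      List.getElem?_append_left ht]

theorem IsFactorization.end_le {u : List α} {F : List (List α)} (h : IsFactorization u F)
    {k : ℕ} (hk : k < F.length) : (F.take k).flatten.length + F[k].length ≤ u.length := by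
  have hu : u = (F.take k).flatten ++ (F[k] ++ (F.drop (k + 1)).flatten) := by
    rw [← h.1, ← List.flatten_cons, ← List.drop_eq_getElem_cons hk, ← List.flatten_append,
      List.take_append_drop]
  have := congrArg List.length hu
  simp only [List.length_append] at this
  omega

/-! ### Staircases -/

/-- The interval of index `k` of the staircase. -/
def stair (γ : Interval) (m k : ℕ) : Interval := ⟨γ.lo + k * m, min (γ.lo + (k + 3) * m - 1) γ.hi⟩

theorem inStaircase_stair {γ : Interval} {m k : ℕ} (h : k ≤ (γ.length ⌈/⌉ m) - 3) :
    InStaircase γ m (stair γ m k) := ⟨k, h, rfl, rfl⟩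

/-- The extension of the last interval therefore leaves `γ`, so this interval is never removed from
the staircase. -/
theorem stair_last_hi {γ : Interval} {m : ℕ} (hm : 1 ≤ m) :
    (stair γ m ((γ.length ⌈/⌉ m) - 3)).hi = γ.hi := by
  rw [Nat.ceilDiv_eq_add_pred_div]
  have h1 := Nat.lt_div_mul_add (a := γ.length + m - 1) (b := m) (by omega)
  have h2 : (γ.length + m - 1) / m * m ≤ ((γ.length + m - 1) / m - 3 + 3) * m :=
    Nat.mul_le_mul_right _ (by omega)
  have hN : γ.length = γ.hi + 1 - γ.lo := rfl
  simp only [stair]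
  omega

theorem InStaircase.bounds {γ l : Interval} {m : ℕ} (h : InStaircase γ m l) (hm : 1 ≤ m)
    (hmN : m ≤ γ.length) : γ.lo ≤ l.lo ∧ l.lo ≤ l.hi ∧ l.hi ≤ γ.hi := by
  obtain ⟨k, hk, hlo, hhi⟩ := h
  have hN : γ.length = γ.hi + 1 - γ.lo := rfl
  have h1 : k * m + m ≤ γ.length + m - 1 := by
    rw [← Nat.succ_mul]
    rw [Nat.ceilDiv_eq_add_pred_div] at hk
    refine (Nat.le_div_iff_mul_le (by omega)).1 ?_
    have : 1 ≤ (γ.length + m - 1) / m := (Nat.le_div_iff_mul_le (by omega)).2 (by omega)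
    omega
  rw [Nat.add_mul] at hhi
  omega

theorem not_withinSingleFactor {w : List α} {γ : Interval} (hγ : IsIntervalOf w γ)
    {F : List (List α)} (hF : IsFactorization (subword w γ) F) {a b : ℕ} (h : γ.hi < b) :
    ¬ WithinSingleFactor γ F ⟨a, b⟩ := by
  rintro ⟨k, hk, -, h1⟩
  have h2 := hF.end_le hk
  rw [length_subword hγ] at h2
  have hN : γ.length = γ.hi + 1 - γ.lo := rfl
  have := hγ.2.1
  dsimp only at h1
  omega

/-- A word of length `g ≤ m` is dense in `γ` if it is dense in all intervals of the reduced
staircase: the other intervals of the staircase have an earlier copy. -/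
theorem dense_of_reducedStaircase {w : List α} {γ : Interval} {m : ℕ} {F : List (List α)}
    {K : List Interval} (hγ : IsIntervalOf w γ) (hm : 1 ≤ m) (hmN : m ≤ γ.length)
    (hF : IsFactorization (subword w γ) F) (hK : IsReducedStaircase γ m F K) {x : List α}
    (hx : x.length ≤ m)
    (h : ∀ l ∈ K, Dense (occ w (x.map some) l) l x.length) :
    Dense (occ w (x.map some) γ) γ x.length := by
  obtain ⟨g1, g2, g3⟩ := hγ
  have hN : γ.length = γ.hi + 1 - γ.lo := rfl
  set kmax := (γ.length ⌈/⌉ m) - 3 with hkmax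
  have sub : ∀ {l k}, InStaircase γ m l → k ∈ occ w (x.map some) l → k ∈ occ w (x.map some) γ := by
    intro l k hl hk
    have := hl.bounds hm hmN
    exact ((mem_occ_of_sub ⟨this.1, this.2.2⟩).1 hk).1
  -- The last interval, which is always kept, supplies the last occurrence `e` in `γ` and the
  -- condition at the end.
  have hlastK : stair γ m kmax ∈ K := by
    refine (hK.2 _).2 ⟨inStaircase_stair le_rfl, not_withinSingleFactor ⟨g1, g2, g3⟩ hF ?_⟩
    rw [stair_last_hi hm]
    omega
  obtain ⟨hx1, e, he, hmax, h2, h3⟩ := h _ hlastK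
  have heb := (mem_occ.1 he).1
  rw [stair_last_hi hm] at heb h2
  have hmaxγ : ∀ y ∈ occ w (x.map some) γ, y ≤ e := by
    intro y hy
    by_contra hn
    refine hn (hmax y ?_)
    rw [mem_occ] at hy ⊢
    rw [stair_last_hi hm]
    exact ⟨⟨by omega, hy.1.2⟩, hy.2⟩
  refine ⟨hx1, e, sub (inStaircase_stair le_rfl) he, hmaxγ, h2, fun p => ?_⟩
  induction p using Nat.strong_induction_on with
  | _ p ih =>
    intro hp hpe
    have hdm := Nat.div_add_mod' (p - γ.lo) m
    have hml := Nat.mod_lt (p - γ.lo) (show 0 < m by omega)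
    by_cases hlast : kmax ≤ (p - γ.lo) / m
    · have h4 := Nat.mul_le_mul_right m hlast
      obtain ⟨q, hq, hq'⟩ := h3 p (by simp only [stair]; omega) hpe
      exact ⟨q, sub (inStaircase_stair le_rfl) hq, hq'⟩
    push Not at hlast
    generalize (p - γ.lo) / m = k at hlast hdm
    have hst := inStaircase_stair (γ := γ) (m := m) hlast.le
    have hb := hst.bounds hm hmN
    have hhi : (stair γ m k).hi = γ.lo + k * m + 3 * m - 1 := by
      rw [hkmax, Nat.ceilDiv_eq_add_pred_div] at hlast
      have h5 : (k + 3 + 1) * m ≤ γ.length + m - 1 :=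
        (Nat.le_div_iff_mul_le (by omega)).1 (by
          generalize (γ.length + m - 1) / m = r at hlast ⊢
          omega)
      simp only [stair]
      rw [Nat.add_mul k 3, min_eq_left]
      · omega
      · rw [Nat.add_mul, Nat.add_mul] at h5
        omega
    have hlo : (stair γ m k).lo = γ.lo + k * m := rfl
    by_cases hkK : stair γ m k ∈ K
    · obtain ⟨-, e', he', -, h6, h7⟩ := h _ hkK
      -- The position `p` lies in the first third of the interval, whereas its last occurrence `e'`
      -- is less than `2 * m` from its end; hence `p ≤ e'` and the window at `p` is covered by
      -- density.
      obtain ⟨q, hq, hq'⟩ := h7 p (by omega) (by omega)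
      exact ⟨q, sub hst hq, hq'⟩
    · have hw : WithinSingleFactor γ F ⟨(stair γ m k).lo, (stair γ m k).hi + m⟩ := by
        by_contra hn
        exact hkK ((hK.2 _).2 ⟨hst, hn⟩)
      obtain ⟨s, hs, h6, h7⟩ := hw
      dsimp only at h6 h7
      -- The extended interval has `4 * m` positions, so the factor is not a single letter.
      obtain ⟨a, h8, h9⟩ := hF.exists_copy hs (by omega)
      have h10 := hF.end_le hs
      rw [length_subword ⟨g1, g2, g3⟩] at h10
      set off := (F.take s).flatten.length with hoff
      -- The image of `p` in the earlier copy; it is smaller than `p` because the copy ends before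
      -- the factor begins. An occurrence found in the window there fits into the copy and is
      -- carried back.
      obtain ⟨q, hq, h11, h12⟩ := ih (p - off + a) (by omega) (by omega) (by omega)
      have hq' := mem_occ.1 hq
      refine ⟨q + off - a, mem_occ.2 ⟨⟨by omega, by omega⟩, ?_⟩, by omega, by omega⟩
      rw [map_some_prefix_iff] at hq' ⊢
      intro t ht
      rw [← hq'.2 t ht]
      have h13 := h9 (q - γ.lo - a + t) (by omega)
      rw [subword_getElem? (by omega), subword_getElem? (by omega)] at h13
      rw [show q + off - a - 1 + t = γ.lo - 1 + (off + (q - γ.lo - a + t)) by omega, h13]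
      congr 1
      omega

/-- The reduction of quasigaps in `γ` to the intervals of the reduced staircase. -/
theorem quasigap_le_iff_forall {w : List α} {γ : Interval} {m : ℕ} {F : List (List α)}
    {K : List Interval} (hγ : IsIntervalOf w γ) (hm : 1 ≤ m) (hmN : m ≤ γ.length)
    (hF : IsFactorization (subword w γ) F) (hK : IsReducedStaircase γ m F K)
    {v : List (Option α)} (hv : IsNode w γ v) (hne : v ≠ []) {g : ℕ} (hg : g ≤ m) :
    quasigap w v γ ≤ (g : ℕ∞) ↔ nodeLength (parent w γ v) + 1 ≤ min g (nodeLength v) ∧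
      ∀ l ∈ K, Dense (occ w v l) l (min g (nodeLength v)) := by
  rw [quasigap_le_iff, and_comm]
  refine and_congr_right fun hp => ?_
  have hKs : ∀ l ∈ K, l.Sub γ := fun l hl => by
    have := ((hK.2 l).1 hl).1.bounds hm hmN
    exact ⟨this.1, this.2.2⟩
  constructor
  · intro h l hl
    exact h.of_staircase (le_trans (min_le_left _ _) hg) ((hK.2 l).1 hl).1 hm hmN
      (fun x hx => (mem_occ.1 hx).1) fun k => mem_occ_of_sub (hKs l hl)
  · intro h
    obtain ⟨k, hk⟩ := id hv
    rw [mem_occ] at hk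
    have hkw : k ≤ w.length := hk.1.2.trans hγ.2.2
    -- The prefix `x` of `v` is longer than the parent of `v`, so no explicit node separates them
    -- and the occurrences agree; being of length at most `m`, it is subject to the staircase
    -- argument.
    obtain ⟨x, hx, hxl⟩ := take_nodeLength hkw hk.2 (min_le_right g (nodeLength v))
    have hpl : nodeLength (parent w γ v) = (parent w γ v).length :=
      nodeLength_eq_of_lt hkw hk.2 parent_prefix (parent_ne hne)
    have hocc : occ w (x.map some) γ = occ w v γ := by
      rw [← hx]
      refine occ_eq_of_not_explicit hv (List.take_prefix _ _) fun c h1 h2 h3 => ?_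
      by_contra hc
      have h4 := (prefix_parent h1 h3 hc).length_le
      have h5 := h2.length_le
      rw [hx, List.length_map, hxl] at h5
      omega
    rw [← hocc, ← hxl]
    refine dense_of_reducedStaircase hγ hm hmN hF hK (by omega) fun l hl => ?_
    have : occ w (x.map some) l = occ w v l := by
      ext j
      rw [mem_occ_of_sub (hKs l hl), mem_occ_of_sub (hKs l hl), hocc]
    rw [this, hxl]
    exact h l hl

end Words

/-! ## Sizes -/

section Words

variable {α : Type}

/-- Each new leaf of an induced suffix tree creates at most one branching node. -/
theorem exists_list_of_explicit (w : List α) {lo : ℕ} (hlo : 1 ≤ lo) (d : ℕ) :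
    ∃ L : List (List (Option α)), L.length ≤ 2 * d + 1 ∧
      ∀ v, IsExplicit w ⟨lo, lo + d - 1⟩ v → v ∈ L := by
  induction d with
  | zero =>
    refine ⟨[[]], by simp, fun v hv => ?_⟩
    rcases hv with rfl | ⟨k, h1, h2, -⟩ | ⟨a, -, -, ⟨k, hk⟩, -⟩
    · simp
    · dsimp only at h1 h2; omega
    · have := (mem_occ.1 hk).1
      dsimp only at this; omega
  | succ d ih =>
    obtain ⟨L, hL, hmem⟩ := ih
    set S := markedSuffix w (lo + d) with hS
    have hnode : ∀ v, IsNode w ⟨lo, lo + (d + 1) - 1⟩ v →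
        IsNode w ⟨lo, lo + d - 1⟩ v ∨ v <+: S := by
      rintro v ⟨k, hk⟩
      obtain ⟨⟨h1, h2⟩, h3⟩ := mem_occ.1 hk
      dsimp only at h1 h2
      by_cases e : k = lo + d
      · subst e; exact Or.inr h3
      · exact Or.inl ⟨k, mem_occ.2 ⟨⟨h1, by dsimp only; omega⟩, h3⟩⟩
    -- The point where the path of the new leaf leaves the old trie. It is unique, and no other
    -- branching node can arise.
    let New : List (Option α) → Prop := fun c => IsNode w ⟨lo, lo + d - 1⟩ c ∧
      ∃ a, c ++ [a] <+: S ∧ ¬ IsNode w ⟨lo, lo + d - 1⟩ (c ++ [a])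
    have huniq : ∀ c c', New c → New c' → c = c' := by
      have key : ∀ c c', New c → New c' → c <+: c' → c = c' := by
        rintro c c' ⟨-, a, h1, h2⟩ ⟨h3, b, h4, -⟩ h
        by_contra hne
        obtain ⟨z, hz⟩ := append_singleton_of_prefix h hne
        have h5 := List.prefix_of_prefix_length_le h1
          (hz.trans ((List.prefix_append _ _).trans h4)) (by simp)
        rw [h5.eq_of_length (by simp)] at h2
        exact h2 (h3.of_prefix hz)
      intro c c' h h'
      obtain ⟨-, a, h1, -⟩ := id h
      obtain ⟨-, b, h2, -⟩ := id h'
      rcases List.prefix_or_prefix_of_prefix ((List.prefix_append _ _).trans h1)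
        ((List.prefix_append _ _).trans h2) with h3 | h3
      · exact key _ _ h h' h3
      · exact (key _ _ h' h h3).symm
    have hcase : ∀ v, IsExplicit w ⟨lo, lo + (d + 1) - 1⟩ v →
        IsExplicit w ⟨lo, lo + d - 1⟩ v ∨ v = S ∨ New v := by
      rintro v (rfl | ⟨k, h1, h2, h3⟩ | ⟨a, b, hab, h1, h2⟩)
      · exact Or.inl isExplicit_nil
      · dsimp only at h1 h2
        by_cases e : k = lo + d
        · subst e; exact Or.inr (Or.inl h3)
        · exact Or.inl (Or.inr (Or.inl ⟨k, h1, by dsimp only; omega, h3⟩))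
      · by_cases ha : IsNode w ⟨lo, lo + d - 1⟩ (v ++ [a]) <;>
          by_cases hb : IsNode w ⟨lo, lo + d - 1⟩ (v ++ [b])
        · exact Or.inl (Or.inr (Or.inr ⟨a, b, hab, ha, hb⟩))
        · exact Or.inr (Or.inr ⟨ha.of_prefix (List.prefix_append _ _), b,
            (hnode _ h2).resolve_left hb, hb⟩)
        · exact Or.inr (Or.inr ⟨hb.of_prefix (List.prefix_append _ _), a,
            (hnode _ h1).resolve_left ha, ha⟩)
        · have h3 := (hnode _ h1).resolve_left ha
          have h4 := (hnode _ h2).resolve_left hb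
          have := (List.prefix_of_prefix_length_le h3 h4 (by simp)).eq_of_length (by simp)
          exact absurd (by simpa using this) hab
    by_cases hex : ∃ c, New c
    · obtain ⟨c, hc⟩ := hex
      refine ⟨S :: c :: L, by simp; omega, fun v hv => ?_⟩
      rcases hcase v hv with h | rfl | h
      · simp [hmem v h]
      · simp
      · simp [huniq v c h hc]
    · refine ⟨S :: L, by simp; omega, fun v hv => ?_⟩
      rcases hcase v hv with h | rfl | h
      · simp [hmem v h]
      · simp
      · exact absurd ⟨v, h⟩ hex

theorem Enumerates.length_le {w : List α} {γ : Interval} {V : List (List (Option α))}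
    (h : Enumerates w γ V) (hlo : 1 ≤ γ.lo) (hγ : γ.lo ≤ γ.hi) : V.length ≤ 2 * γ.length + 1 := by
  obtain ⟨L, h1, h2⟩ := exists_list_of_explicit w hlo γ.length
  have e : (⟨γ.lo, γ.lo + γ.length - 1⟩ : Interval) = γ := by
    obtain ⟨lo, hi⟩ := γ
    simp only [Interval.length, Interval.mk.injEq, true_and]
    dsimp only at hγ
    omega
  rw [e] at h2
  exact ((List.subperm_of_subset h.1 fun v hv => h2 v ((h.2 v).1 hv)).length_le).trans h1

/-- The left end determines the index, so there are at most `kmax + 1` intervals, each with at most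
`3 * m` positions; and both `kmax * m` and `m` are at most the length of `γ`. -/
theorem IsReducedStaircase.length_le {γ : Interval} {m : ℕ} {F : List (List α)}
    {K : List Interval} (hK : IsReducedStaircase γ m F K) (hm : 1 ≤ m) (hmN : m ≤ γ.length) :
    K.length ≤ totalLength K ∧ totalLength K ≤ 6 * γ.length := by
  have hN : γ.length = γ.hi + 1 - γ.lo := rfl
  have hst := fun l (hl : l ∈ K) => ((hK.2 l).1 hl).1
  have key : ∀ (L : List Interval) (a b : ℕ), (∀ l ∈ L, a ≤ l.length ∧ l.length ≤ b) →
      L.length * a ≤ totalLength L ∧ totalLength L ≤ L.length * b := by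
    intro L a b
    induction L with
    | nil => simp [totalLength]
    | cons l L ih =>
      intro h
      have h1 := ih fun x hx => h x (List.mem_cons_of_mem _ hx)
      have h2 := h l List.mem_cons_self
      simp only [totalLength, List.map_cons, List.sum_cons, List.length_cons, Nat.add_mul] at h1 ⊢
      omega
  have h1 := key K 1 (3 * m) fun l hl => by
    have h2 := (hst l hl).bounds hm hmN
    obtain ⟨k, -, h3, h4⟩ := hst l hl
    rw [Nat.add_mul] at h4
    simp only [Interval.length]
    omega
  refine ⟨by omega, h1.2.trans ?_⟩
  set kmax := (γ.length ⌈/⌉ m) - 3 with hk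
  have hkm : kmax * m ≤ γ.length := by
    rw [hk, Nat.ceilDiv_eq_add_pred_div, Nat.sub_mul]
    have := Nat.div_mul_le_self (γ.length + m - 1) m
    omega
  have hlen : K.length ≤ kmax + 1 := by
    have hinj : (K.map fun l => (l.lo - γ.lo) / m).Nodup := by
      refine List.Nodup.map_on (fun l hl l' hl' e => ?_) hK.1
      obtain ⟨k, -, h3, h4⟩ := hst l hl
      obtain ⟨k', -, h5, h6⟩ := hst l' hl'
      rw [h3, h5, Nat.add_sub_cancel_left, Nat.add_sub_cancel_left,
        Nat.mul_div_cancel _ (by omega), Nat.mul_div_cancel _ (by omega)] at e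
      subst e
      obtain ⟨a, b⟩ := l
      obtain ⟨a', b'⟩ := l'
      simp_all
    have hsub : (K.map fun l => (l.lo - γ.lo) / m) ⊆ List.range (kmax + 1) := by
      intro k hk'
      obtain ⟨l, hl, rfl⟩ := List.mem_map.1 hk'
      obtain ⟨k, h2, h3, -⟩ := hst l hl
      rw [h3, Nat.add_sub_cancel_left, Nat.mul_div_cancel _ (by omega), List.mem_range]
      omega
    simpa using (List.subperm_of_subset hinj hsub).length_le
  have := Nat.mul_le_mul_right (3 * m) hlen
  have h5 : (kmax + 1) * (3 * m) = 3 * (kmax * m) + 3 * m := by ring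
  omega

/-! ## Merge as a problem on trees -/

/-- The node with the identifier `i`. -/
def node (V : List (List (Option α))) (i : ℕ) : List (Option α) := V.getD i []

open Classical in
theorem nodeId_lt {V : List (List (Option α))} {v : List (Option α)} (h : v ∈ V) :
    nodeId V v < V.length :=
  List.idxOf_lt_length_of_mem h

open Classical in
theorem node_nodeId {V : List (List (Option α))} {v : List (Option α)} (h : v ∈ V) :
    node V (nodeId V v) = v := by
  rw [node, List.getD_eq_getElem _ _ (nodeId_lt h)]
  exact List.getElem_idxOf _

open Classical in
theorem nodeId_node {V : List (List (Option α))} (hV : V.Nodup) {i : ℕ} (h : i < V.length) :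
    nodeId V (node V i) = i := by
  rw [node, List.getD_eq_getElem _ _ h]
  exact hV.idxOf_getElem i h

theorem node_mem {V : List (List (Option α))} {i : ℕ} (h : i < V.length) : node V i ∈ V := by
  rw [node, List.getD_eq_getElem _ _ h]
  exact List.getElem_mem h

/-- The hypotheses on an instance of Merge that concern the trees. -/
structure Instance (w : List α) (γ : Interval) (K : List Interval) (V : List (List (Option α)))
    (U : Interval → List (List (Option α))) : Prop where
  lo : 1 ≤ γ.lo
  le : γ.lo ≤ γ.hi
  hi : γ.hi ≤ w.length
  sub : ∀ l ∈ K, l.Sub γ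
  ne : ∀ l ∈ K, l.lo ≤ l.hi
  V : Enumerates w γ V
  U : ∀ l ∈ K, Enumerates w l (U l)

/-- The edge of `T(l)` that leads to `u`, viewed as a vertical path of `T(γ)`. Weight `0` encodes an
infinite quasigap. -/
noncomputable def nodeItem (w : List α) (V : List (List (Option α))) (l : Interval)
    (u : List (Option α)) : Item :=
  ⟨nodeId V u, nodeId V (parent w l u), encodeGap (quasigap w u l)⟩

namespace Instance

variable {w : List α} {γ : Interval} {K : List Interval} {V : List (List (Option α))}
  {U : Interval → List (List (Option α))}

theorem nil_mem (h : Instance w γ K V U) : [] ∈ V := (h.V.2 _).2 isExplicit_nil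

theorem parent_mem (h : Instance w γ K V U) (v : List (Option α)) : parent w γ v ∈ V :=
  (h.V.2 _).2 IsExplicit.parent

theorem mem_of_mem (h : Instance w γ K V U) {l : Interval} (hl : l ∈ K) {u : List (Option α)}
    (hu : u ∈ U l) : u ∈ V :=
  (h.V.2 _).2 ((((h.U l hl).2 u).1 hu).of_sub (h.sub l hl))

theorem parent_mem' (h : Instance w γ K V U) {l : Interval} (hl : l ∈ K) (u : List (Option α)) :
    parent w l u ∈ V :=
  (h.V.2 _).2 (IsExplicit.parent.of_sub (h.sub l hl))

theorem node_ne_nil (h : Instance w γ K V U) {v : ℕ} (hv : v < V.length)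
    (hr : v ≠ nodeId V []) : node V v ≠ [] := fun e => by
  rw [← e, nodeId_node h.V.1 hv] at hr
  exact hr rfl

theorem node_inj (h : Instance w γ K V U) {u v : ℕ} (hu : u < V.length) (hv : v < V.length)
    (e : node V u = node V v) : u = v := by
  rw [← nodeId_node h.V.1 hu, e, nodeId_node h.V.1 hv]

/-- The input for the algorithm on trees. -/
noncomputable def tree (h : Instance w γ K V U) (m : ℕ) : TreeInput where
  n := V.length
  root := nodeId V []
  par v := nodeId V (parent w γ (node V v))
  le a v := node V a <+: node V v
  rank v := (node V v).length
  root_lt := nodeId_lt h.nil_mem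
  par_lt v _ := nodeId_lt (h.parent_mem _)
  par_root := by rw [node_nodeId h.nil_mem, parent_nil]
  rank_lt v hv hr := by
    rw [node_nodeId (h.parent_mem _)]
    exact (parent_spec (h.node_ne_nil hv hr)).1
  le_iff a v ha hv := by
    rw [node_nodeId (h.parent_mem _)]
    constructor
    · intro h1
      by_cases e : node V a = node V v
      · exact Or.inl (h.node_inj ha hv e)
      · refine Or.inr ⟨?_, prefix_parent ((h.V.2 _).1 (node_mem ha)) h1 e⟩
        rintro rfl
        rw [node_nodeId h.nil_mem] at h1 e
        exact e (List.prefix_nil.1 h1)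
    · rintro (rfl | ⟨-, h1⟩)
      · exact List.prefix_refl _
      · exact h1.trans parent_prefix
  len v := nodeLength (node V v)
  items := K.flatMap fun l => (U l).map (nodeItem w V l)
  K := K.length
  m := m
  item_ok := by
    intro it hit
    obtain ⟨l, hl, hit⟩ := List.mem_flatMap.1 hit
    obtain ⟨u, hu, rfl⟩ := List.mem_map.1 hit
    refine ⟨nodeId_lt (h.mem_of_mem hl hu), nodeId_lt (h.parent_mem' hl u), ?_⟩
    simp only [nodeItem]
    rw [node_nodeId (h.mem_of_mem hl hu), node_nodeId (h.parent_mem' hl u)]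
    exact parent_prefix

end Instance

end Words

/-! ### Counting in concatenated lists -/

section Lists

variable {ι β : Type*}

theorem countP_le_one {L : List β} (hL : L.Nodup) {p : β → Bool}
    (h : ∀ a ∈ L, ∀ b ∈ L, p a → p b → a = b) : L.countP p ≤ 1 := by
  induction L with
  | nil => simp
  | cons a L ih =>
    have h1 := ih hL.of_cons fun x hx y hy =>
      h x (List.mem_cons_of_mem _ hx) y (List.mem_cons_of_mem _ hy)
    rw [List.countP_cons]
    split_ifs with ha
    · rw [List.countP_eq_zero.2]
      intro b hb hpb
      have := h a List.mem_cons_self b (List.mem_cons_of_mem _ hb) ha hpb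
      exact (List.nodup_cons.1 hL).1 (this ▸ hb)
    · exact h1

/-- If each block of a list contains at most one element with the property `p`, then the number of
these elements is the number of blocks if and only if each block contains one. -/
theorem countP_flatMap_eq_length_iff {K : List ι} {f : ι → List β} {p : β → Bool}
    (h : ∀ l ∈ K, (f l).countP p ≤ 1) :
    (K.flatMap f).countP p = K.length ↔ ∀ l ∈ K, ∃ x ∈ f l, p x := by
  suffices H : (K.flatMap f).countP p ≤ K.length ∧
      ((K.flatMap f).countP p = K.length ↔ ∀ l ∈ K, ∃ x ∈ f l, p x) from H.2
  induction K with
  | nil => simp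
  | cons l K ih =>
    obtain ⟨h1, h2⟩ := ih fun x hx => h x (List.mem_cons_of_mem _ hx)
    have h3 := h l List.mem_cons_self
    have h4 : (∃ x ∈ f l, p x) ↔ (f l).countP p = 1 := by
      rw [← List.countP_pos_iff]; omega
    simp only [List.flatMap_cons, List.countP_append, List.length_cons, List.forall_mem_cons, h4]
    rw [← h2]
    omega

end Lists

/-! ### Quasigaps in terms of the data of the tree algorithm -/

section Words

variable {α : Type}

/-- Density requires `1 ≤ g`. It is this positivity that leaves the word `0` free to encode `∞`. -/
theorem quasigap_pos {w : List α} {v : List (Option α)} {γ : Interval} : quasigap w v γ ≠ 0 := by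
  intro h
  have := (quasigap_le_iff (w := w) (v := v) (γ := γ) (g := 0)).1 (by simp [h])
  have := this.1.1
  omega

theorem quasigap_le_iff_encodeGap {w : List α} {v : List (Option α)} {γ : Interval} {g : ℕ} :
    quasigap w v γ ≤ (g : ℕ∞) ↔
      0 < encodeGap (quasigap w v γ) ∧ encodeGap (quasigap w v γ) ≤ g := by
  have h := quasigap_pos (w := w) (v := v) (γ := γ)
  revert h
  cases quasigap w v γ with
  | top => simp [encodeGap]
  | coe x =>
    simp only [encodeGap, ENat.toNat_natCast, Nat.cast_le, ne_eq, Nat.cast_eq_zero]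
    omega

/-- Needed for edges that end above the node under consideration: their weights are dominated by the
length of its parent. -/
theorem encodeGap_le (w : List α) (v : List (Option α)) (γ : Interval) :
    encodeGap (quasigap w v γ) ≤ nodeLength v := by
  rcases Nat.eq_zero_or_pos (encodeGap (quasigap w v γ)) with h | h
  · omega
  · have h1 := quasigap_le_iff.1 (quasigap_le_iff_encodeGap.2 ⟨h, le_rfl⟩)
    refine (quasigap_le_iff_encodeGap.1 (quasigap_le_iff.2 ?_)).2
    refine ⟨?_, ?_⟩
    · rw [min_self]
      obtain ⟨⟨h2, e, he, h3, h4, h5⟩, -⟩ := h1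
      refine ⟨by omega, e, he, h3, by omega, fun p hp hp' => ?_⟩
      obtain ⟨q, hq, hq'⟩ := h5 p hp hp'
      exact ⟨q, hq, by omega⟩
    · omega

namespace Instance

variable {w : List α} {γ : Interval} {K : List Interval} {V : List (List (Option α))}
  {U : Interval → List (List (Option α))}

theorem le_nodeId (h : Instance w γ K V U) (m : ℕ) {l : Interval} (hl : l ∈ K)
    {u : List (Option α)} (hu : u ∈ U l) (v : ℕ) :
    (h.tree m).le v (nodeItem w V l u).u ↔ node V v <+: u := by
  simp only [tree, nodeItem]
  rw [node_nodeId (h.mem_of_mem hl hu)]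

theorem le_parent (h : Instance w γ K V U) (m : ℕ) {l : Interval} (hl : l ∈ K)
    (u : List (Option α)) (v : ℕ) :
    (h.tree m).le v (nodeItem w V l u).p ↔ node V v <+: parent w l u := by
  simp only [tree, nodeItem]
  rw [node_nodeId (h.parent_mem' hl u)]

open Classical in
-- Covers are unique, so each interval contributes at most one path through `v`. The additional
-- predicate `p` allows one statement for all paths and for those of positive weight.
theorem countP_block_le (h : Instance w γ K V U) (m : ℕ) (v : ℕ) {l : Interval} (hl : l ∈ K)
    (p : Item → Bool) : ((U l).map (nodeItem w V l)).countP (fun it =>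
      decide ((h.tree m).le v it.u ∧ ¬ (h.tree m).le v it.p) && p it) ≤ 1 := by
  rw [List.countP_map]
  refine countP_le_one (h.U l hl).1 fun a ha b hb h1 h2 => ?_
  simp only [Function.comp_apply, Bool.and_eq_true, decide_eq_true_eq, h.le_nodeId m hl ha,
    h.le_nodeId m hl hb, h.le_parent m hl] at h1 h2
  exact Covers.unique (h.ne l hl) ⟨((h.U l hl).2 a).1 ha, h1.1.1, h1.1.2⟩
    ⟨((h.U l hl).2 b).1 hb, h2.1.1, h2.1.2⟩

theorem cov_fin_iff (h : Instance w γ K V U) (m v : ℕ) :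
    (h.tree m).cov (h.tree m).fin v = (h.tree m).K ↔
      ∀ l ∈ K, ∃ u, Covers w l (node V v) u ∧ 0 < encodeGap (quasigap w u l) := by
  classical
  simp only [Arbor.cov, TreeInput.fin]
  rw [List.countP_filter, show (h.tree m).items = K.flatMap fun l => (U l).map (nodeItem w V l)
    from rfl, show (h.tree m).K = K.length from rfl,
    countP_flatMap_eq_length_iff fun l hl => h.countP_block_le m v hl _]
  refine forall₂_congr fun l hl => ?_
  simp only [List.mem_map, exists_exists_and_eq_and, Bool.and_eq_true, decide_eq_true_eq]
  constructor
  · rintro ⟨u, hu, ⟨h1, h2⟩, h3⟩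
    exact ⟨u, ⟨((h.U l hl).2 u).1 hu, (h.le_nodeId m hl hu v).1 h1,
      fun h4 => h2 ((h.le_parent m hl u v).2 h4)⟩, h3⟩
  · rintro ⟨u, ⟨h1, h2, h3⟩, h4⟩
    have hu := ((h.U l hl).2 u).2 h1
    exact ⟨u, hu, ⟨(h.le_nodeId m hl hu v).2 h2,
      fun h5 => h3 ((h.le_parent m hl u v).1 h5)⟩, h4⟩

/-- The root has to be excluded: a path stops below its upper end, so none contains the root. -/
theorem full_iff (h : Instance w γ K V U) (m : ℕ) {v : ℕ} (hv : v < V.length)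
    (hr : v ≠ nodeId V []) : (h.tree m).Full v ↔ ∀ l ∈ K, IsNode w l (node V v) := by
  classical
  have hb : ∀ l ∈ K, ((U l).map (nodeItem w V l)).countP (fun it =>
      decide ((h.tree m).le v it.u ∧ ¬ (h.tree m).le v it.p)) ≤ 1 := fun l hl => by
    simpa using h.countP_block_le m v hl fun _ => true
  simp only [TreeInput.Full, Arbor.cov]
  rw [show (h.tree m).items = K.flatMap fun l => (U l).map (nodeItem w V l) from rfl,
    show (h.tree m).K = K.length from rfl, countP_flatMap_eq_length_iff hb]
  refine forall₂_congr fun l hl => ?_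
  simp only [List.mem_map, exists_exists_and_eq_and, decide_eq_true_eq]
  constructor
  · rintro ⟨u, hu, h1, -⟩
    exact ((((h.U l hl).2 u).1 hu).isNode (h.ne l hl)).of_prefix ((h.le_nodeId m hl hu v).1 h1)
  · intro h1
    obtain ⟨u, h2, h3, h4⟩ := exists_covers (h.node_ne_nil hv hr) h1
    have hu := ((h.U l hl).2 u).2 h2
    exact ⟨u, hu, (h.le_nodeId m hl hu v).2 h3, fun h5 => h4 ((h.le_parent m hl u v).1 h5)⟩

theorem node_par (h : Instance w γ K V U) (m v : ℕ) :
    node V ((h.tree m).par v) = parent w γ (node V v) :=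
  node_nodeId (h.parent_mem _)

theorem explicit_node (h : Instance w γ K V U) {v : ℕ} (hv : v < V.length) :
    IsExplicit w γ (node V v) := (h.V.2 _).1 (node_mem hv)

/-- Occurrences of a node are occurrences of its prefixes, whence `up`. For `br`, two full children
of `y` occur in every interval and diverge at `y`; so `y` is a branching node of every `T(l)` and
cannot lie strictly inside an edge. -/
theorem good (h : Instance w γ K V U) (m : ℕ) : (h.tree m).Good where
  up v hv hr hf hp := by
    rw [h.full_iff m hv hr] at hf
    rw [h.full_iff m ((h.tree m).par_lt v hv) hp]
    intro l hl
    refine (hf l hl).of_prefix ?_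
    rw [h.node_par]
    exact parent_prefix
  br it hit y hy hcf hyu hne := by
    obtain ⟨l, hl, hit⟩ := List.mem_flatMap.1 hit
    obtain ⟨u, hu, rfl⟩ := List.mem_map.1 hit
    rw [h.le_nodeId m hl hu] at hyu
    rw [h.le_parent m hl]
    have hyu' : node V y ≠ u := by
      rintro e
      refine hne ?_
      simp only [nodeItem]
      rw [← e, nodeId_node h.V.1 hy]
    obtain ⟨a, ha, b, hb, hab⟩ := Finset.one_lt_card.1 (show 1 < _ from hcf)
    obtain ⟨⟨ha1, ha2, ha3⟩, ha4⟩ := by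
      simpa only [Finset.mem_filter, Arbor.mem_children] using ha
    obtain ⟨⟨hb1, hb2, hb3⟩, hb4⟩ := by
      simpa only [Finset.mem_filter, Arbor.mem_children] using hb
    rw [h.full_iff m ha1 ha2] at ha4
    rw [h.full_iff m hb1 hb2] at hb4
    have ea := h.node_par m a
    have eb := h.node_par m b
    rw [ha3] at ea
    rw [hb3] at eb
    have ha5 := h.explicit_node ha1
    have hb5 := h.explicit_node hb1
    have ha6 := h.node_ne_nil ha1 ha2
    have hb6 := h.node_ne_nil hb1 hb2
    have key : ∀ {x y : List (Option α)}, IsExplicit w γ x → y ≠ [] → parent w γ y = parent w γ x →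
        x ≠ [] → x ≠ y → ¬ x <+: y := by
      intro x y hx _ e hx' hne hxy
      have h1 := (prefix_parent hx hxy hne).length_le
      rw [e] at h1
      have := (parent_spec (w := w) (γ := γ) hx').1
      omega
    have hab' : node V a ≠ node V b := fun e => hab (h.node_inj ha1 hb1 e)
    obtain ⟨c, z, z', hz, h1, h2⟩ := exists_diverge
      (key ha5 hb6 (eb.symm.trans ea) ha6 hab') (key hb5 ha6 (ea.symm.trans eb) hb6 hab'.symm)
    -- The divergence point is explicit in `T(γ)` and properly above the child `a`, hence not below
    -- the parent `y`; and it is not above `y`, which is a prefix of both children.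
    have hc : node V y = c := by
      refine isPrefix_antisymm ?_ ?_
      · refine prefix_of_diverge hz h1 h2 ?_ ?_
        · rw [ea]; exact parent_prefix
        · rw [eb]; exact parent_prefix
      · rw [ea]
        refine prefix_parent (isExplicit_of_diverge (ha5.isNode h.le) (hb5.isNode h.le) hz h1 h2)
          ((List.prefix_append _ _).trans h1) ?_
        rintro rfl
        simpa using h1.length_le
    refine prefix_parent ?_ hyu hyu'
    rw [hc]
    exact isExplicit_of_diverge (ha4 l hl) (hb4 l hl) hz h1 h2

/-- The characterization of small quasigaps in terms of the data of the tree algorithm. -/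
theorem quasigap_le_iff (h : Instance w γ K V U) {m : ℕ} {F : List (List α)} (hm : 1 ≤ m)
    (hmN : m ≤ γ.length) (hF : IsFactorization (subword w γ) F) (hK : IsReducedStaircase γ m F K)
    {v : ℕ} (hv : v < V.length) (hr : v ≠ nodeId V []) {g : ℕ} (hg : g ≤ m) :
    quasigap w (node V v) γ ≤ (g : ℕ∞) ↔ (h.tree m).cov (h.tree m).fin v = (h.tree m).K ∧
      nodeLength (parent w γ (node V v)) + 1 ≤ min g (nodeLength (node V v)) ∧
      (h.tree m).Bound v (min g (nodeLength (node V v))) := by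
  have hne := h.node_ne_nil hv hr
  have hex := h.explicit_node hv
  have hnode := hex.isNode h.le
  rw [quasigap_le_iff_forall ⟨h.lo, h.le, h.hi⟩ hm hmN hF hK hnode hne hg, h.cov_fin_iff]
  rw [← and_assoc, and_comm (a := ∀ l ∈ K, _), and_assoc]
  refine and_congr_right fun hp => ?_
  set g' := min g (nodeLength (node V v)) with hg'
  -- The condition on the parent of `u` in `l` is automatic, since that parent is a prefix of the
  -- parent of `v` in `γ`; and the minimum with `|u|` is inactive because `v` is a prefix of `u`.
  have hcov : ∀ l ∈ K, ∀ u, Covers w l (node V v) u →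
      (Dense (occ w (node V v) l) l g' ↔ quasigap w u l ≤ (g' : ℕ∞)) := by
    intro l hl u hu
    have h1 := nodeLength_mono hu.pre
    have h2 : parent w l u <+: parent w γ (node V v) := by
      refine prefix_parent (IsExplicit.parent.of_sub (h.sub l hl)) hu.parent_prefix fun e => ?_
      exact hu.par (e ▸ List.prefix_refl _)
    have h3 := nodeLength_mono h2
    rw [SeedMerge.quasigap_le_iff, hu.occ_eq (h.ne l hl),
      show min g' (nodeLength u) = g' by omega]
    exact ⟨fun h4 => ⟨h4, by omega⟩, fun h4 => h4.1⟩
  constructor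
  · intro hd
    have hall : ∀ l ∈ K, ∃ u, Covers w l (node V v) u ∧ quasigap w u l ≤ (g' : ℕ∞) := by
      intro l hl
      obtain ⟨u, hu⟩ := exists_covers hne (hd l hl).nonempty
      exact ⟨u, hu, (hcov l hl u hu).1 (hd l hl)⟩
    refine ⟨fun l hl => ?_, ?_⟩
    · obtain ⟨u, h1, h2⟩ := hall l hl
      exact ⟨u, h1, (quasigap_le_iff_encodeGap.1 h2).1⟩
    · rintro it hit ⟨a, ⟨ha1, ha2, ha3⟩, -, ha5, ha6⟩
      obtain ⟨l, hl, hit⟩ := List.mem_flatMap.1 hit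
      obtain ⟨u, hu, rfl⟩ := List.mem_map.1 hit
      obtain ⟨u', h1, h2⟩ := hall l hl
      have hue := ((h.U l hl).2 u).1 hu
      rw [h.le_nodeId m hl hu] at ha5
      have hpa : parent w l u <+: node V a ∧ ¬ node V a <+: parent w l u := by
        have e := h.node_par m a
        rw [ha3] at e
        simp only [nodeItem] at e
        rw [node_nodeId (h.parent_mem' hl u)] at e
        have := (parent_spec (w := w) (γ := γ) (h.node_ne_nil ha1 ha2)).1
        rw [← e] at this
        refine ⟨e ▸ parent_prefix, fun h3 => ?_⟩
        have := h3.length_le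
        omega
      -- A relevant path passes through `v`, ends above `v`, or branches off. In the first case `u`
      -- is the cover of `v`, whose weight is bounded.
      by_cases h3 : node V v <+: u
      · have h4 : Covers w l (node V v) u :=
          ⟨hue, h3, fun h4 => hpa.2 (List.IsPrefix.trans ha6 h4)⟩
        rw [h4.unique (h.ne l hl) h1]
        exact (quasigap_le_iff_encodeGap.1 h2).2
      by_cases h4 : u <+: node V v
      -- The path ends above `v`: its weight is at most `|u|`, hence at most the length of the
      -- parent of `v`.
      · have h5 : u <+: parent w γ (node V v) :=
          prefix_parent (hue.of_sub (h.sub l hl)) h4 fun e => h3 (e ▸ List.prefix_refl _)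
        have h6 := nodeLength_mono h5
        have h7 := encodeGap_le w u l
        simp only [nodeItem]
        omega
      · exfalso
        -- Branching off is impossible: as `v` occurs in `l`, the point `c` would be an explicit
        -- node of `T(l)` below the top `a` of the path and properly above `u`, that is, strictly
        -- inside an edge.
        obtain ⟨c, z, z', hz, h5, h6⟩ := exists_diverge h4 h3
        have h7 := prefix_of_diverge hz h5 h6 ha5 ha6
        refine hpa.2 (h7.trans (prefix_parent (isExplicit_of_diverge (hue.isNode (h.ne l hl))
          (hd l hl).nonempty hz h5 h6) ((List.prefix_append _ _).trans h5) ?_))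
        rintro rfl
        simpa using h5.length_le
  · rintro ⟨hc, hb⟩ l hl
    obtain ⟨u, h1, h2⟩ := hc l hl
    refine (hcov l hl u h1).2 (quasigap_le_iff_encodeGap.2 ⟨h2, ?_⟩)
    have hu := ((h.U l hl).2 u).2 h1.explicit
    have hPm := h.parent_mem' hl u
    have hP : (h.tree m).le (nodeId V (parent w l u)) v := by
      simp only [tree]
      rw [node_nodeId hPm]
      exact h1.parent_prefix
    -- The top node of the edge through `v`. It is full because it is a prefix of `v`, which occurs
    -- in every interval; so the weight of the edge is relevant for `v`.
    obtain ⟨a, ha, hav⟩ := (h.tree m).exists_child (nodeId_lt hPm) hv hP (by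
      rintro rfl
      rw [node_nodeId hPm] at h1
      exact h1.par (List.prefix_refl _))
    refine hb (nodeItem w V l u) (List.mem_flatMap.2 ⟨l, hl, List.mem_map.2 ⟨u, hu, rfl⟩⟩)
      ⟨a, ha, ?_, ?_, hav⟩
    · rw [h.full_iff m ha.1 ha.2.1]
      intro l' hl'
      obtain ⟨u', h3, -⟩ := hc l' hl'
      exact (h3.explicit.isNode (h.ne l' hl')).of_prefix (List.IsPrefix.trans hav h3.pre)
    · rw [h.le_nodeId m hl hu]
      exact List.IsPrefix.trans hav h1.pre

/-- The inequalities `quasigap ≤ g` for all `g ≤ m` determine the reported value, which is the least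
such `g` or `0`. The root has length `0` and hence an infinite quasigap. -/
theorem smallQuasigap_eq (h : Instance w γ K V U) {m : ℕ} {F : List (List α)} (hm : 1 ≤ m)
    (hmN : m ≤ γ.length) (hF : IsFactorization (subword w γ) F) (hK : IsReducedStaircase γ m F K)
    {v : ℕ} (hv : v < V.length) {Q : ℕ} (hQ : ∀ x, Q ≤ x ↔ (h.tree m).Bound v x) :
    smallQuasigap w γ m (node V v) =
      if v = (h.tree m).root then 0 else (h.tree m).out Q v := by
  by_cases hr : v = nodeId V []
  · rw [if_pos (show v = (h.tree m).root from hr), hr, node_nodeId h.nil_mem, smallQuasigap,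
      if_neg]
    intro h1
    have := ((SeedMerge.quasigap_le_iff (w := w) (γ := γ) (v := [])).1 h1).1.1
    simp [nodeLength] at this
  rw [if_neg (show ¬ v = (h.tree m).root from hr)]
  have key : ∀ g, g ≤ m → (quasigap w (node V v) γ ≤ (g : ℕ∞) ↔
      (h.tree m).cov (h.tree m).fin v = (h.tree m).K ∧
      max ((h.tree m).len ((h.tree m).par v) + 1) Q ≤ min g ((h.tree m).len v)) := by
    intro g hg
    rw [h.quasigap_le_iff hm hmN hF hK hv hr hg, ← hQ, max_le_iff]
    simp only [show (h.tree m).len v = nodeLength (node V v) from rfl,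
      show (h.tree m).len ((h.tree m).par v) = nodeLength (node V ((h.tree m).par v)) from rfl,
      h.node_par]
  rw [TreeInput.out, smallQuasigap]
  set X := max ((h.tree m).len ((h.tree m).par v) + 1) Q
  by_cases hc : (h.tree m).cov (h.tree m).fin v = (h.tree m).K ∧ X ≤ (h.tree m).m ∧
      X ≤ (h.tree m).len v
  · have hXm : X ≤ m := hc.2.1
    have h1 := (key X hXm).2 ⟨hc.1, le_min le_rfl hc.2.2⟩
    rw [if_pos hc, if_pos (h1.trans (Nat.cast_le.2 hXm))]
    have h2 := quasigap_le_iff_encodeGap.1 h1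
    refine le_antisymm h2.2 ?_
    have h3 := (key _ (h2.2.trans hXm)).1 (quasigap_le_iff_encodeGap.2 ⟨h2.1, le_rfl⟩)
    exact h3.2.trans (min_le_left _ _)
  · rw [if_neg hc, if_neg]
    intro h1
    have h2 := (key m le_rfl).1 h1
    exact hc ⟨h2.1, h2.2.trans (min_le_left _ _), h2.2.trans (min_le_right _ _)⟩

end Instance

end Words

/-! ## The program -/

/-- The instructions that compute the base address of the records. -/
def prelude : Program :=
  [.const 4 0, .load 5 4, .const 4 1, .load 6 4, .add 6 6 4, .sub 6 6 5, .const 7 1000,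
    .mul 2 6 7, .const 3 16]

/-- The code of `mergeCmd` is placed at `9`, the length of `prelude`. -/
def program : Program := prelude ++ mergeCmd.comp 9

theorem holds_getD (l : List ℕ) : Holds (fun a => l.getD a 0) 0 l := by
  intro i hi
  rw [Nat.zero_add]
  exact List.getD_eq_getElem _ _ hi

theorem flatMap_getD {β : Type} (V : List β) (f : β → List ℕ) (hf : ∀ v ∈ V, (f v).length = 3)
    {inp : ℕ → ℕ} {pos : ℕ} (h : Holds inp pos (V.flatMap f)) {v : ℕ} (hv : v < V.length) :
    Holds inp (pos + 3 * v) (f V[v]) := by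
  induction V generalizing pos v with
  | nil => simp at hv
  | cons a V ih =>
    rw [List.flatMap_cons, holds_append, hf a List.mem_cons_self] at h
    cases v with
    | zero => exact h.1
    | succ v =>
      have := ih (fun x hx => hf x (List.mem_cons_of_mem _ hx)) h.2 (v := v) (by simpa using hv)
      rw [List.getElem_cons_succ]
      convert this using 1
      omega

/-- The machine register `2` receives `1000` times the length of `γ`, which will be the base address
of the records; the memory is left unchanged. -/
theorem run_prelude {W : ℕ} {input : List ℕ} {N : ℕ}
    (hlt : ∀ a, input.getD a 0 < 2 ^ W) (h1 : input.getD 1 0 + 1 < 2 ^ W)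
    (hN : input.getD 1 0 + 1 - input.getD 0 0 = N) (hW : 1000 * N < 2 ^ W) (hW' : 1000 < 2 ^ W) :
    (run W program 9 (initial input)).pc = 9 ∧
      (run W program 9 (initial input)).mem = (fun a => input.getD a 0) ∧
      (run W program 9 (initial input)).reg 2 = 1000 * N ∧
      (run W program 9 (initial input)).reg 3 = 16 ∧
      ∀ x, (run W program 9 (initial input)).reg x < 2 ^ W := by
  have hn : N < 2 ^ W := by omega
  have m1 : 1 % 2 ^ W = 1 := Nat.mod_eq_of_lt (by omega)
  have m2 : 16 % 2 ^ W = 16 := Nat.mod_eq_of_lt (by omega)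
  have m3 : 1000 % 2 ^ W = 1000 := Nat.mod_eq_of_lt hW'
  have m4 : 1000 * N % 2 ^ W = 1000 * N := Nat.mod_eq_of_lt hW
  have m5 := Nat.mod_eq_of_lt h1
  have m6 := fun a => Nat.mod_eq_of_lt (hlt a)
  have m7 := Nat.mod_eq_of_lt hn
  have e : run W program 9 (initial input) =
      Instr.exec W (Instr.exec W (Instr.exec W (Instr.exec W (Instr.exec W (Instr.exec W
        (Instr.exec W (Instr.exec W (Instr.exec W (initial input) (.const 4 0)) (.load 5 4))
        (.const 4 1)) (.load 6 4)) (.add 6 6 4)) (.sub 6 6 5)) (.const 7 1000)) (.mul 2 6 7))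
        (.const 3 16) := by
    simp only [run_succ, run_zero]
    iterate 9 rw [step_of_getElem? rfl]
  rw [e]
  refine ⟨rfl, rfl, ?_, ?_, fun x => ?_⟩
  · simp [-List.getD_eq_getElem?_getD, Instr.exec, Config.setReg, initial, m1, m3, m5, m6, hN, m7]
    rw [mul_comm, m4]
  · simp [Instr.exec, Config.setReg, m2]
  · have : 0 < 2 ^ W := by omega
    simp only [Instr.exec, Config.setReg, Function.update_apply]
    split_ifs
    all_goals first | exact Nat.mod_lt _ this | exact this

/-! ### Size of the input and correctness of the program -/

section Words

variable {α : Type}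

/-- The blocks of the input. -/
noncomputable def inputBlocks (w : List α) (K : List Interval) (V : List (List (Option α)))
    (U : Interval → List (List (Option α))) : List Block :=
  K.map fun l => ⟨l.lo, l.hi, (U l).map (nodeItem w V l)⟩

theorem inputBlocks_enc (w : List α) (K : List Interval) (V : List (List (Option α)))
    (U : Interval → List (List (Option α))) :
    (inputBlocks w K V U).flatMap Block.enc = K.flatMap fun l => encodeSubtree w V l (U l) := by
  simp only [inputBlocks, List.flatMap_map, Block.enc, encodeSubtree, List.length_map, Item.enc,
    nodeItem]

theorem inputBlocks_items (w : List α) (K : List Interval) (V : List (List (Option α)))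
    (U : Interval → List (List (Option α))) : (inputBlocks w K V U).flatMap Block.items =
      K.flatMap fun l => (U l).map (nodeItem w V l) := by
  simp only [inputBlocks, List.flatMap_map]

theorem totalLength_cons (l : Interval) (K : List Interval) :
    totalLength (l :: K) = l.length + totalLength K := by simp [totalLength]

theorem length_items_le {w : List α} {K : List Interval} {V : List (List (Option α))}
    {U : Interval → List (List (Option α))} (h : ∀ l ∈ K, (U l).length ≤ 2 * l.length + 1) :
    (K.flatMap fun l => (U l).map (nodeItem w V l)).length ≤ 2 * totalLength K + K.length ∧
    (K.flatMap fun l => encodeSubtree w V l (U l)).length ≤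
      6 * totalLength K + 6 * K.length := by
  induction K with
  | nil => simp [totalLength]
  | cons l K ih =>
    have h1 := ih fun x hx => h x (List.mem_cons_of_mem _ hx)
    have h2 := h l List.mem_cons_self
    have h3 : (encodeSubtree w V l (U l)).length = 3 + 3 * (U l).length := by
      simp only [encodeSubtree, List.length_cons, List.length_flatMap, List.length_nil,
        List.map_const', List.sum_replicate, smul_eq_mul]
      omega
    simp only [List.flatMap_cons, List.length_append, List.length_map, totalLength_cons,
      List.length_cons, h3]
    omega

theorem nodeLength_le {w : List α} {γ : Interval} {v : List (Option α)} (hγ : γ.hi ≤ w.length)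
    (h : IsNode w γ v) : nodeLength v ≤ w.length := by
  obtain ⟨k, hk⟩ := h
  rw [mem_occ] at hk
  have h1 := nodeLength_mono hk.2
  rw [nodeLength_markedSuffix (hk.1.2.trans hγ)] at h1
  omega

open Classical in
theorem leafLabel_le {w : List α} {γ : Interval} (v : List (Option α)) (hγ : γ.hi ≤ w.length) :
    leafLabel w γ v ≤ w.length := by
  rw [leafLabel]
  split_ifs with h
  · exact h.choose_spec.2.1.trans hγ
  · exact Nat.zero_le _

theorem Instance.input_le {w : List α} {γ : Interval} {K : List Interval}
    {V : List (List (Option α))} {U : Interval → List (List (Option α))}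
    (h : Instance w γ K V U) {m b : ℕ} (h1 : w.length ≤ b) (h2 : m ≤ b) (h3 : V.length ≤ b)
    (h4 : K.length ≤ b) (h5 : ∀ l ∈ K, (U l).length ≤ b) :
    ∀ x ∈ mergeInput w γ m K V U, x ≤ b := by
  have hlo := h.lo
  have hle := h.le
  have hhi := h.hi
  intro x hx
  simp only [mergeInput, encodeTree, encodeSubtree, List.mem_append, List.mem_cons,
    List.mem_flatMap, List.not_mem_nil, or_false] at hx
  rcases hx with ((rfl | rfl | rfl) | rfl | ⟨v, hv, rfl | rfl | rfl⟩) | rfl |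
    ⟨l, hl, rfl | rfl | rfl | ⟨u, hu, rfl | rfl | rfl⟩⟩
  · omega
  · omega
  · exact h2
  · exact h3
  · exact (nodeId_lt (h.parent_mem v)).le.trans h3
  · exact (nodeLength_le h.hi (((h.V.2 v).1 hv).isNode h.le)).trans h1
  · exact (leafLabel_le v h.hi).trans h1
  · exact h4
  · have := (h.sub l hl).2
    have := h.ne l hl
    omega
  · have := (h.sub l hl).2
    omega
  · exact h5 l hl
  · exact (nodeId_lt (h.mem_of_mem hl hu)).le.trans h3
  · exact (nodeId_lt (h.parent_mem' hl u)).le.trans h3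
  · have hl' := (h.sub l hl).2
    exact ((encodeGap_le w u l).trans (nodeLength_le (hl'.trans h.hi)
      (((h.U l hl).2 u).1 hu |>.isNode (h.ne l hl)))).trans h1

theorem length_treeEntries (w : List α) (γ : Interval) (V L : List (List (Option α))) :
    (L.flatMap fun v => [nodeId V (parent w γ v), nodeLength v, leafLabel w γ v]).length =
      3 * L.length := by
  simp [mul_comm]

theorem program_correct {w : List α} {γ : Interval} {m : ℕ} {F : List (List α)}
    {K : List Interval} {V : List (List (Option α))} {U : Interval → List (List (Option α))} {W : ℕ}
    (hγ : IsIntervalOf w γ) (hm : 1 ≤ m) (hmN : m ≤ γ.length)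
    (hF : IsFactorization (subword w γ) F) (hK : IsReducedStaircase γ m F K)
    (hV : Enumerates w γ V) (hU : ∀ l ∈ K, Enumerates w l (U l))
    (hW : 100000 * w.length ≤ 2 ^ W) :
    ∃ t, t ≤ 100000 * (γ.length + totalLength K) ∧
      (run W program t (initial (mergeInput w γ m K V U))).Halted program ∧
      ∀ (k : ℕ) (hk : k < V.length), (run W program t
        (initial (mergeInput w γ m K V U))).mem k = smallQuasigap w γ m V[k] := by
  obtain ⟨g1, g2, g3⟩ := id hγ
  have hN : γ.length = γ.hi + 1 - γ.lo := rfl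
  have hst := fun l (hl : l ∈ K) => ((hK.2 l).1 hl).1.bounds hm hmN
  have h : Instance w γ K V U := ⟨g1, g2, g3, fun l hl => ⟨(hst l hl).1, (hst l hl).2.2⟩,
    fun l hl => (hst l hl).2.1, hV, hU⟩
  have hVn := hV.length_le g1 g2
  have hUn : ∀ l ∈ K, (U l).length ≤ 2 * l.length + 1 := fun l hl =>
    (hU l hl).length_le (by have := (hst l hl).1; omega) (hst l hl).2.1
  obtain ⟨hK1, hK2⟩ := hK.length_le hm hmN
  obtain ⟨hI, hE⟩ := length_items_le (w := w) (V := V) hUn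
  have hlen : ∀ l ∈ K, l.length ≤ γ.length := fun l hl => by
    have := hst l hl
    simp only [Interval.length]
    omega
  -- The factor `6` is needed for the number of intervals, which is at most their total length;
  -- positions, lengths and node numbers satisfy smaller bounds.
  have hin := h.input_le (m := m) (b := 6 * w.length) (by omega) (by omega) (by omega) (by omega)
    fun l hl => by have := hUn l hl; have := hlen l hl; omega
  set input := mergeInput w γ m K V U with hinput
  have hget : ∀ a, input.getD a 0 ≤ 6 * w.length := by
    intro a
    by_cases ha : a < input.length
    · rw [List.getD_eq_getElem _ _ ha]
      exact hin _ (List.getElem_mem ha)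
    · rw [List.getD_eq_default _ _ (by omega)]
      omega
  obtain ⟨input', hinput', hh⟩ : ∃ l, input = l ∧ Holds (fun a => input.getD a 0) 0 l :=
    ⟨_, rfl, holds_getD input⟩
  rw [hinput, mergeInput, encodeTree, ← inputBlocks_enc] at hinput'
  rw [← hinput'] at hh
  simp only [List.cons_append, List.nil_append, holds_cons, holds_append, Nat.zero_add,
    Nat.reduceAdd, length_treeEntries] at hh
  obtain ⟨i0, i1, i2, i3, i4, i5, i6⟩ := hh
  rw [show 4 + 3 * V.length + 1 = 5 + 3 * V.length by omega] at i6
  obtain ⟨r1, r2, r3, r4, r5⟩ := run_prelude (W := W) (input := input) (N := γ.length)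
    (fun a => by have := hget a; omega) (by have := hget 1; omega) (by rw [i0, i1]; rfl)
    (by omega) (by omega)
  set cfg := run W program 9 (initial input) with hcfg
  -- The records start beyond the input, where all memory cells still hold `0`; this gives the
  -- initial value `0` of all fields in `σ`.
  have hil : input.length ≤ 1000 * γ.length := by
    rw [hinput, mergeInput, encodeTree]
    simp only [List.length_append, List.length_cons, List.length_nil, length_treeEntries]
    omega
  set σ : St := ⟨fun r => cfg.reg (r + 4), cfg.mem, fun _ _ => 0⟩ with hσ
  have hrel : Rel W (1000 * γ.length) σ cfg := by
    refine ⟨fun _ => rfl, r3, r4, fun _ _ => rfl, fun k _ v => ?_, r5, fun a => ?_⟩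
    · rw [r2]
      exact List.getD_eq_default _ _ (by omega)
    · rw [r2]
      have := hget a
      dsimp only
      omega
  have hinp : σ.inp = fun a => input.getD a 0 := r2
  have hentry : ∀ v (hv : v < V.length), input.getD (4 + 3 * v) 0 = (h.tree m).par v ∧
      input.getD (4 + 3 * v + 1) 0 = (h.tree m).len v := by
    intro v hv
    have h1 := flatMap_getD V _ (fun _ _ => rfl) i4 hv
    simp only [holds_cons] at h1
    refine ⟨h1.1.trans ?_, h1.2.1.trans ?_⟩
    · simp only [Instance.tree, node, List.getD_eq_getElem _ _ hv]
    · simp only [Instance.tree, node, List.getD_eq_getElem _ _ hv]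
  have hblocks := inputBlocks_items w K V U
  have hn : (h.tree m).n = V.length := rfl
  have hit : (h.tree m).items = K.flatMap fun l => (U l).map (nodeItem w V l) := rfl
  have hDK : (h.tree m).K = K.length := rfl
  have hfits : Fits W (1000 * γ.length) (h.tree m) := by
    refine ⟨by rw [hn]; omega, by omega, by rw [hit]; omega, by rw [hn]; omega, fun v hv => ?_,
      fun it hmem => ?_⟩
    · have := nodeLength_le g3 ((h.explicit_node hv).isNode g2)
      simp only [Instance.tree]
      omega
    · obtain ⟨l, hl, hmem⟩ := List.mem_flatMap.1 hmem
      obtain ⟨u, hu, rfl⟩ := List.mem_map.1 hmem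
      have h1 := encodeGap_le w u l
      have h2 := nodeLength_le ((hst l hl).2.2.trans g3) ((((hU l hl).2 u).1 hu).isNode (hst l hl).2.1)
      simp only [nodeItem]
      omega
  have hcode : CodeAt program 9 (mergeCmd.comp 9) := by
    intro i hi
    have hp : prelude.length = 9 := rfl
    rw [program, List.getElem?_append_right (by omega), hp, Nat.add_sub_cancel_left,
      List.getElem?_eq_getElem hi]
  obtain ⟨t, ht, σ', hrel', hpc, Q, hQ, hout⟩ := mergeCmd_tri hfits (h.good m) (σ := σ)
    (inputBlocks w K V U)
    ⟨by rw [hinp]; exact i2, by rw [hinp]; exact i3,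
      fun v hv => by rw [hinp]; exact (hentry v hv).1,
      fun v hv => by rw [hinp]; exact (hentry v hv).2, by rw [hinp]; exact i5⟩
    (fun _ _ _ => rfl) (by rw [hinp]; exact i6) (by simp [inputBlocks, hDK]) hblocks
    (by rw [inputBlocks_enc, hn]; omega) program 9 hcode cfg r1 hrel
  refine ⟨9 + t, ?_, ?_, fun k hk => ?_⟩
  · rw [hn, hit, hDK] at ht
    omega
  · rw [run_add, ← hcfg, Config.Halted, hpc, program, List.length_append, Cmd.length_comp]
    exact le_rfl
  · rw [run_add, ← hcfg, hrel'.inp k (by omega), hout k hk,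
      ← h.smallQuasigap_eq hm hmN hF hK hk (hQ k hk), node, List.getD_eq_getElem _ _ hk]

end Words

end SeedMerge

theorem mainTheorem10 :
    ∃ (P : SeedMerge.Program) (C : ℕ),
      ∀ (α : Type) (w : List α) (γ : SeedMerge.Interval) (m : ℕ) (F : List (List α))
        (K : List SeedMerge.Interval) (V : List (List (Option α)))
        (U : SeedMerge.Interval → List (List (Option α))) (W : ℕ),
        SeedMerge.IsIntervalOf w γ →
        1 ≤ m → m ≤ γ.length →
        SeedMerge.IsFFactorization (SeedMerge.subword w γ) F →
        SeedMerge.IsReducedStaircase γ m F K →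
        SeedMerge.Enumerates w γ V →
        (∀ l ∈ K, SeedMerge.Enumerates w l (U l)) →
        C * w.length ≤ 2 ^ W →
        ∃ t : ℕ, t ≤ C * (γ.length + SeedMerge.totalLength K) ∧
          (SeedMerge.run W P t
            (SeedMerge.initial (SeedMerge.mergeInput w γ m K V U))).Halted P ∧
          ∀ (k : ℕ) (hk : k < V.length),
            (SeedMerge.run W P t
              (SeedMerge.initial (SeedMerge.mergeInput w γ m K V U))).mem k =
              SeedMerge.smallQuasigap w γ m V[k] := by
  refine ⟨SeedMerge.program, 100000, ?_⟩
  intro α w γ m F K V U W hγ hm hmN hF hK hV hU hW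
  exact SeedMerge.program_correct hγ hm hmN hF.1 hK hV hU hW
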